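/- Let $R=\mathbb Z[\tfrac12]$. For a commutative ring $D$ containing $\tfrac12$, let $Vir_D=\bigoplus_{n\in\mathbb Z}D L_n\oplus D C$ be the Virasoro algebra over $D$: $C$ is central and $[L_m,L_n]=(m-n)L_{m+n}+\delta_{m+n,0}\frac{m^3-m}{12}C$. For a field $F$ with $\operatorname{char}F\ne 2$ and $c,h\in F$, let $V(c,h)_F$ be the Verma module over $Vir_F$ with highest weight vector $v_{c,h}$ ($L_nv_{c,h}=0$ for $n>0$, $L_0v_{c,h}=hv_{c,h}$, $Cv_{c,h}=cv_{c,h}$), graded so that $L_{-n_1}\cdots L_{-n_k}v_{c,h}$ has degree $n_1+\cdots+n_k$. Let $W(c,h)_F$ be its maximal graded submodule, that is, the sum of all proper graded submodules, and let $L(c,h)_F=V(c,h)_F/W(c,h)_F$. For $Z=\mathbb Z+\tfrac12$ or $Z=\mathbb Z$, let $A(Z)$ be the associative $R$-algebra generated by $a(n)$, $n\in Z$, with relations $a(m)a(n)+a(n)a(m)=\delta_{m+n,0}$; let $V(Z)=A(Z)/\sum_{n>0}A(Z)a(n)$, with $\mathbf 1$ the image of $1$; and for $s\in\{0,1\}$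 let $V(Z)_{\bar s}$ be the $R$-span of the monomials $a(n_1)\cdots a(n_k)\mathbf 1$ with $k\equiv s \pmod 2$. On $V(Z)_{\bar s}$ there are operators $$L(n)=\frac12\sum_{j\in Z}j\,{:}a(-j)a(n+j){:}\;+\;\frac1{16}\,\delta_{n,0}\,\delta_{Z,\mathbb Z}\qquad(n\in\mathbb Z),$$ where ${:}a(m)a(n){:}$ is $a(m)a(n)$ if $m\le n$ and $-a(n)a(m)$ if $m>n$. Put $L(\tfrac12,0)_R=V(\mathbb Z+\tfrac12)_{\bar 0}$, $L(\tfrac12,\tfrac12)_R=V(\mathbb Z+\tfrac12)_{\bar 1}$, and let $L(\tfrac12,\tfrac1{16})_R$ be either of $V(\mathbb Z)_{\bar 0}$, $V(\mathbb Z)_{\bar 1}$. **Corollary.** Let $F$ be a field with $\operatorname{char}F\ne 2,7$. Then, for $h=0,\tfrac12,\tfrac1{16}$ (and for both choices of $L(\tfrac12,\tfrac1{16})_R$), $$L(\tfrac12,h)_F\cong F\otimes_R L(\tfrac12,h)_R$$ as $Vir_F$-modules, where $L_n$ acts on the right-hand side as $\mathrm{id}\otimes L(n)$ and $C$ as $\tfrac12$.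 The isomorphism can be chosen so as to send the highest weight vector of $L(\tfrac12,h)_F$ to $1\otimes\mathbf 1$, $1\otimes a(-\tfrac12)\mathbf 1$, $1\otimes\mathbf 1$, $1\otimes a(0)\mathbf 1$ when $L(\tfrac12,h)_R$ is $V(\mathbb Z+\tfrac12)_{\bar 0}$, $V(\mathbb Z+\tfrac12)_{\bar 1}$, $V(\mathbb Z)_{\bar 0}$, $V(\mathbb Z)_{\bar 1}$ respectively. These modules are irreducible. -/

import Mathlib

open scoped TensorProduct

noncomputable section

namespace Ising

/-! ## The ring `ℤ[1/2]` -/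

/-- The ring `R = ℤ[1/2]`. A commutative ring `D` in which `2` is invertible is the same thing as
an `R`-algebra, so "`1/2 ∈ D`" is expressed below as `[Algebra ZHalf D]`. -/
abbrev ZHalf : Type := Localization.Away (2 : ℤ)

/-- A field of characteristic different from `2` is an `R`-algebra, in exactly one way. -/
theorem nonempty_unique_algebra {F : Type*} [Field F] (hF : ringChar F ≠ 2) :
    Nonempty (Unique (Algebra ZHalf F)) := by
  have h2 : IsUnit (algebraMap ℤ F 2) := by
    rw [isUnit_iff_ne_zero]
    simpa using Ring.two_ne_zero hF
  refine ⟨⟨⟨(IsLocalization.Away.lift (S := ZHalf) (2 : ℤ) h2).toAlgebra⟩, fun A => ?_⟩⟩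
  apply Algebra.algebra_ext
  intro r
  have h : @algebraMap ZHalf F _ _ A = IsLocalization.Away.lift (S := ZHalf) (2 : ℤ) h2 :=
    IsLocalization.ringHom_ext (Submonoid.powers (2 : ℤ)) (RingHom.ext_int _ _)
  exact congrArg (fun f : ZHalf →+* F => f r) h

section

variable (D : Type*) [CommRing D] [Algebra ZHalf D]

/-- The element `1/2` of `D`. -/
def half : D := algebraMap ZHalf D (IsLocalization.Away.invSelf (2 : ℤ))

theorem two_mul_half : (2 : D) * half D = 1 := by
  have h : (2 : ZHalf) * IsLocalization.Away.invSelf (2 : ℤ) = 1 := by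
    simpa using IsLocalization.Away.mul_invSelf (S := ZHalf) (2 : ℤ)
  have h' := congrArg (algebraMap ZHalf D) h
  rwa [map_mul, map_one, map_ofNat] at h'

/-! ## The Virasoro algebra over `D` -/

/-- The integer `(m ^ 3 - m) / 6`. -/
def cubic (m : ℤ) : ℤ := (m ^ 3 - m) / 6

theorem six_mul_cubic (m : ℤ) : 6 * cubic m = m ^ 3 - m := by
  have h : (6 : ℤ) ∣ m ^ 3 - m := by
    have h1 : ((m ^ 3 - m : ℤ) : ZMod 6) = 0 := by
      push_cast
      generalize (m : ZMod 6) = x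
      revert x
      decide
    exact (ZMod.intCast_zmod_eq_zero_iff_dvd _ 6).1 h1
  exact Int.mul_ediv_cancel' h

/-- The underlying free module `⨁ D L_n ⊕ D C` of the Virasoro algebra. -/
def Vir : Type _ := (ℤ →₀ D) × D

instance : AddCommGroup (Vir D) := inferInstanceAs (AddCommGroup ((ℤ →₀ D) × D))

instance : Module D (Vir D) := inferInstanceAs (Module D ((ℤ →₀ D) × D))

/-- The basis element `L_n`. -/
def Vir.L (n : ℤ) : Vir D := (Finsupp.single n 1, 0)

/-- The basis element `C`. -/
def Vir.C : Vir D := (0, 1)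

/-- `[L_m, L_n] = (m - n) L_{m+n} + δ_{m+n,0} ((m³ - m) / 12) C`. -/
def Vir.basisBracket (m n : ℤ) : Vir D :=
  ((m - n : ℤ) : D) • Vir.L D (m + n) +
    (if m + n = 0 then (cubic m : D) * half D else 0) • Vir.C D

/-- The bilinear extension of `Vir.basisBracket`. -/
def Vir.bracketLin : (ℤ →₀ D) →ₗ[D] (ℤ →₀ D) →ₗ[D] Vir D :=
  Finsupp.linearCombination D fun m =>
    Finsupp.linearCombination D fun n => Vir.basisBracket D m n

/-- The bracket is bilinear, with `C` central. -/
instance : Bracket (Vir D) (Vir D) := ⟨fun x y => Vir.bracketLin D x.1 y.1⟩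

theorem Vir.lie_def (x y : Vir D) : ⁅x, y⁆ = Vir.bracketLin D x.1 y.1 := rfl

theorem Vir.bracketLin_single (m n : ℤ) (a b : D) :
    Vir.bracketLin D (Finsupp.single m a) (Finsupp.single n b) =
      (a * b) • Vir.basisBracket D m n := by
  simp [Vir.bracketLin, Finsupp.linearCombination_single, mul_smul]

theorem Vir.basisBracket_fst (m n : ℤ) :
    (Vir.basisBracket D m n).1 = Finsupp.single (m + n) ((m - n : ℤ) : D) := by
  change ((m - n : ℤ) : D) • Finsupp.single (m + n) (1 : D) + _ • (0 : ℤ →₀ D) = _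
  simp

theorem Vir.basisBracket_snd (m n : ℤ) :
    (Vir.basisBracket D m n).2 = if m + n = 0 then (cubic m : D) * half D else 0 := by
  change ((m - n : ℤ) : D) • (0 : D) + (if m + n = 0 then (cubic m : D) * half D else 0) • 1 = _
  simp

theorem Vir.ext' {D : Type*} [CommRing D] {x y : Vir D} (h1 : x.1 = y.1) (h2 : x.2 = y.2) : x = y := Prod.ext h1 h2

theorem cubic_neg (m : ℤ) : cubic (-m) = - cubic m := by
  have h1 := six_mul_cubic m
  have h2 := six_mul_cubic (-m)
  have h3 : (-m) ^ 3 - (-m) = -(m ^ 3 - m) := by ring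
  omega

theorem Vir.basisBracket_skew (m n : ℤ) :
    Vir.basisBracket D m n = - Vir.basisBracket D n m := by
  apply Vir.ext'
  · change _ = -(Vir.basisBracket D n m).1
    rw [Vir.basisBracket_fst, Vir.basisBracket_fst, ← Finsupp.single_neg, add_comm n m]
    congr 1
    push_cast
    ring
  · change _ = -(Vir.basisBracket D n m).2
    rw [Vir.basisBracket_snd, Vir.basisBracket_snd, add_comm n m]
    split_ifs with h
    · obtain rfl : n = -m := by omega
      rw [cubic_neg]
      push_cast
      ring
    · simp

theorem Vir.bracketLin_skew (x y : ℤ →₀ D) :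
    Vir.bracketLin D x y = - Vir.bracketLin D y x := by
  induction x using Finsupp.induction_linear with
  | zero => simp
  | add f g hf hg => rw [map_add, map_add, LinearMap.add_apply, hf, hg]; abel
  | single m a =>
    induction y using Finsupp.induction_linear with
    | zero => simp
    | add f g hf hg => rw [map_add, map_add, LinearMap.add_apply, hf, hg]; abel
    | single n b =>
      rw [Vir.bracketLin_single, Vir.bracketLin_single, Vir.basisBracket_skew D m n, smul_neg,
        mul_comm]

theorem Vir.jacobi_basis (m n k : ℤ) (a b c : D) :
    Vir.bracketLin D (Finsupp.single m a)
        (Vir.bracketLin D (Finsupp.single n b) (Finsupp.single k c)).1 =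
      Vir.bracketLin D (Vir.bracketLin D (Finsupp.single m a) (Finsupp.single n b)).1
          (Finsupp.single k c) +
        Vir.bracketLin D (Finsupp.single n b)
          (Vir.bracketLin D (Finsupp.single m a) (Finsupp.single k c)).1 := by
  have key : ∀ (i j : ℤ) (u v : D), (Vir.bracketLin D (Finsupp.single i u) (Finsupp.single j v)).1 =
      Finsupp.single (i + j) ((u * v) * ((i - j : ℤ) : D)) := by
    intro i j u v
    rw [Vir.bracketLin_single]
    change (u * v) • (Vir.basisBracket D i j).1 = _
    rw [Vir.basisBracket_fst, Finsupp.smul_single, smul_eq_mul]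
  have key2 : ∀ (i j : ℤ) (u v : D), (Vir.bracketLin D (Finsupp.single i u) (Finsupp.single j v)).2 =
      (u * v) * (if i + j = 0 then (cubic i : D) * half D else 0) := by
    intro i j u v
    rw [Vir.bracketLin_single]
    change (u * v) • (Vir.basisBracket D i j).2 = _
    rw [Vir.basisBracket_snd, smul_eq_mul]
  rw [key n k, key m n, key m k]
  apply Vir.ext'
  · change _ = (Vir.bracketLin D _ _).1 + (Vir.bracketLin D _ _).1
    rw [key, key, key, show m + n + k = m + (n + k) by ring, show n + (m + k) = m + (n + k) by ring,
      ← Finsupp.single_add]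
    congr 1
    push_cast
    ring
  · change _ = (Vir.bracketLin D _ _).2 + (Vir.bracketLin D _ _).2
    rw [key2, key2, key2, show m + n + k = m + (n + k) by ring,
      show n + (m + k) = m + (n + k) by ring]
    split_ifs with h
    · obtain rfl : k = -(m + n) := by omega
      have hZ : (n - -(m + n)) * cubic m =
          (m - n) * cubic (m + n) + (m - -(m + n)) * cubic n := by
        have h1 := six_mul_cubic m
        have h2 := six_mul_cubic n
        have h3 := six_mul_cubic (m + n)
        have h6 : (6 : ℤ) ≠ 0 := by norm_num
        apply mul_left_cancel₀ h6
        linear_combination (n - -(m + n)) * h1 - (m - n) * h3 - (m - -(m + n)) * h2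
      have hD := congrArg (Int.cast : ℤ → D) hZ
      push_cast at hD ⊢
      linear_combination a * b * c * half D * hD
    · simp

theorem Vir.jacobi (x y z : ℤ →₀ D) :
    Vir.bracketLin D x (Vir.bracketLin D y z).1 =
      Vir.bracketLin D (Vir.bracketLin D x y).1 z +
        Vir.bracketLin D y (Vir.bracketLin D x z).1 := by
  have hfst : ∀ u v : Vir D, (u + v).1 = u.1 + v.1 := fun _ _ => rfl
  have hzero : (0 : Vir D).1 = 0 := rfl
  induction x using Finsupp.induction_linear with
  | zero => simp [hzero]
  | add f g hf hg => simp only [map_add, LinearMap.add_apply, hfst, hf, hg]; abel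
  | single m a =>
    induction y using Finsupp.induction_linear with
    | zero => simp [hzero]
    | add f g hf hg => simp only [map_add, LinearMap.add_apply, hfst, hf, hg]; abel
    | single n b =>
      induction z using Finsupp.induction_linear with
      | zero => simp [hzero]
      | add f g hf hg => simp only [map_add, hfst, hf, hg]; abel
      | single k c => exact Vir.jacobi_basis D m n k a b c

instance : LieRing (Vir D) where
  add_lie x y z := by
    change Vir.bracketLin D (x.1 + y.1) z.1 = _
    rw [map_add]; rfl
  lie_add x y z := by
    change Vir.bracketLin D x.1 (y.1 + z.1) = _
    rw [map_add]; rfl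
  lie_self x := by
    have h : ⁅x, x⁆ = -⁅x, x⁆ := Vir.bracketLin_skew D x.1 x.1
    have h2 : (2 : D) • ⁅x, x⁆ = 0 := by
      rw [two_smul]
      nth_rewrite 1 [h]
      exact neg_add_cancel _
    calc ⁅x, x⁆ = ((2 : D) * half D) • ⁅x, x⁆ := by rw [two_mul_half, one_smul]
      _ = half D • (2 : D) • ⁅x, x⁆ := by rw [smul_smul, mul_comm]
      _ = 0 := by rw [h2, smul_zero]
  leibniz_lie x y z := Vir.jacobi D x.1 y.1 z.1

/-- The Virasoro algebra over `D`. -/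
instance : LieAlgebra D (Vir D) where
  lie_smul t x y := by
    change Vir.bracketLin D x.1 (t • y.1) = _
    rw [map_smul]; rfl

/-! ## Highest weight modules -/

/-- The universal enveloping algebra `U(Vir_D)`. -/
abbrev UVir : Type _ := UniversalEnvelopingAlgebra D (Vir D)

variable {D}

/-- The image of `L_n` in `U(Vir_D)`. -/
def opL (n : ℤ) : UVir D := UniversalEnvelopingAlgebra.ι D (Vir.L D n)

/-- The image of `C` in `U(Vir_D)`. -/
def opC : UVir D := UniversalEnvelopingAlgebra.ι D (Vir.C D)

/-- The left ideal of `U(Vir_D)` generated by `L_n` for `n > 0`, `L_0 - h` and `C - c`. -/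
def vermaIdeal (c h : D) : Submodule (UVir D) (UVir D) :=
  Submodule.span (UVir D)
    ({x | ∃ n : ℤ, 0 < n ∧ x = opL n} ∪
      {opL 0 - algebraMap D (UVir D) h, opC - algebraMap D (UVir D) c})

/-- The Verma module `V(c,h)_D`, that is `U(Vir_D)` tensored over `U(Vir_D^{≥ 0})` with the rank one
module `D` on which `L_n` (`n > 0`), `L_0` and `C` act as `0`, `h` and `c`. -/
abbrev Verma (c h : D) : Type _ := UVir D ⧸ vermaIdeal c h

/-- The highest weight vector `v_{c,h} = 1 ⊗ 1`. -/
def vermaVec (c h : D) : Verma c h := (vermaIdeal c h).mkQ 1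

/-- The homogeneous component `V(c,h)_D(n)`: the `D`-span of the vectors
`L_{-n₁} ⋯ L_{-n_k} v_{c,h}` with `nᵢ ≥ 1` and `∑ nᵢ = n`. (Those with `n₁ ≥ ⋯ ≥ n_k` span the same
submodule, as reordering produces only shorter products of the same degree.) -/
def vermaDeg (c h : D) (n : ℕ) : Submodule D (Verma c h) :=
  Submodule.span D {x | ∃ l : List ℕ, (∀ i ∈ l, 1 ≤ i) ∧ l.sum = n ∧
    x = (l.map fun i : ℕ => opL (D := D) (-(i : ℤ))).prod • vermaVec c h}

/-- A `Vir_D`-submodule `N` is graded if it is the sum of the `N ∩ V(c,h)_D(n)`. -/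
def IsGraded (c h : D) (N : Submodule (UVir D) (Verma c h)) : Prop :=
  N.restrictScalars D = ⨆ n : ℕ, N.restrictScalars D ⊓ vermaDeg c h n

end

/-- The maximal graded submodule `W(c,h)_F`: the sum of all proper graded submodules. -/
def maxGraded {F : Type*} [Field F] [Algebra ZHalf F] (c h : F) :
    Submodule (UVir F) (Verma c h) :=
  sSup {N | IsGraded c h N ∧ N ≠ ⊤}

/-- The irreducible highest weight module `L(c,h)_F = V(c,h)_F / W(c,h)_F`. -/
abbrev IrredHW {F : Type*} [Field F] [Algebra ZHalf F] (c h : F) : Type _ :=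
  Verma c h ⧸ maxGraded c h

/-- The highest weight vector of `L(c,h)_F`. -/
def irredVec {F : Type*} [Field F] [Algebra ZHalf F] (c h : F) : IrredHW c h :=
  (maxGraded c h).mkQ (vermaVec c h)

/-! ## The fermionic Fock spaces -/

/-- The two mode sets `Z = ℤ + 1/2` and `Z = ℤ`. -/
inductive Sector
  | halfInt
  | int

/-- The elements of `Z` are the numbers `k + shift / 2` with `k : ℤ`. A mode is encoded by the
integer `k`; then `-(k + shift / 2)` is encoded by `-k - shift`. -/
def Sector.shift : Sector → ℤ
  | .halfInt => 1
  | .int => 0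

section

variable (D : Type*) [CommRing D] (Z : Sector)

/-- The relations `a(m) a(n) + a(n) a(m) = δ_{m+n,0}` for `m, n ∈ Z`. -/
inductive FermionRel : FreeAlgebra D ℤ → FreeAlgebra D ℤ → Prop
  | anticomm (k l : ℤ) : FermionRel
      (FreeAlgebra.ι D k * FreeAlgebra.ι D l + FreeAlgebra.ι D l * FreeAlgebra.ι D k)
      (algebraMap D (FreeAlgebra D ℤ) (if k + l + Z.shift = 0 then 1 else 0))

/-- The algebra `A(H_D, Z)`. -/
def Fermion : Type _ := RingQuot (FermionRel D Z)

instance : Ring (Fermion D Z) := inferInstanceAs (Ring (RingQuot (FermionRel D Z)))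

instance : Algebra D (Fermion D Z) := inferInstanceAs (Algebra D (RingQuot (FermionRel D Z)))

/-- The projection from the free algebra. -/
def Fermion.mk : FreeAlgebra D ℤ →ₐ[D] Fermion D Z := RingQuot.mkAlgHom D (FermionRel D Z)

/-- The generator `a(k + shift / 2)`. -/
def gen (k : ℤ) : Fermion D Z := Fermion.mk D Z (FreeAlgebra.ι D k)

/-- The left ideal of `A(H_D, Z)` generated by the `a(n)` with `n > 0`. -/
def annihilators : Submodule (Fermion D Z) (Fermion D Z) :=
  Submodule.span (Fermion D Z) {x | ∃ k : ℤ, 0 < 2 * k + Z.shift ∧ x = gen D Z k}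

/-- The induced module `V(H_D, Z) = A(H_D, Z) ⊗_{A(H_D, Z)_+} D`. -/
abbrev Fock : Type _ := Fermion D Z ⧸ annihilators D Z

/-- The vacuum `1 ⊗ 1`. -/
def vac : Fock D Z := (annihilators D Z).mkQ 1

/-- The monomial `a(n₁) ⋯ a(n_r) 1`. -/
def mono (l : List ℤ) : Fock D Z := (l.map (gen D Z)).prod • vac D Z

theorem gen_anticomm (k l : ℤ) :
    gen D Z k * gen D Z l = - (gen D Z l * gen D Z k) +
      algebraMap D (Fermion D Z) (if k + l + Z.shift = 0 then 1 else 0) := by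
  have h : Fermion.mk D Z _ = Fermion.mk D Z _ :=
    RingQuot.mkAlgHom_rel D (FermionRel.anticomm (D := D) (Z := Z) k l)
  rw [map_add, map_mul, map_mul, AlgHom.commutes] at h
  rw [← h]
  simp only [gen]
  abel

/-- Every vector is annihilated by all `a(n)` with `n` sufficiently large. -/
theorem exists_bound (w : Fock D Z) : ∃ N : ℤ, ∀ k : ℤ, N < k → gen D Z k • w = 0 := by
  have hvac : ∃ N : ℤ, ∀ k : ℤ, N < k → gen D Z k • vac D Z = 0 := by
    refine ⟨0, fun k hk => ?_⟩
    have hs : 0 ≤ Z.shift := by cases Z <;> simp [Sector.shift]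
    rw [vac, ← map_smul, Submodule.mkQ_apply, Submodule.Quotient.mk_eq_zero, smul_eq_mul, mul_one]
    exact Submodule.subset_span ⟨k, by omega, rfl⟩
  have hstep : ∀ (x : FreeAlgebra D ℤ) (w : Fock D Z),
      (∃ N : ℤ, ∀ k : ℤ, N < k → gen D Z k • w = 0) →
      ∃ N : ℤ, ∀ k : ℤ, N < k →
        gen D Z k • (Fermion.mk D Z x • w) = 0 := by
    intro x
    induction x using FreeAlgebra.induction with
    | grade0 r =>
      rintro w ⟨N, hN⟩
      refine ⟨N, fun k hk => ?_⟩
      rw [AlgHom.commutes, ← mul_smul, ← Algebra.commutes, mul_smul, hN k hk, smul_zero]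
    | grade1 l =>
      rintro w ⟨N, hN⟩
      refine ⟨max N (-l - Z.shift), fun k hk => ?_⟩
      have h1 : ¬ k + l + Z.shift = 0 := by omega
      change gen D Z k • gen D Z l • w = 0
      rw [← mul_smul, gen_anticomm, if_neg h1, map_zero, add_zero, neg_smul, mul_smul,
        hN k (by omega), smul_zero, neg_zero]
    | mul x y hx hy =>
      intro w hw
      rw [map_mul]
      simp only [mul_smul]
      exact hx _ (hy w hw)
    | add x y hx hy =>
      intro w hw
      obtain ⟨N, hN⟩ := hx w hw
      obtain ⟨M, hM⟩ := hy w hw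
      refine ⟨max N M, fun k hk => ?_⟩
      rw [map_add, add_smul, smul_add, hN k (by omega), hM k (by omega), add_zero]
  obtain ⟨y, rfl⟩ := (annihilators D Z).mkQ_surjective w
  obtain ⟨x, rfl⟩ : ∃ x, Fermion.mk D Z x = y :=
    RingQuot.mkAlgHom_surjective D (FermionRel D Z) y
  have h := hstep x (vac D Z) hvac
  rwa [vac, ← map_smul, smul_eq_mul, mul_one] at h

/-- The normally ordered product `:a(m) a(n):`, with `m, n` encoded by `k, l`. -/
def normalOrder (k l : ℤ) : Fermion D Z :=
  if k ≤ l then gen D Z k * gen D Z l else - (gen D Z l * gen D Z k)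

/-- The summation over `j` in the definition of `L(n)` is finite on each vector. -/
theorem finite_support (n : ℤ) (w : Fock D Z) (f : ℤ → D) :
    (Function.support fun k : ℤ =>
      f k • normalOrder D Z (-k - Z.shift) (n + k) • w).Finite := by
  obtain ⟨N, hN⟩ := exists_bound D Z w
  refine (Set.finite_Icc (-N - Z.shift) (N - n)).subset fun k hk => ?_
  by_contra hk'
  apply hk
  have hor : N < -k - Z.shift ∨ N < n + k := by
    by_contra hcon
    exact hk' (Set.mem_Icc.2 ⟨by omega, by omega⟩)
  change f k • normalOrder D Z (-k - Z.shift) (n + k) • w = 0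
  unfold normalOrder
  split_ifs with hle
  · rw [mul_smul, hN (n + k) (by omega), smul_zero, smul_zero]
  · rw [neg_smul, mul_smul, hN (-k - Z.shift) (by omega), smul_zero, neg_zero, smul_zero]

/-- The submodule `V(H_D, Z)_{s̄}` spanned by the monomials of length congruent to `s` mod `2`. -/
def Fock.part (s : ZMod 2) : Submodule D (Fock D Z) :=
  Submodule.span D {w | ∃ l : List ℤ, (l.length : ZMod 2) = s ∧ w = mono D Z l}

/-- The monomial `a(n₁) ⋯ a(n_r) 1` as an element of the part of its parity. -/
def monoPart (s : ZMod 2) (l : List ℤ) (h : (l.length : ZMod 2) = s) : Fock.part D Z s :=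
  ⟨mono D Z l, Submodule.subset_span ⟨l, h, rfl⟩⟩

theorem gen_gen_smul_mem (s : ZMod 2) (k l : ℤ) {w : Fock D Z} (hw : w ∈ Fock.part D Z s) :
    (gen D Z k * gen D Z l) • w ∈ Fock.part D Z s := by
  induction hw using Submodule.span_induction with
  | mem x hx =>
    obtain ⟨t, ht, rfl⟩ := hx
    refine Submodule.subset_span ⟨k :: l :: t, ?_, ?_⟩
    · rw [← ht]
      have h2 : (1 : ZMod 2) + 1 = 0 := by decide
      simp only [List.length_cons]
      push_cast
      rw [add_assoc, h2, add_zero]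
    · simp only [mono, List.map_cons, List.prod_cons, ← mul_smul, mul_assoc]
  | zero => rw [smul_zero]; exact zero_mem _
  | add x y _ _ hx hy => rw [smul_add]; exact add_mem hx hy
  | smul r x _ hx => rw [smul_comm]; exact Submodule.smul_mem _ _ hx

variable [Algebra ZHalf D]

/-- The constant term of `L(n)`: it is `1/16` if `n = 0` and `Z = ℤ`, and `0` otherwise. -/
def constTerm : Sector → ℤ → D
  | .halfInt, _ => 0
  | .int, n => if n = 0 then half D ^ 4 else 0

/-- The operator `L(n) = (1/2) ∑_{j ∈ Z} j :a(-j) a(n+j):` on `V(H_D, Z)`, with `1/16` added if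
`n = 0` and `Z = ℤ`. Here `j = k + shift / 2`. -/
def virOp (n : ℤ) : Fock D Z →ₗ[D] Fock D Z where
  toFun w := half D • (∑ᶠ k : ℤ, ((k : D) + (Z.shift : D) * half D) •
    normalOrder D Z (-k - Z.shift) (n + k) • w) + constTerm D Z n • w
  map_add' v w := by
    have h := finsum_add_distrib
      (finite_support D Z n v fun k => (k : D) + (Z.shift : D) * half D)
      (finite_support D Z n w fun k => (k : D) + (Z.shift : D) * half D)
    simp only [smul_add]
    rw [h, smul_add]
    abel
  map_smul' r w := by
    have h := smul_finsum' r (finite_support D Z n w fun k => (k : D) + (Z.shift : D) * half D)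
    simp only [RingHom.id_apply, smul_add]
    rw [smul_comm r (half D), h, smul_comm r (constTerm D Z n)]
    congr 2
    apply finsum_congr
    intro k
    rw [smul_comm r, smul_comm _ r w]

theorem virOp_mem (s : ZMod 2) (n : ℤ) (w : Fock D Z) (hw : w ∈ Fock.part D Z s) :
    virOp D Z n w ∈ Fock.part D Z s := by
  change half D • (∑ᶠ k : ℤ, ((k : D) + (Z.shift : D) * half D) •
    normalOrder D Z (-k - Z.shift) (n + k) • w) + constTerm D Z n • w ∈ Fock.part D Z s
  refine add_mem (Submodule.smul_mem _ _ ?_) (Submodule.smul_mem _ _ hw)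
  refine finsum_induction (· ∈ Fock.part D Z s) (zero_mem _) (fun _ _ => add_mem) fun k => ?_
  refine Submodule.smul_mem _ _ ?_
  unfold normalOrder
  split_ifs
  · exact gen_gen_smul_mem D Z s _ _ hw
  · rw [neg_smul]
    exact neg_mem (gen_gen_smul_mem D Z s _ _ hw)

/-- The operator `L(n)` on `V(H_D, Z)_{s̄}`. -/
def virOpPart (s : ZMod 2) (n : ℤ) : Fock.part D Z s →ₗ[D] Fock.part D Z s :=
  (virOp D Z n).restrict (virOp_mem D Z s n)

end

/-- `F ⊗_R V(H_R, Z)_{s̄}` is the module `L(1/2,h)_F` of the Virasoro algebra over `F`: there is an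
`F`-linear isomorphism which carries the action of each `L_n` to `id ⊗ L(n)`, that of `C` to
multiplication by `1/2`, and the highest weight vector of `L(1/2,h)_F` to `1 ⊗ u`; and
this module is irreducible. -/
def ReducesTo {F : Type*} [Field F] [Algebra ZHalf F] (h : F) (Z : Sector) (s : ZMod 2)
    (u : Fock.part ZHalf Z s) : Prop :=
  (∃ e : IrredHW (half F) h ≃ₗ[F] F ⊗[ZHalf] Fock.part ZHalf Z s,
    (∀ (n : ℤ) (x : IrredHW (half F) h),
      e (opL (D := F) n • x) = (virOpPart ZHalf Z s n).baseChange F (e x)) ∧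
    (∀ x : IrredHW (half F) h, e (opC (D := F) • x) = half F • e x) ∧
    e (irredVec (half F) h) = 1 ⊗ₜ[ZHalf] u) ∧
  IsSimpleModule (UVir F) (IrredHW (half F) h)

end Ising

end

/-! Let `N` be the Fock space over `F`, and `W` a subspace of one parity stable under all `L(n)`.
The heart of the proof is that `W` is stable under every product `a(k) a(l)`. Lowering a nonzero
vector of `W` to the vacuum and raising again by words of even total length then gives every
monomial of that parity. This is irreducibility without any grading assumption.

For `w ∈ W` the class of `a(k) a(T - k) w` modulo `W` is antisymmetric under `k ↦ T - k` and nonzero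
for only finitely many `k`. It is studied through its moments, the sums over `k` against functions
of `k` with constant `n`-th difference. Binomial coefficients replace powers, so leading terms make
sense in every characteristic. If all moments of degree below `n` vanish (`Kills n`), those of
degree `n` depend only on the leading coefficient, and it remains to kill one of them:

- for `n` even, antisymmetry does it, since `2` is invertible (`Kills.succ_of_even`); - for `n = 1`,
the moment is `L` up to a factor (`kills_two`); - for `n ≥ 3` odd there are two relations. The null
vector of the fermion, `L(-2)ψ = (3/4) L(-1)²ψ`, yields a BPZ-type equation which multiplies the
moment by `(3n - 2)(n + 1)/4` (`theta_eq`, `Kills.bpz`). Quadratic operators of degree below `n`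
already preserve `W`, and commuting them past `a(k) a(l)` multiplies the moment by `2 * (n+1).choose
(i+1)`, for `i` even with `0 < i < n - 1` (`Kills.choose_smul`).

In `Kills.succ_of_odd` some factor is always invertible. If `n + 1 = 0` in `F`, take `i + 1` to be
the exact power of `p` dividing `n + 1`. Otherwise only `3n = 2` is left; for `n ≥ 5` the choice `i
= 2` excludes it, and for `n = 3` it says `7 = 0`. This is where characteristic `7` is excluded.
Finite support makes the system of moments triangular, so vanishing moments give stability
(`a_a_mem_of_kills`).

The rest identifies the modules. The failure of the Virasoro relations commutes with all fermions,
so it is found on the vacuum (`defect_eq`). The Fock space over `ℤ[1/2]` has a functional nonzero on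
the vacuum and splits by parity, so both features survive extension of scalars. Finally the map from
the Verma module has a maximal kernel, graded because the target is, and this kernel must be the
maximal graded submodule (`maxGraded_eq_of_isCoatom`). -/

noncomputable section

namespace Ising

/-! ## Finite differences of functions on the integers -/

section Difference

variable {K : Type*} [CommRing K]

/-- The `n`-th forward difference of `f` is the constant `c`. -/
def HasLead : ℕ → K → (ℤ → K) → Prop
  | 0, c, f => ∀ k, f k = c
  | n + 1, c, f => HasLead n c fun k => f (k + 1) - f k

namespace HasLead

theorem congr {n : ℕ} {c d : K} {f g : ℤ → K} (hf : HasLead n c f) (h : ∀ k, g k = f k)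
    (hc : d = c) : HasLead n d g := by
  obtain rfl : g = f := funext h
  rwa [hc]

theorem const (c : K) : HasLead 0 c fun _ => c := fun _ => rfl

theorem add {n : ℕ} {c d : K} {f g : ℤ → K} (hf : HasLead n c f) (hg : HasLead n d g) :
    HasLead n (c + d) fun k => f k + g k := by
  induction n generalizing f g with
  | zero => intro k; simp only [hf k, hg k]
  | succ n ih => exact (ih hf hg).congr (fun k => by ring) rfl

theorem smul {n : ℕ} {c : K} {f : ℤ → K} (hf : HasLead n c f) (a : K) :
    HasLead n (a * c) fun k => a * f k := by
  induction n generalizing f with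
  | zero => intro k; simp only [hf k]
  | succ n ih => exact (ih hf).congr (fun k => by ring) rfl

theorem sub {n : ℕ} {c d : K} {f g : ℤ → K} (hf : HasLead n c f) (hg : HasLead n d g) :
    HasLead n (c - d) fun k => f k - g k :=
  (hf.add (hg.smul (-1))).congr (fun k => by ring) (by ring)

theorem succ {n : ℕ} {c : K} {f : ℤ → K} (hf : HasLead n c f) : HasLead (n + 1) 0 f := by
  induction n generalizing f with
  | zero => intro k; simp only [hf _, sub_self]
  | succ n ih => exact ih hf

theorem mono {n m : ℕ} {f : ℤ → K} (hf : HasLead n 0 f) (h : n ≤ m) : HasLead m 0 f := by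
  induction h with
  | refl => exact hf
  | step _ ih => exact ih.succ

theorem of_lt {n m : ℕ} {c : K} {f : ℤ → K} (hf : HasLead n c f) (h : n < m) : HasLead m 0 f :=
  hf.succ.mono h

theorem shift {n : ℕ} {c : K} {f : ℤ → K} (hf : HasLead n c f) (m : ℤ) :
    HasLead n c fun k => f (k + m) := by
  induction n generalizing f with
  | zero => intro k; exact hf _
  | succ n ih => exact (ih hf).congr (fun k => by rw [add_right_comm]) rfl

theorem reflect {n : ℕ} {c : K} {f : ℤ → K} (hf : HasLead n c f) (a : ℤ) :
    HasLead n ((-1) ^ n * c) fun k => f (a - k) := by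
  induction n generalizing f a with
  | zero => intro k; simp only [hf _, pow_zero, one_mul]
  | succ n ih =>
    refine ((ih hf (a - 1)).smul (-1)).congr (fun k => ?_) (by ring)
    simp only [show a - 1 - k + 1 = a - k by ring, show a - (k + 1) = a - 1 - k by ring]
    ring

/-- Discrete Leibniz rule, `Δ(fg) = Δf · g + f(· + 1) · Δg`; the two leading coefficients add up by
Pascal's rule. Leads are normalised as `n`-th differences, which explains the binomial factor and
avoids all division by factorials. -/
theorem mul {a b : ℕ} {c d : K} {f g : ℤ → K} (hf : HasLead a c f) (hg : HasLead b d g) :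
    HasLead (a + b) ((a + b).choose a * (c * d)) fun k => f k * g k := by
  induction hn : a + b generalizing a b c d f g with
  | zero =>
    obtain ⟨rfl, rfl⟩ : a = 0 ∧ b = 0 := by omega
    intro k
    simp only [hf k, hg k]
    simp
  | succ n ih =>
    rcases Nat.eq_zero_or_pos a with rfl | ha
    · obtain rfl : b = n + 1 := by omega
      exact (hg.smul c).congr (fun k => by rw [hf k]) (by simp)
    rcases Nat.eq_zero_or_pos b with rfl | hb
    · obtain rfl : a = n + 1 := by omega
      exact (hf.smul d).congr (fun k => by rw [hg k, mul_comm]) (by simp [mul_comm])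
    obtain ⟨a, rfl⟩ : ∃ a', a = a' + 1 := ⟨a - 1, by omega⟩
    obtain ⟨b, rfl⟩ : ∃ b', b = b' + 1 := ⟨b - 1, by omega⟩
    have hf' : HasLead a c fun k => f (k + 1) - f k := hf
    have hg' : HasLead b d fun k => g (k + 1) - g k := hg
    have h1 := ih hf' hg (by omega)
    have h2 := ih (hf.shift 1) hg' (by omega)
    refine (h1.add h2).congr (fun k => by ring) ?_
    rw [Nat.choose_succ_succ n a]
    push_cast
    ring

/-- Translation by `m` changes a function of degree `n + 1` by one of degree `n`. -/
theorem translate {n : ℕ} {c : K} {f : ℤ → K} (hf : HasLead (n + 1) c f) (m : ℤ) :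
    HasLead n (m * c) fun k => f (k + m) - f k := by
  have hstep : ∀ m : ℤ, HasLead n c fun k => f (k + (m + 1)) - f (k + m) := fun m =>
    ((show HasLead n c fun k => f (k + 1) - f k from hf).shift m).congr
      (fun k => by rw [show k + m + 1 = k + (m + 1) by ring]) rfl
  induction m with
  | zero => exact ((hstep 0).smul 0).congr (fun k => by simp) (by simp)
  | succ i ih => exact (ih.add (hstep i)).congr (fun k => by ring) (by push_cast; ring)
  | pred i ih =>
    refine (ih.sub (hstep (-i - 1))).congr (fun k => ?_) (by push_cast; ring)
    rw [show -(i : ℤ) - 1 + 1 = -i by ring]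
    ring

end HasLead

theorem HasLead.linear (a b : K) : HasLead 1 b fun k : ℤ => a + b * k := by
  intro k
  push_cast
  ring

/-- The binomial coefficient function `k ↦ (k choose n)` with values in `K`. -/
def bin (K : Type*) [CommRing K] (n : ℕ) (k : ℤ) : K := ((Ring.choose k n : ℤ) : K)

theorem bin_succ (n : ℕ) (k : ℤ) : bin K (n + 1) (k + 1) = bin K n k + bin K (n + 1) k := by
  simp only [bin, Ring.choose_succ_succ, Int.cast_add]

theorem bin_zero (k : ℤ) : bin K 0 k = 1 := by simp [bin]

theorem bin_natCast (n k : ℕ) : bin K n k = (k.choose n : K) := by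
  simp only [bin, Ring.choose_natCast, Int.cast_natCast]

theorem hasLead_bin (n : ℕ) : HasLead n (1 : K) (bin K n) := by
  induction n with
  | zero => intro k; exact bin_zero k
  | succ n ih => exact ih.congr (fun k => by rw [bin_succ]; ring) rfl

/-- A rewriting of `(k - n) (k choose n) = (n + 1) (k choose n + 1)` over `ℤ`. It gives `k * bin K n
k` an antiderivative without denominators. -/
theorem mul_bin (n : ℕ) (k : ℤ) :
    (k : K) * bin K n k = (n + 1) * bin K (n + 1) k + n * bin K n k := by
  have h : (k - n) * Ring.choose k n = (n + 1) * Ring.choose k (n + 1) := by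
    have h := Ring.choose_smul_choose k (Nat.le_succ n)
    simp only [Nat.succ_eq_add_one, Nat.choose_succ_self_right, nsmul_eq_mul, add_tsub_cancel_left,
      Ring.choose_one_right] at h
    push_cast at h
    linear_combination -h
  have h' := congrArg (Int.cast : ℤ → K) h
  push_cast at h'
  simp only [bin]
  linear_combination h'

/-- A sum of differences over an interval telescopes. -/
theorem sum_Ico_telescope {f g : ℤ → K} (h : ∀ k, g (k + 1) - g k = f k) {a b : ℤ} (hab : a ≤ b) :
    ∑ k ∈ Finset.Ico a b, f k = g b - g a := by
  induction b, hab using Int.leInduction with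
  | base => simp
  | succ b hab ih =>
    rw [← Finset.insert_Ico_right_eq_Ico_add_one hab, Finset.sum_insert (by simp), ih, ← h b]
    ring

end Difference

/-- `p^a` divides `n` exactly: then `n choose p^a` is prime to `p`. -/
theorem cast_choose_pow_ne_zero {F : Type*} [Field F] {p : ℕ} [hp : Fact p.Prime] [CharP F p]
    {a m : ℕ} (hm : ¬ p ∣ m) : ((p ^ a * m).choose (p ^ a) : F) ≠ 0 := by
  -- By Frobenius `(1 + X)^(p^a m) = (1 + X^(p^a))^m`, whose coefficient at `X^(p^a)` is `m`.
  have h : ((1 + Polynomial.X : Polynomial F) ^ (p ^ a * m)).coeff (p ^ a) = m := by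
    rw [pow_mul, add_pow_char_pow, one_pow, add_comm, add_pow, Polynomial.finsetSum_coeff]
    simp only [one_pow, mul_one, ← pow_mul, ← Polynomial.C_eq_natCast, Polynomial.coeff_mul_C,
      Polynomial.coeff_X_pow]
    have hpa : 0 < p ^ a := pow_pos hp.out.pos a
    have hm1 : 0 < m := Nat.pos_of_ne_zero fun h0 => hm (h0 ▸ dvd_zero p)
    rw [Finset.sum_eq_single 1]
    · simp
    · intro b _ hb
      rw [if_neg, zero_mul]
      intro h
      exact hb (Nat.eq_of_mul_eq_mul_left hpa (by omega))
    · intro h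
      simp at h
      omega
  rw [add_comm, Polynomial.coeff_X_add_one_pow] at h
  rw [h]
  rwa [Ne, CharP.cast_eq_zero_iff F p]

/-! ## Abstract fermionic Fock spaces -/

/-- A Fock space: a vector space with operators `a k` satisfying the anticommutation relations of
the sector `Z`, spanned by the monomials in the `a k` applied to a nonzero vacuum. -/
structure FockRep (F : Type*) [Field F] (N : Type*) [AddCommGroup N] [Module F N]
    (Z : Sector) where
  a : ℤ → N →ₗ[F] N
  vac : N
  anticomm : ∀ k l w, a k (a l w) + a l (a k w) = if k + l + Z.shift = 0 then w else 0
  ann : ∀ k, 0 < 2 * k + Z.shift → a k vac = 0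
  span : ∀ w, w ∈ Submodule.span F (Set.range fun l : List ℤ => l.foldr (fun k => a k) vac)
  vac_ne : vac ≠ 0

theorem Sector.shift_cases (Z : Sector) : Z.shift = 0 ∨ Z.shift = 1 := by
  cases Z <;> simp [Sector.shift]

theorem add_one_add_one (t : ZMod 2) : t + 1 + 1 = t := by
  revert t
  decide

namespace FockRep

variable {F : Type*} [Field F] {N : Type*} [AddCommGroup N] [Module F N] {Z : Sector}
variable (R : FockRep F N Z)

/-- The monomial `a(k₁) ⋯ a(k_r) vac`. -/
def word (l : List ℤ) (w : N) : N := l.foldr (fun k => R.a k) w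

theorem word_nil (w : N) : R.word [] w = w := rfl

theorem word_cons (k : ℤ) (l : List ℤ) (w : N) : R.word (k :: l) w = R.a k (R.word l w) := rfl

theorem word_append (l l' : List ℤ) (w : N) : R.word (l ++ l') w = R.word l (R.word l' w) := by
  simp [word]

theorem word_smul (l : List ℤ) (c : F) (w : N) : R.word l (c • w) = c • R.word l w := by
  induction l with
  | nil => rfl
  | cons k l ih => rw [word_cons, ih, map_smul, word_cons]

theorem word_zero (l : List ℤ) : R.word l 0 = 0 := by
  induction l with
  | nil => rfl
  | cons k l ih => rw [word_cons, ih, map_zero]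

theorem anticomm' (k l : ℤ) (w : N) :
    R.a k (R.a l w) = (if k + l + Z.shift = 0 then w else 0) - R.a l (R.a k w) :=
  eq_sub_of_add_eq (R.anticomm k l w)

theorem a_a_of_ne {k l : ℤ} (h : k + l + Z.shift ≠ 0) (w : N) :
    R.a k (R.a l w) = -R.a l (R.a k w) := by
  rw [anticomm', if_neg h, zero_sub]

/-- Linear operators agree if they agree on the vacuum and agreement on `w` implies agreement on
all `a k w`. -/
theorem ext_of_step {P : N → N} (hP0 : P 0 = 0) (hPadd : ∀ v w, P (v + w) = P v + P w)
    (hPsmul : ∀ (c : F) w, P (c • w) = c • P w)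
    (hvac : P R.vac = 0) (hstep : ∀ k w, P w = 0 → P (R.a k w) = 0) (w : N) : P w = 0 := by
  induction R.span w using Submodule.span_induction with
  | mem x hx =>
    obtain ⟨l, rfl⟩ := hx
    induction l with
    | nil => exact hvac
    | cons k l ih => exact hstep k _ ih
  | zero => exact hP0
  | add x y _ _ hx hy => rw [hPadd, hx, hy, add_zero]
  | smul c x _ hx => rw [hPsmul, hx, smul_zero]

theorem exists_bound (w : N) : ∃ K : ℤ, ∀ k, K < k → R.a k w = 0 := by
  induction R.span w using Submodule.span_induction with
  | mem x hx =>
    obtain ⟨l, rfl⟩ := hx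
    induction l with
    | nil => exact ⟨0, fun k hk => R.ann k (by rcases Z.shift_cases with h | h <;> omega)⟩
    | cons m l ih =>
      obtain ⟨K, hK⟩ := ih
      refine ⟨max K (-m - Z.shift), fun k hk => ?_⟩
      change R.a k (R.a m _) = 0
      rw [R.a_a_of_ne (by omega), hK k (by omega), map_zero, neg_zero]
  | zero => exact ⟨0, fun k _ => map_zero _⟩
  | add x y _ _ hx hy =>
    obtain ⟨K, hK⟩ := hx
    obtain ⟨M, hM⟩ := hy
    exact ⟨max K M, fun k hk => by rw [map_add, hK k (by omega), hM k (by omega), add_zero]⟩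
  | smul c x _ hx =>
    obtain ⟨K, hK⟩ := hx
    exact ⟨K, fun k hk => by rw [map_smul, hK k hk, smul_zero]⟩

/-! ### Normal ordered quadratic operators -/

/-- The normally ordered product `:a(k) a(l):`. -/
def nord (k l : ℤ) : N →ₗ[F] N := if k ≤ l then R.a k ∘ₗ R.a l else -(R.a l ∘ₗ R.a k)

theorem nord_of_le {k l : ℤ} (h : k ≤ l) (w : N) : R.nord k l w = R.a k (R.a l w) := by
  rw [nord, if_pos h]; rfl

theorem nord_of_lt {k l : ℤ} (h : l < k) (w : N) : R.nord k l w = -R.a l (R.a k w) := by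
  rw [nord, if_neg (by omega)]; rfl

theorem nord_of_ne {k l : ℤ} (h : k + l + Z.shift ≠ 0) (w : N) :
    R.nord k l w = R.a k (R.a l w) := by
  rcases le_or_gt k l with hkl | hkl
  · exact R.nord_of_le hkl w
  · rw [R.nord_of_lt hkl, R.a_a_of_ne h]

theorem nord_swap {k l : ℤ} (h : k ≠ l) (w : N) : R.nord k l w = -R.nord l k w := by
  rcases lt_or_gt_of_ne h with hkl | hkl
  · rw [R.nord_of_le hkl.le, R.nord_of_lt hkl, neg_neg]
  · rw [R.nord_of_lt hkl, R.nord_of_le hkl.le]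

theorem nord_sub (k l : ℤ) (w : N) : R.nord k l w - R.a k (R.a l w) =
    if l < k then (if k + l + Z.shift = 0 then -w else 0) else 0 := by
  rcases le_or_gt k l with hkl | hkl
  · rw [R.nord_of_le hkl, if_neg (by omega), sub_self]
  · rw [R.nord_of_lt hkl, R.anticomm' k l, if_pos hkl]
    split_ifs <;> abel

theorem nord_eq_zero {K : ℤ} {w : N} (hK : ∀ k, K < k → R.a k w = 0) {k l : ℤ}
    (h : K < k ∨ K < l) : R.nord k l w = 0 := by
  rcases le_or_gt k l with hkl | hkl
  · rw [R.nord_of_le hkl, hK l (by omega), map_zero]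
  · rw [R.nord_of_lt hkl, hK k (by omega), map_zero, neg_zero]

theorem finite_nord (f : ℤ → F) (T : ℤ) (w : N) :
    (fun k => f k • R.nord k (T - k) w).HasFiniteSupport := by
  obtain ⟨K, hK⟩ := R.exists_bound w
  refine (Set.finite_Icc (T - K) K).subset fun k hk => ?_
  by_contra hk'
  apply hk
  change f k • R.nord k (T - k) w = 0
  rw [R.nord_eq_zero hK, smul_zero]
  by_contra hcon
  exact hk' (Set.mem_Icc.2 ⟨by omega, by omega⟩)

/-- The operator `∑ f(k) :a(k) a(T-k):`. -/
def quad (f : ℤ → F) (T : ℤ) : N →ₗ[F] N where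
  toFun w := ∑ᶠ k, f k • R.nord k (T - k) w
  map_add' v w := by
    rw [← finsum_add_distrib (R.finite_nord f T v) (R.finite_nord f T w)]
    exact finsum_congr fun k => by rw [map_add, smul_add]
  map_smul' c w := by
    rw [RingHom.id_apply, smul_finsum' c (R.finite_nord f T w)]
    exact finsum_congr fun k => by rw [map_smul, smul_comm]

theorem quad_apply (f : ℤ → F) (T : ℤ) (w : N) :
    R.quad f T w = ∑ᶠ k, f k • R.nord k (T - k) w := rfl

/-- The contraction formula for `a(k) a(l)` is antisymmetric in `k, l`, so both branches of the
normal ordering give the same commutator. -/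
theorem nord_comm (k l r : ℤ) (w : N) : R.nord k l (R.a r w) - R.a r (R.nord k l w) =
    (if l + r + Z.shift = 0 then R.a k w else 0) - if k + r + Z.shift = 0 then R.a l w else 0 := by
  have key : ∀ k l : ℤ, R.a k (R.a l (R.a r w)) - R.a r (R.a k (R.a l w)) =
      (if l + r + Z.shift = 0 then R.a k w else 0) -
        if k + r + Z.shift = 0 then R.a l w else 0 := by
    intro k l
    rw [R.anticomm' l r, map_sub, R.anticomm' k r]
    split_ifs <;> try simp only [map_zero]
    all_goals abel
  rcases le_or_gt k l with hkl | hkl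
  · rw [R.nord_of_le hkl, R.nord_of_le hkl, key]
  · rw [R.nord_of_lt hkl, R.nord_of_lt hkl, map_neg, ← neg_sub', key, neg_sub]

/-- Only the two summands containing the mode dual to `r` contract with `a(r)`; after swapping, both
leave the same fermion. -/
theorem quad_comm (f : ℤ → F) (T r : ℤ) (w : N) : R.quad f T (R.a r w) - R.a r (R.quad f T w) =
    (f (T + r + Z.shift) - f (-r - Z.shift)) • R.a (T + r + Z.shift) w := by
  have h1 := map_finsum (R.a r) (R.finite_nord f T w)
  rw [quad_apply, quad_apply, h1, ← finsum_sub_distrib (R.finite_nord f T _)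
    ((R.finite_nord f T w).fun_comp (g := R.a r) (map_zero _))]
  have h2 : ∀ k, f k • R.nord k (T - k) (R.a r w) - R.a r (f k • R.nord k (T - k) w) =
      (if k = T + r + Z.shift then f (T + r + Z.shift) • R.a (T + r + Z.shift) w else 0) +
      (if k = -r - Z.shift then -(f (-r - Z.shift) • R.a (T + r + Z.shift) w) else 0) := by
    intro k
    rw [map_smul, ← smul_sub, nord_comm, smul_sub, sub_eq_add_neg]
    congr 1
    · by_cases hk : k = T + r + Z.shift
      · rw [if_pos hk, if_pos (by omega), hk]
      · rw [if_neg hk, if_neg (by omega), smul_zero]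
    · by_cases hk : k = -r - Z.shift
      · rw [if_pos hk, if_pos (by omega), hk]
        congr 4
        ring
      · rw [if_neg hk, if_neg (by omega), smul_zero, neg_zero]
  have hfin : ∀ (m : ℤ) (x : N), (fun k : ℤ => if k = m then x else 0).HasFiniteSupport := by
    intro m x
    refine (Set.finite_singleton m).subset fun k hk => ?_
    by_contra h
    exact hk (if_neg h)
  rw [finsum_congr h2, finsum_add_distrib (hfin _ _) (hfin _ _),
    finsum_eq_single _ (T + r + Z.shift) (fun k hk => if_neg hk),
    finsum_eq_single _ (-r - Z.shift) (fun k hk => if_neg hk), if_pos rfl, if_pos rfl, sub_smul]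
  exact (sub_eq_add_neg _ _).symm

theorem exists_bound_quad (f : ℤ → ℤ → F) (c : ℤ) (w : N) :
    ∃ K : ℤ, ∀ n, K < n → R.quad (f n) (n + c) w = 0 := by
  obtain ⟨K, hK⟩ := R.exists_bound w
  refine ⟨2 * K - c, fun n hn => ?_⟩
  rw [quad_apply]
  exact finsum_eq_zero_of_forall_eq_zero fun k => by
    rw [R.nord_eq_zero hK (by omega), smul_zero]

theorem quad_add (f g : ℤ → F) (T : ℤ) (w : N) :
    R.quad (fun k => f k + g k) T w = R.quad f T w + R.quad g T w := by
  simp only [quad_apply]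
  rw [← finsum_add_distrib (R.finite_nord f T w) (R.finite_nord g T w)]
  exact finsum_congr fun k => add_smul _ _ _

theorem quad_smul (c : F) (f : ℤ → F) (T : ℤ) (w : N) :
    R.quad (fun k => c * f k) T w = c • R.quad f T w := by
  simp only [quad_apply]
  rw [smul_finsum' c (R.finite_nord f T w)]
  exact finsum_congr fun k => mul_smul _ _ _

/-! ### The filtration by modes -/

/-- The span of the monomials `a(-i₁) ⋯ a(-i_r) vac` and `a(-i₁) ⋯ a(-i_r) a(0) vac` with
`j ≥ i₁ > i₂ > ⋯ > 0` (for half-integral modes, with `j > i₁`), of parity `t`, with the modes summing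
up to `-d/2` when multiplied by `g`. -/
def V (g : ℤ) : ℕ → ℤ → ZMod 2 → Submodule F N
  | 0, d, t => Submodule.span F
      {x | d = 0 ∧ ((t = 0 ∧ x = R.vac) ∨ (t = 1 ∧ Z.shift = 0 ∧ x = R.a 0 R.vac))}
  | j + 1, d, t => V g j d t ⊔
      (V g j (d - g * (2 * (j + 1) - Z.shift)) (t + 1)).map (R.a (-1 - j))

variable {R} {g : ℤ}

theorem mem_V_succ {j : ℕ} {d : ℤ} {t : ZMod 2} {x : N} : x ∈ R.V g (j + 1) d t ↔
    ∃ v ∈ R.V g j d t, ∃ u ∈ R.V g j (d - g * (2 * (j + 1) - Z.shift)) (t + 1),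
      v + R.a (-1 - j) u = x := by
  simp only [V, Submodule.mem_sup, Submodule.mem_map, exists_exists_and_eq_and]

/-- Parity separates the two possible generators of the bottom layer, so a nonzero element is a
multiple of exactly one of them. -/
theorem mem_V_zero {d : ℤ} {t : ZMod 2} {x : N} (hx : x ∈ R.V g 0 d t) (h0 : x ≠ 0) : d = 0 ∧
    ∃ c : F, c ≠ 0 ∧ ((t = 0 ∧ x = c • R.vac) ∨ (t = 1 ∧ Z.shift = 0 ∧ x = c • R.a 0 R.vac)) := by
  have h01 : (0 : ZMod 2) ≠ 1 := by decide
  have key : x = 0 ∨ (d = 0 ∧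
      ∃ c : F, ((t = 0 ∧ x = c • R.vac) ∨ (t = 1 ∧ Z.shift = 0 ∧ x = c • R.a 0 R.vac))) := by
    rw [V] at hx
    induction hx using Submodule.span_induction with
    | mem x hx =>
      obtain ⟨hd, h⟩ := hx
      exact Or.inr ⟨hd, 1, by simpa using h⟩
    | zero => exact Or.inl rfl
    | add x y _ _ ihx ihy =>
      by_cases hx : x = 0
      · rw [hx, zero_add]
        by_cases hy : y = 0
        · exact Or.inl hy
        · exact ihy hy
      by_cases hy : y = 0
      · rw [hy, add_zero]
        exact ihx hx
      obtain ⟨hd, c, hc⟩ := (ihx hx).resolve_left hx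
      obtain ⟨-, e, he⟩ := (ihy hy).resolve_left hy
      refine Or.inr ⟨hd, c + e, ?_⟩
      rcases hc with ⟨ht, rfl⟩ | ⟨ht, hs, rfl⟩ <;> rcases he with ⟨ht', rfl⟩ | ⟨ht', hs', rfl⟩
      · exact Or.inl ⟨ht, (add_smul _ _ _).symm⟩
      · exact absurd (ht.symm.trans ht') h01
      · exact absurd (ht'.symm.trans ht) h01
      · exact Or.inr ⟨ht, hs, (add_smul _ _ _).symm⟩
    | smul c x _ ih =>
      by_cases hx : x = 0
      · exact Or.inl (by rw [hx, smul_zero])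
      obtain ⟨hd, e, he⟩ := (ih hx).resolve_left hx
      refine Or.inr ⟨hd, c * e, ?_⟩
      rcases he with ⟨ht, rfl⟩ | ⟨ht, hs, rfl⟩
      · exact Or.inl ⟨ht, (mul_smul _ _ _).symm⟩
      · exact Or.inr ⟨ht, hs, (mul_smul _ _ _).symm⟩
  obtain ⟨hd, c, hc⟩ := key.resolve_left h0
  refine ⟨hd, c, ?_, hc⟩
  rintro rfl
  rcases hc with ⟨-, hc⟩ | ⟨-, -, hc⟩ <;> exact h0 (by rw [hc, zero_smul])

theorem V_mono {i j : ℕ} (h : i ≤ j) (d : ℤ) (t : ZMod 2) : R.V g i d t ≤ R.V g j d t := by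
  induction h with
  | refl => exact le_rfl
  | step _ ih => exact ih.trans le_sup_left

/-- The mode `1 + i - Z.shift` is the one contracting with `-1 - i`. Layer `j` only involves
creation modes `-1 - i` with `i < j`, so the annihilators with `i ≥ j` kill it. -/
theorem ann_mem_V (i : ℕ) {j : ℕ} {d : ℤ} {t : ZMod 2} {x : N} (hx : x ∈ R.V g j d t) :
    R.a (1 + i - Z.shift) x ∈ R.V g j (d - g * (2 * (i + 1) - Z.shift)) (t + 1) ∧
      (j ≤ i → R.a (1 + i - Z.shift) x = 0) := by
  have hs := Z.shift_cases
  induction j generalizing d t x with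
  | zero =>
    have h0 : R.a (1 + i - Z.shift) x = 0 := by
      by_cases hx0 : x = 0
      · rw [hx0, map_zero]
      obtain ⟨-, c, -, ⟨-, rfl⟩ | ⟨-, h0, rfl⟩⟩ := mem_V_zero hx hx0
      · rw [map_smul, R.ann _ (by omega), smul_zero]
      · rw [map_smul, R.a_a_of_ne (by omega), R.ann _ (by omega), map_zero, neg_zero, smul_zero]
    exact ⟨h0 ▸ zero_mem _, fun _ => h0⟩
  | succ j ih =>
    obtain ⟨v, hv, u, hu, rfl⟩ := mem_V_succ.1 hx
    rw [map_add]
    by_cases hij : i = j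
    · subst hij
      refine ⟨?_, fun h => by omega⟩
      rw [(ih hv).2 le_rfl, zero_add, R.anticomm', if_pos (by omega), (ih hu).2 le_rfl, map_zero,
        sub_zero]
      exact V_mono (Nat.le_succ _) _ _ hu
    · rw [R.a_a_of_ne (l := -1 - (j : ℤ)) (by omega)]
      refine ⟨mem_V_succ.2 ⟨_, (ih hv).1, -R.a (1 + i - Z.shift) u, neg_mem ?_, ?_⟩, fun h => ?_⟩
      · convert (ih hu).1 using 2
        ring
      · rw [map_neg]
      · rw [(ih hv).2 (by omega), (ih hu).2 (by omega), map_zero, neg_zero, add_zero]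

/-- In `v + a(-1 - j) u` the mode dual to `-1 - j` kills `v` and returns `u`; iteration strips off
the largest creation mode each time. The recorded sum of modes is needed for the independence of the
graded pieces. -/
theorem lower {j : ℕ} {d : ℤ} {t : ZMod 2} {x : N} (hx : x ∈ R.V g j d t) (h0 : x ≠ 0) :
    ∃ l : List ℤ, g * (l.map fun k => 2 * k + Z.shift).sum = d ∧
      R.word l x ∈ R.V g 0 0 (t + l.length) ∧ R.word l x ≠ 0 := by
  induction j generalizing d t x with
  | zero =>
    obtain ⟨rfl, -⟩ := mem_V_zero hx h0
    exact ⟨[], by simp, by simpa [word] using hx, h0⟩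
  | succ j ih =>
    obtain ⟨v, hv, u, hu, rfl⟩ := mem_V_succ.1 hx
    by_cases hu0 : u = 0
    · subst hu0
      rw [map_zero, add_zero] at h0 ⊢
      exact ih hv h0
    obtain ⟨l, h1, h2, h3⟩ := ih hu hu0
    have hk : R.a (1 + j - Z.shift) (v + R.a (-1 - j) u) = u := by
      rw [map_add, (ann_mem_V j hv).2 le_rfl, zero_add, R.anticomm', if_pos (by omega),
        (ann_mem_V j hu).2 le_rfl, map_zero, sub_zero]
    refine ⟨l ++ [1 + j - Z.shift], ?_, ?_, ?_⟩
    · rw [List.map_append, List.sum_append, mul_add, h1]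
      simp only [List.map_cons, List.map_nil, List.sum_singleton]
      ring
    · rw [word_append, word_cons, word_nil, hk]
      convert h2 using 2
      simp only [List.length_append, List.length_singleton]
      push_cast
      ring
    · rw [word_append, word_cons, word_nil, hk]
      exact h3

/-- The same stripping shows that the top component `u` is zero. With `g = 1` a singular vector of
nonzero degree therefore vanishes, which is how identities on the vacuum are proved below. -/
theorem mem_V_zero_of_ann {j : ℕ} {d : ℤ} {t : ZMod 2} {x : N} (hx : x ∈ R.V g j d t)
    (hann : ∀ k, 0 < 2 * k + Z.shift → R.a k x = 0) : x ∈ R.V g 0 d t := by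
  have hs := Z.shift_cases
  induction j generalizing x with
  | zero => exact hx
  | succ j ih =>
    obtain ⟨v, hv, u, hu, rfl⟩ := mem_V_succ.1 hx
    have hk := hann (1 + j - Z.shift) (by omega)
    rw [map_add, (ann_mem_V j hv).2 le_rfl, zero_add, R.anticomm', if_pos (by omega),
      (ann_mem_V j hu).2 le_rfl, map_zero, sub_zero] at hk
    subst hk
    rw [map_zero, add_zero] at hann ⊢
    exact ih hv hann

theorem V_neg_eq_zero {j : ℕ} {d : ℤ} {t : ZMod 2} {x : N} (hx : x ∈ R.V 1 j d t) (hd : d < 0) :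
    x = 0 := by
  have hs := Z.shift_cases
  induction j generalizing d t x with
  | zero =>
    by_contra h0
    have := (mem_V_zero hx h0).1
    omega
  | succ j ih =>
    obtain ⟨v, hv, u, hu, rfl⟩ := mem_V_succ.1 hx
    rw [ih hv hd, ih hu (by omega), map_zero, add_zero]

variable (R g) in
/-- The homogeneous subspaces. -/
def H (d : ℤ) (t : ZMod 2) : Submodule F N where
  carrier := {x | ∃ j, x ∈ R.V g j d t}
  zero_mem' := ⟨0, zero_mem _⟩
  add_mem' := by
    rintro x y ⟨i, hi⟩ ⟨j, hj⟩
    exact ⟨max i j, add_mem (V_mono (le_max_left _ _) _ _ hi) (V_mono (le_max_right _ _) _ _ hj)⟩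
  smul_mem' := by
    rintro c x ⟨j, hj⟩
    exact ⟨j, Submodule.smul_mem _ _ hj⟩

theorem vac_mem_H : R.vac ∈ R.H g 0 0 := ⟨0, Submodule.subset_span ⟨rfl, Or.inl ⟨rfl, rfl⟩⟩⟩

/-! ### Creation operators and homogeneity when 2 is invertible -/

section

variable [Algebra ZHalf F]

variable (F) in
theorem two_ne : (2 : F) ≠ 0 := fun h => by simpa [h] using two_mul_half F

theorem half_smul_add (w : N) : half F • (w + w) = w := by
  rw [← two_smul F w, smul_smul, mul_comm, two_mul_half, one_smul]

theorem eq_zero_of_eq_neg {M : Type*} [AddCommGroup M] [Module F M] {w : M} (h : w = -w) :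
    w = 0 := by
  have h2 : (2 : F) • w = 0 := by
    rw [two_smul]
    nth_rewrite 1 [h]
    exact neg_add_cancel w
  exact (smul_eq_zero.1 h2).resolve_left (two_ne F)

theorem a_a_self {k : ℤ} (h : 2 * k + Z.shift ≠ 0) (w : N) : R.a k (R.a k w) = 0 :=
  eq_zero_of_eq_neg (F := F) (R.a_a_of_ne (by omega) w)

theorem a_zero_a_zero (hs : Z.shift = 0) (w : N) : R.a 0 (R.a 0 w) = half F • w := by
  have h := R.anticomm 0 0 w
  rw [if_pos (by omega)] at h
  rw [← half_smul_add (F := F) (R.a 0 (R.a 0 w)), h]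

/-- A repeated creation mode disappears because `a(k)² = 0`, which needs `2` invertible; otherwise
the new mode is moved inward by anticommutation. -/
theorem create_mem_V {i j : ℕ} (hij : i < j) {d : ℤ} {t : ZMod 2} {x : N} (hx : x ∈ R.V g j d t) :
    R.a (-1 - i) x ∈ R.V g j (d + g * (2 * (i + 1) - Z.shift)) (t + 1) := by
  have hs := Z.shift_cases
  induction j generalizing d t x with
  | zero => omega
  | succ j ih =>
    obtain ⟨v, hv, u, hu, rfl⟩ := mem_V_succ.1 hx
    rw [map_add]
    rcases Nat.lt_succ_iff_lt_or_eq.1 hij with h | rfl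
    · refine mem_V_succ.2 ⟨_, ih h hv, -R.a (-1 - i) u, neg_mem ?_, ?_⟩
      · convert ih h hu using 2
        ring
      · rw [R.a_a_of_ne (k := -1 - (i : ℤ)) (by omega), map_neg]
    · refine mem_V_succ.2 ⟨0, zero_mem _, v, ?_, ?_⟩
      · rw [add_sub_cancel_right, add_one_add_one]
        exact hv
      · rw [a_a_self (by omega), zero_add, add_zero]

theorem zero_mode_mem_V (hs : Z.shift = 0) {j : ℕ} {d : ℤ} {t : ZMod 2} {x : N}
    (hx : x ∈ R.V g j d t) : R.a 0 x ∈ R.V g j d (t + 1) := by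
  induction j generalizing d t x with
  | zero =>
    by_cases hx0 : x = 0
    · rw [hx0, map_zero]
      exact zero_mem _
    obtain ⟨hd, c, -, ⟨rfl, rfl⟩ | ⟨rfl, h0, rfl⟩⟩ := mem_V_zero hx hx0
    · rw [map_smul]
      exact Submodule.smul_mem _ _ (Submodule.subset_span ⟨hd, Or.inr ⟨rfl, hs, rfl⟩⟩)
    · rw [map_smul, a_zero_a_zero hs]
      exact Submodule.smul_mem _ _ (Submodule.smul_mem _ _
        (Submodule.subset_span ⟨hd, Or.inl ⟨rfl, rfl⟩⟩))
  | succ j ih =>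
    obtain ⟨v, hv, u, hu, rfl⟩ := mem_V_succ.1 hx
    rw [map_add, R.a_a_of_ne (by omega)]
    exact mem_V_succ.2 ⟨_, ih hv, -R.a 0 u, neg_mem (ih hu), by rw [map_neg]⟩

theorem a_mem_H (k : ℤ) {d : ℤ} {t : ZMod 2} {x : N} (hx : x ∈ R.H g d t) :
    R.a k x ∈ R.H g (d - g * (2 * k + Z.shift)) (t + 1) := by
  have hs := Z.shift_cases
  obtain ⟨j, hj⟩ := hx
  rcases lt_trichotomy (2 * k + Z.shift) 0 with hk | hk | hk
  · obtain ⟨i, rfl⟩ : ∃ i : ℕ, k = -1 - i := ⟨(-1 - k).toNat, by omega⟩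
    refine ⟨max j (i + 1), ?_⟩
    convert create_mem_V (i := i) (by omega) (V_mono (le_max_left j (i + 1)) _ _ hj) using 2
    ring
  · obtain ⟨h0, rfl⟩ : Z.shift = 0 ∧ k = 0 := by omega
    refine ⟨j, ?_⟩
    convert zero_mode_mem_V h0 hj using 2
    rw [h0]
    ring
  · obtain ⟨i, rfl⟩ : ∃ i : ℕ, k = 1 + i - Z.shift := ⟨(k - 1 + Z.shift).toNat, by omega⟩
    refine ⟨j, ?_⟩
    convert (ann_mem_V i hj).1 using 2
    ring

theorem word_mem_H (l : List ℤ) {d : ℤ} {t : ZMod 2} {x : N} (hx : x ∈ R.H g d t) :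
    R.word l x ∈ R.H g (d - g * (l.map fun k => 2 * k + Z.shift).sum) (t + l.length) := by
  induction l with
  | nil => simpa [word] using hx
  | cons k l ih =>
    rw [word_cons]
    convert a_mem_H k ih using 2
    · rw [List.map_cons, List.sum_cons]
      ring
    · rw [List.length_cons]
      push_cast
      ring

theorem nord_mem_H (k l : ℤ) {d : ℤ} {t : ZMod 2} {x : N} (hx : x ∈ R.H g d t) :
    R.nord k l x ∈ R.H g (d - g * (2 * (k + l + Z.shift))) t := by
  rw [← add_one_add_one t]
  rcases le_or_gt k l with hkl | hkl
  · rw [R.nord_of_le hkl]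
    convert a_mem_H k (a_mem_H l hx) using 2
    ring
  · rw [R.nord_of_lt hkl]
    apply neg_mem
    convert a_mem_H l (a_mem_H k hx) using 2
    ring

theorem quad_mem_H (f : ℤ → F) (T : ℤ) {d : ℤ} {t : ZMod 2} {x : N} (hx : x ∈ R.H g d t) :
    R.quad f T x ∈ R.H g (d - g * (2 * (T + Z.shift))) t := by
  rw [quad_apply]
  refine finsum_induction (· ∈ R.H g _ t) (zero_mem _) (fun _ _ => add_mem) fun k => ?_
  refine Submodule.smul_mem _ _ ?_
  convert nord_mem_H k (T - k) hx using 2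
  ring

end

end FockRep

namespace FockRep

variable {F : Type*} [Field F] [Algebra ZHalf F] {N : Type*} [AddCommGroup N] [Module F N]
  {Z : Sector}

/-! ## The Virasoro operators -/

variable (F Z) in
/-- The mode `k + shift / 2` as an element of `F`. -/
def kap (k : ℤ) : F := k + Z.shift * half F

theorem kap_add (k l : ℤ) : kap F Z (k + l) = kap F Z k + l := by
  simp only [kap]
  push_cast
  ring

theorem kap_neg (k : ℤ) : kap F Z (-k - Z.shift) = -kap F Z k := by
  simp only [kap]
  push_cast
  linear_combination (Z.shift : F) * two_mul_half F

variable (R : FockRep F N Z)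

/-- The operator `L(n)`. -/
def L (n : ℤ) : N →ₗ[F] N :=
  R.quad (fun k => -(half F * kap F Z k)) (n - Z.shift) + constTerm F Z n • LinearMap.id

theorem L_apply (n : ℤ) (w : N) : R.L n w =
    R.quad (fun k => -(half F * kap F Z k)) (n - Z.shift) w + constTerm F Z n • w := rfl

theorem constTerm_of_ne {n : ℤ} (h : n ≠ 0) : constTerm F Z n = 0 := by
  cases Z
  · rfl
  · exact if_neg h

/-- The fermion is primary of weight `1/2`: the two contractions contribute `-(r + n)/2` and `-r/2`,
with `r` standing for its mode. -/
theorem L_comm (n r : ℤ) (w : N) :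
    R.L n (R.a r w) = R.a r (R.L n w) - (kap F Z r + n * half F) • R.a (r + n) w := by
  have h := R.quad_comm (fun k => -(half F * kap F Z k)) (n - Z.shift) r w
  rw [show n - Z.shift + r + Z.shift = r + n by ring, kap_neg, kap_add, sub_eq_iff_eq_add] at h
  rw [L_apply, L_apply, map_add, map_smul, h]
  have h2 := two_mul_half F
  match_scalars
  all_goals first | ring1 | linear_combination (kap F Z r) * h2 | linear_combination (-kap F Z r) * h2

omit [Algebra ZHalf F] in
theorem nord_vac {k l : ℤ} (h : 0 < 2 * k + Z.shift ∨ 0 < 2 * l + Z.shift) :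
    R.nord k l R.vac = 0 := by
  rcases le_or_gt k l with hkl | hkl
  · rw [R.nord_of_le hkl, R.ann l (by omega), map_zero]
  · rw [R.nord_of_lt hkl, R.ann k (by omega), map_zero, neg_zero]

omit [Algebra ZHalf F] in
theorem quad_vac (f : ℤ → F) {T : ℤ} (hT : 0 ≤ T + Z.shift)
    (hf : Z.shift = 0 → T = 0 → f 0 = 0) : R.quad f T R.vac = 0 := by
  rw [quad_apply]
  refine finsum_eq_zero_of_forall_eq_zero fun k => ?_
  by_cases h : 0 < 2 * k + Z.shift ∨ 0 < 2 * (T - k) + Z.shift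
  · rw [R.nord_vac h, smul_zero]
  · have hs := Z.shift_cases
    obtain ⟨h0, h1, h2⟩ : Z.shift = 0 ∧ T = 0 ∧ k = 0 := by omega
    rw [h2, hf h0 h1, zero_smul]

theorem L_vac {n : ℤ} (hn : 0 ≤ n) : R.L n R.vac = constTerm F Z n • R.vac := by
  rw [L_apply, R.quad_vac _ (by omega), zero_add]
  intro h _
  simp [kap, h]

theorem L_vac_of_pos {n : ℤ} (hn : 0 < n) : R.L n R.vac = 0 := by
  rw [R.L_vac hn.le, constTerm_of_ne hn.ne', zero_smul]

variable {R} in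
theorem L_mem_H {g : ℤ} (n : ℤ) {d : ℤ} {t : ZMod 2} {x : N} (hx : x ∈ R.H g d t) :
    R.L n x ∈ R.H g (d - g * (2 * n)) t := by
  rw [L_apply]
  refine add_mem ?_ ?_
  · convert quad_mem_H (fun k => -(half F * kap F Z k)) (n - Z.shift) hx using 2
    ring
  · by_cases h : n = 0
    · rw [h, mul_zero, mul_zero, sub_zero]
      exact Submodule.smul_mem _ _ hx
    · rw [constTerm_of_ne h, zero_smul]
      exact zero_mem _

theorem exists_bound_L (w : N) : ∃ K : ℤ, ∀ n, K < n → R.L n w = 0 := by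
  obtain ⟨K, hK⟩ := R.exists_bound_quad (fun _ k => -(half F * kap F Z k)) (-Z.shift) w
  refine ⟨max K 0, fun n hn => ?_⟩
  rw [L_apply, sub_eq_add_neg, hK n (by omega), constTerm_of_ne (by omega), zero_smul, add_zero]

/-- The defect of the relation for `[L(m), L(n)]` without central term. -/
def defect (m n : ℤ) (w : N) : N :=
  R.L m (R.L n w) - R.L n (R.L m w) - ((m - n : ℤ) : F) • R.L (m + n) w

/-- The action of the `L(n)` on the modes is a representation of the Witt algebra, so the defect
commutes with every fermion and is determined by its value on the vacuum. -/
theorem defect_a (m n r : ℤ) (w : N) : R.defect m n (R.a r w) = R.a r (R.defect m n w) := by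
  simp only [defect, L_comm, map_sub, map_smul]
  rw [show r + m + n = r + (m + n) by ring, show r + n + m = r + (m + n) by ring]
  simp only [kap_add]
  push_cast
  module

theorem a_zero_mode_vac {k : ℤ} : R.a k (R.a (-k - Z.shift) R.vac) =
    (if 0 < 2 * k + Z.shift then 1 else if 2 * k + Z.shift = 0 then half F else 0) • R.vac := by
  have hs := Z.shift_cases
  split_ifs with h1 h2
  · rw [R.anticomm', if_pos (by ring), R.ann k h1, map_zero, sub_zero, one_smul]
  · obtain ⟨h0, rfl⟩ : Z.shift = 0 ∧ k = 0 := by omega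
    rw [h0]
    exact a_zero_a_zero h0 _
  · rw [R.ann _ (by omega), map_zero, zero_smul]

/-! ### The central charge, computed on the vacuum -/

theorem six_mul_sum_sq {m : ℤ} (hm : 0 ≤ m) :
    6 * ∑ x ∈ Finset.Ico (-m) 0, x ^ 2 = m * (m + 1) * (2 * m + 1) := by
  rw [Finset.mul_sum, sum_Ico_telescope (g := fun x : ℤ => 2 * x ^ 3 - 3 * x ^ 2 + x)
    (fun k => by ring) (by omega : -m ≤ 0)]
  ring

theorem two_mul_sum {m : ℤ} (hm : 0 ≤ m) :
    2 * ∑ x ∈ Finset.Ico (-m) 0, x = -(m * (m + 1)) := by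
  rw [Finset.mul_sum, sum_Ico_telescope (g := fun x : ℤ => x ^ 2 - x)
    (fun k => by ring) (by omega : -m ≤ 0)]
  ring

/-- The vacuum sum for half-integral modes: `2 * x + 1` is twice the mode, and only `-m ≤ x < 0`
contributes to the expectation of `L(m) L(-m)`. -/
theorem sum_odd_mul {m : ℤ} (hm : 0 ≤ m) :
    ∑ x ∈ Finset.Ico (-m) 0, (2 * x + 1) * (2 * x + 1 + m) = 2 * cubic m := by
  have h : ∀ x : ℤ, (2 * x + 1) * (2 * x + 1 + m) = 4 * x ^ 2 + (4 + 2 * m) * x + (1 + m) := by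
    intro x
    ring
  rw [Finset.sum_congr rfl fun x _ => h x, Finset.sum_add_distrib, Finset.sum_add_distrib,
    ← Finset.mul_sum, ← Finset.mul_sum, Finset.sum_const, Int.card_Ico, nsmul_eq_mul]
  have h1 := six_mul_sum_sq hm
  have h2 := two_mul_sum hm
  have h3 := six_mul_cubic m
  have h4 : ((0 - -m).toNat : ℤ) = m := by omega
  rw [h4]
  have h6 : (6 : ℤ) ≠ 0 := by norm_num
  apply mul_left_cancel₀ h6
  linear_combination 4 * h1 + (12 + 6 * m) * h2 - 2 * h3

/-- The analogue for integral modes. The surplus `m + m ^ 2` is cancelled by the constant `1/16` and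
by the half contraction of the zero mode. -/
theorem sum_mul_two_add {m : ℤ} (hm : 0 ≤ m) :
    2 * ∑ x ∈ Finset.Ico (-m) 0, x * (2 * x + m) = m + m ^ 2 + 2 * cubic m := by
  have h : ∀ x : ℤ, x * (2 * x + m) = 2 * x ^ 2 + m * x := by
    intro x
    ring
  rw [Finset.sum_congr rfl fun x _ => h x, Finset.sum_add_distrib, ← Finset.mul_sum,
    ← Finset.mul_sum]
  have h1 := six_mul_sum_sq hm
  have h2 := two_mul_sum hm
  have h3 := six_mul_cubic m
  have h3' : (3 : ℤ) ≠ 0 := by norm_num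
  apply mul_left_cancel₀ h3'
  linear_combination 2 * h1 + 3 * m * h2 - h3

/-- The vacuum expectation of `a(k) a(-k)`. -/
def contr (F : Type*) [Field F] [Algebra ZHalf F] (Z : Sector) (k : ℤ) : F :=
  if 0 < 2 * k + Z.shift then 1 else if 2 * k + Z.shift = 0 then half F else 0

theorem contr_of_pos {k : ℤ} (h : 0 < 2 * k + Z.shift) : contr F Z k = 1 := if_pos h

theorem contr_of_neg {k : ℤ} (h : 2 * k + Z.shift < 0) : contr F Z k = 0 := by
  rw [contr, if_neg (by omega), if_neg (by omega)]

theorem contr_of_zero {k : ℤ} (h : 2 * k + Z.shift = 0) : contr F Z k = half F := by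
  rw [contr, if_neg (by omega), if_pos h]

theorem L_nord_vac {m : ℤ} (hm : 0 < m) (k : ℤ) :
    R.L m (R.nord k (-m - Z.shift - k) R.vac) =
      -((kap F Z k + m * half F) * (contr F Z (k + m) - contr F Z k)) • R.vac := by
  rw [R.nord_of_ne (by omega), L_comm, L_comm, R.L_vac_of_pos hm, map_zero, zero_sub, map_neg,
    map_smul, show -m - Z.shift - k + m = -k - Z.shift by ring, a_zero_mode_vac,
    show -m - Z.shift - k = -(k + m) - Z.shift by ring, a_zero_mode_vac, kap_neg, kap_add, smul_smul,
    smul_smul, ← neg_smul, ← sub_smul]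
  congr 1
  simp only [contr]
  linear_combination (-(m : F) * (if 0 < 2 * k + Z.shift then 1
    else if 2 * k + Z.shift = 0 then half F else 0)) * two_mul_half F

theorem L_L_neg_vac {m : ℤ} (hm : 0 < m) : R.L m (R.L (-m) R.vac) =
    ((2 * m : ℤ) * constTerm F Z 0 + cubic m * half F * half F) • R.vac := by
  have hs := Z.shift_cases
  have h2 := two_mul_half F
  rw [L_apply R (-m), constTerm_of_ne (by omega), zero_smul, add_zero, quad_apply,
    map_finsum _ (R.finite_nord _ _ _)]
  have hterm : ∀ k, R.L m (-(half F * kap F Z k) • R.nord k (-m - Z.shift - k) R.vac) =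
      (half F * kap F Z k * ((kap F Z k + m * half F) *
        (contr F Z (k + m) - contr F Z k))) • R.vac := by
    intro k
    rw [map_smul, L_nord_vac R hm, smul_smul]
    congr 1
    ring
  rw [finsum_congr hterm, finsum_eq_sum_of_support_subset (s := Finset.Ico (-m) 0),
    ← Finset.sum_smul]
  · congr 1
    rcases hs with h0 | h1
    · have hZ : Z = .int := by
        cases Z
        · simp [Sector.shift] at h0
        · rfl
      subst hZ
      have hk : ∀ k : ℤ, kap F .int k = k := fun k => by simp [kap, Sector.shift]
      -- At `k = -m` the contraction is `a(0)²`, with expectation `1/2` instead of `1`; the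
      -- correction `m²/8` records this. The other endpoint `k = 0` has coefficient zero.
      have hsum : ∑ k ∈ Finset.Ico (-m) 0, half F * kap F .int k * ((kap F .int k + m * half F) *
          (contr F .int (k + m) - contr F .int k)) =
          ∑ k ∈ Finset.Ico (-m) 0, (half F ^ 2 * ((k * (2 * k + m) : ℤ) : F) -
            if k = -m then half F ^ 3 * (m : F) ^ 2 else 0) := by
        refine Finset.sum_congr rfl fun k hk' => ?_
        rw [Finset.mem_Ico] at hk'
        rw [hk]
        by_cases hkm : k = -m
        · rw [hkm, contr_of_zero (by simp [h0]), contr_of_neg (by omega), if_pos rfl]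
          push_cast
          ring
        · rw [contr_of_pos (by omega), contr_of_neg (by omega), if_neg hkm]
          push_cast
          linear_combination (-half F * k ^ 2) * h2
      rw [hsum, Finset.sum_sub_distrib, ← Finset.mul_sum, Finset.sum_ite_eq', if_pos (by simp [hm])]
      have hI := congrArg (Int.cast : ℤ → F) (sum_mul_two_add hm.le)
      simp only [constTerm, if_true]
      rw [Int.cast_mul, Int.cast_sum] at hI
      push_cast [-Int.cast_sum] at hI ⊢
      generalize ∑ i ∈ Finset.Ico (-m) 0, (i : F) * (2 * i + m) = S at hI ⊢
      linear_combination half F ^ 3 * hI -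
        (half F ^ 2 * S + half F ^ 3 * m - cubic m * half F ^ 2) * h2
    · have hZ : Z = .halfInt := by
        cases Z
        · rfl
        · simp [Sector.shift] at h1
      subst hZ
      have hsum : ∑ k ∈ Finset.Ico (-m) 0, half F * kap F .halfInt k *
          ((kap F .halfInt k + m * half F) * (contr F .halfInt (k + m) - contr F .halfInt k)) =
          ∑ k ∈ Finset.Ico (-m) 0, half F ^ 3 * (((2 * k + 1) * (2 * k + 1 + m) : ℤ) : F) := by
        refine Finset.sum_congr rfl fun k hk' => ?_
        rw [Finset.mem_Ico] at hk'
        rw [contr_of_pos (by omega), contr_of_neg (by omega), kap, h1]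
        push_cast
        linear_combination (-half F * k * ((k + half F) + half F * (2 * k + 1 + m))) * h2
      rw [hsum, ← Finset.mul_sum, ← Int.cast_sum, sum_odd_mul hm.le]
      simp only [constTerm]
      push_cast
      linear_combination (half F ^ 2 * cubic m) * h2
  · intro k hk
    by_contra hk'
    apply hk
    rw [Finset.mem_coe, Finset.mem_Ico] at hk'
    change _ • R.vac = 0
    by_cases h0 : Z.shift = 0 ∧ k = 0
    · simp [kap, h0.1, h0.2]
    · have : contr F Z (k + m) = contr F Z k := by
        simp only [contr]
        split_ifs <;> first | rfl | omega
      rw [this, sub_self, mul_zero, mul_zero, zero_smul]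

theorem defect_eq (m n : ℤ) (w : N) :
    R.defect m n w = if m + n = 0 then (cubic m * half F * half F : F) • w else 0 := by
  have hs := Z.shift_cases
  have hpos : ∀ m : ℤ, 0 < m → R.defect m (-m) R.vac = (cubic m * half F * half F : F) • R.vac := by
    intro m hm
    rw [defect, L_L_neg_vac R hm, R.L_vac_of_pos hm, map_zero, sub_zero, add_neg_cancel,
      R.L_vac le_rfl, smul_smul, ← sub_smul]
    congr 1
    push_cast
    ring
  have hskew : ∀ m n w, R.defect m n w = -R.defect n m w := by
    intro m n w
    simp only [defect]
    rw [add_comm n m, ← neg_sub m n, Int.cast_neg]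
    module
  have hvac : R.defect m n R.vac =
      if m + n = 0 then (cubic m * half F * half F : F) • R.vac else 0 := by
    split_ifs with h
    · obtain rfl : n = -m := by omega
      rcases lt_trichotomy m 0 with hm | rfl | hm
      · have h := hpos (-m) (by omega)
        rw [neg_neg] at h
        rw [hskew, h, cubic_neg, ← neg_smul]
        congr 1
        push_cast
        ring
      · simp [defect, cubic]
      · exact hpos m hm
    -- For `m + n ≠ 0` the vector is singular, since the defect commutes with the annihilators, and
    -- it has nonzero degree. Hence it is zero.
    · have hmem : R.defect m n R.vac ∈ R.H 1 (-(2 * (m + n))) 0 := by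
        have h0 := R.vac_mem_H (g := 1)
        refine sub_mem (sub_mem ?_ ?_) (Submodule.smul_mem _ _ ?_)
        · convert L_mem_H m (L_mem_H n h0) using 2
          ring
        · convert L_mem_H n (L_mem_H m h0) using 2
          ring
        · convert L_mem_H (m + n) h0 using 2
          ring
      obtain ⟨j, hj⟩ := hmem
      by_contra h0
      have := (mem_V_zero (mem_V_zero_of_ann hj fun k hk => by
        rw [← defect_a, R.ann k hk]; simp [defect]) h0).1
      omega
  have h := R.ext_of_step (P := fun w => R.defect m n w -
    if m + n = 0 then (cubic m * half F * half F : F) • w else 0) ?_ ?_ ?_ ?_ ?_ w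
  · exact sub_eq_zero.1 h
  · simp [defect]
  · intro v w
    simp only [defect, map_add]
    split_ifs <;> module
  · intro c w
    simp only [defect, map_smul]
    split_ifs <;> module
  · rw [hvac, sub_self]
  · intro k w hw
    rw [sub_eq_zero] at hw ⊢
    rw [defect_a, hw]
    split_ifs <;> simp

end FockRep

namespace FockRep

variable {F : Type*} [Field F] {N : Type*} [AddCommGroup N] [Module F N]
  {Z : Sector}

/-! ## The product of the conformal field and the fermion -/

/-- Summation of a difference against the difference of two step functions. -/
theorem finsum_step_smul {f g : ℤ → F} (h : ∀ k, g (k + 1) - g k = f k) (b c : ℤ) (w : N) :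
    (fun k => (f k * ((if b ≤ k then 1 else 0) - if c ≤ k then 1 else 0)) • w).HasFiniteSupport ∧
    ∑ᶠ k, (f k * ((if b ≤ k then 1 else 0) - if c ≤ k then 1 else 0)) • w = (g c - g b) • w := by
  rcases le_total b c with hbc | hbc
  · have hs : (Function.support fun k =>
        (f k * ((if b ≤ k then 1 else 0) - if c ≤ k then 1 else 0)) • w) ⊆ Finset.Ico b c := by
      intro k hk
      by_contra hk'
      apply hk
      rw [Finset.mem_coe, Finset.mem_Ico] at hk'
      have : ((if b ≤ k then 1 else 0) - if c ≤ k then 1 else 0 : F) = 0 := by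
        split_ifs <;> first | omega | simp
      change _ • w = 0
      rw [this, mul_zero, zero_smul]
    refine ⟨(Finset.finite_toSet _).subset hs, ?_⟩
    rw [finsum_eq_sum_of_support_subset _ hs, ← sum_Ico_telescope h hbc, Finset.sum_smul]
    refine Finset.sum_congr rfl fun k hk => ?_
    rw [Finset.mem_Ico] at hk
    rw [if_pos hk.1, if_neg (by omega), sub_zero, mul_one]
  · have hs : (Function.support fun k =>
        (f k * ((if b ≤ k then 1 else 0) - if c ≤ k then 1 else 0)) • w) ⊆ Finset.Ico c b := by
      intro k hk
      by_contra hk'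
      apply hk
      rw [Finset.mem_coe, Finset.mem_Ico] at hk'
      have : ((if b ≤ k then 1 else 0) - if c ≤ k then 1 else 0 : F) = 0 := by
        split_ifs <;> first | omega | simp
      change _ • w = 0
      rw [this, mul_zero, zero_smul]
    refine ⟨(Finset.finite_toSet _).subset hs, ?_⟩
    rw [finsum_eq_sum_of_support_subset _ hs, ← neg_sub, neg_smul, ← sum_Ico_telescope h hbc,
      Finset.sum_smul, ← Finset.sum_neg_distrib]
    refine Finset.sum_congr rfl fun k hk => ?_
    rw [Finset.mem_Ico] at hk
    rw [if_neg (by omega), if_pos hk.1, ← neg_smul]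
    ring_nf

variable (R : FockRep F N Z) [Algebra ZHalf F]

/-- Pairing `k` with `T - k` cancels everything off the diagonal; twice the sum is `2 a(k)²` at `k =
T - k`, which survives only for the zero mode. -/
theorem quad_one (T : ℤ) (w : N) : R.quad (fun _ => 1) T w =
    if T = 0 ∧ Z.shift = 0 then half F • w else 0 := by
  have hs := Z.shift_cases
  have hfin := R.finite_nord (fun _ => 1) T w
  have hfin' := hfin.fun_comp_of_injective (sub_right_injective (b := T))
  have h1 : R.quad (fun _ => 1) T w = ∑ᶠ k, (1 : F) • R.nord (T - k) (T - (T - k)) w := by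
    rw [quad_apply, ← finsum_comp_equiv (Equiv.subLeft T)]
    rfl
  have h2 : R.quad (fun _ => 1) T w + R.quad (fun _ => 1) T w =
      if T = 0 ∧ Z.shift = 0 then w else 0 := by
    nth_rewrite 2 [h1]
    rw [quad_apply, ← finsum_add_distrib hfin hfin']
    have h3 : ∀ k, (1 : F) • R.nord k (T - k) w + (1 : F) • R.nord (T - k) (T - (T - k)) w =
        if k = 0 then (if T = 0 ∧ Z.shift = 0 then w else 0) else 0 := by
      intro k
      rw [one_smul, one_smul, sub_sub_cancel]
      by_cases hk : k = T - k
      · rw [← hk, R.nord_of_le le_rfl]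
        by_cases h0 : T + Z.shift = 0
        · have h00 : k = 0 ∧ T = 0 ∧ Z.shift = 0 := by omega
          rw [R.anticomm, if_pos (by omega), if_pos h00.1, if_pos h00.2]
        · rw [R.anticomm, if_neg (by omega)]
          split_ifs <;> first | rfl | omega
      · rw [R.nord_swap hk, neg_add_cancel]
        split_ifs <;> first | rfl | omega
    rw [finsum_congr h3, finsum_eq_single _ 0 (fun k hk => if_neg hk), if_pos rfl]
  rw [← half_smul_add (F := F) (R.quad (fun _ => 1) T w), h2]
  split_ifs
  · rfl
  · exact smul_zero _

theorem finite_theta (n : ℤ) (w : N) :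
    (fun m => if m < 0 then R.L m (R.a (n - m) w) else R.a (n - m) (R.L m w)).HasFiniteSupport := by
  obtain ⟨K, hK⟩ := R.exists_bound w
  obtain ⟨K', hK'⟩ := R.exists_bound_L w
  refine (Set.finite_Icc (min 0 (n - K)) (max 0 K')).subset fun m hm => ?_
  by_contra hm'
  apply hm
  rw [Set.mem_Icc, not_and_or] at hm'
  change (if m < 0 then R.L m (R.a (n - m) w) else R.a (n - m) (R.L m w)) = 0
  split_ifs with h
  · rw [hK _ (by omega), map_zero]
  · rw [hK' _ (by omega), map_zero]

/-- The modes `∑_{m < 0} L(m) a(n-m) + ∑_{m ≥ 0} a(n-m) L(m)`. -/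
def theta (n : ℤ) (w : N) : N :=
  ∑ᶠ m : ℤ, if m < 0 then R.L m (R.a (n - m) w) else R.a (n - m) (R.L m w)

theorem theta_add (n : ℤ) (v w : N) : R.theta n (v + w) = R.theta n v + R.theta n w := by
  rw [theta, theta, theta, ← finsum_add_distrib (R.finite_theta n v) (R.finite_theta n w)]
  refine finsum_congr fun m => ?_
  split_ifs <;> simp only [map_add]

theorem theta_smul (n : ℤ) (c : F) (w : N) : R.theta n (c • w) = c • R.theta n w := by
  rw [theta, theta, smul_finsum' c (R.finite_theta n w)]
  refine finsum_congr fun m => ?_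
  split_ifs <;> simp only [map_smul]

variable (F Z) in
/-- The scalar by which `theta` differs from the fermion. -/
def lam (n : ℤ) : F :=
  3 * half F ^ 2 * kap F Z n ^ 2 + half F * kap F Z n + half F ^ 4

/-- Moving `a(r)` through produces one `L(n + r)` from the anticommutator and a quadratic sum from
`[L(m), a(r)]`. These cancel up to a quadratic operator with constant coefficient, which is a scalar
by `quad_one`. -/
theorem theta_anticomm (n r : ℤ) (w : N) : R.theta n (R.a r w) + R.a r (R.theta n w) =
    if n + r + Z.shift = 0 then lam F Z n • w else 0 := by
  have hs := Z.shift_cases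
  have h2 := two_mul_half F
  have hfin := R.finite_theta n w
  have hfin' : (fun m => R.a r (if m < 0 then R.L m (R.a (n - m) w)
    else R.a (n - m) (R.L m w))).HasFiniteSupport := hfin.fun_comp (g := R.a r) (map_zero _)
  -- This is the coefficient `r + m/2` of `[L(m), a(r)]`, with `r` read as its mode, in terms of the
  -- index `k = r + m`.
  set gg : ℤ → F := fun k => half F * (k + r + Z.shift) with hgg
  obtain ⟨B, hB⟩ : ∃ B : ℤ → N, ∀ k, B k = gg k • R.nord k (n + r - k) w := ⟨_, fun _ => rfl⟩
  -- `B` is in normal order, which switches at `1 - Z.shift`, whereas the ordering in `theta`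
  -- switches at `m = 0`, that is `k = r`. `C` is the scalar discrepancy.
  obtain ⟨C, hC⟩ : ∃ C : ℤ → N, ∀ k, C k =
      (gg k * ((if 1 - Z.shift ≤ k then 1 else 0) - if r ≤ k then 1 else 0)) •
        if n + r + Z.shift = 0 then w else 0 := ⟨_, fun _ => rfl⟩
  have hterm : ∀ m, (if m < 0 then R.L m (R.a (n - m) (R.a r w))
      else R.a (n - m) (R.L m (R.a r w))) +
      R.a r (if m < 0 then R.L m (R.a (n - m) w) else R.a (n - m) (R.L m w)) =
      (if m = n + r + Z.shift then R.L (n + r + Z.shift) w else 0) +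
        (B (r + m) + C (r + m)) := by
    intro m
    rw [hB, hC]
    have hn : R.nord (r + m) (n + r - (r + m)) w = R.a (r + m) (R.a (n - m) w) -
        if 1 - Z.shift ≤ r + m ∧ n + r + Z.shift = 0 then w else 0 := by
      have h := R.nord_sub (r + m) (n + r - (r + m)) w
      rw [sub_eq_iff_eq_add] at h
      rw [h, show n + r - (r + m) = n - m by ring]
      split_ifs <;> first | omega | abel
    have hg : kap F Z r + m * half F = gg (r + m) := by
      simp only [hgg, kap]
      push_cast
      linear_combination (-(r : F)) * h2
    have hL : ∀ x, (if n - m + r + Z.shift = 0 then R.L m x else 0) =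
        if m = n + r + Z.shift then R.L (n + r + Z.shift) x else 0 := by
      intro x
      by_cases h : m = n + r + Z.shift
      · rw [if_pos (by omega), if_pos h, h]
      · rw [if_neg (by omega), if_neg h]
    rw [hn, ← hL]
    by_cases hm : m < 0
    · rw [if_pos hm, if_pos hm, if_neg (show ¬ r ≤ r + m by omega), R.anticomm' (n - m) r, map_sub,
        R.L_comm m r, hg, apply_ite (R.L m), map_zero]
      split_ifs <;> first | omega | module
    · rw [if_neg hm, if_neg hm, if_pos (show r ≤ r + m by omega), R.L_comm m r, hg, map_sub,
        map_smul, R.anticomm' (n - m) r, R.anticomm' (n - m) (r + m)]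
      split_ifs <;> first | omega | module
  have hstep := finsum_step_smul (f := gg)
    (g := fun k => half F ^ 2 * ((k : F) ^ 2 - k + 2 * (r + Z.shift) * k)) (fun k => by
      simp only [hgg]
      push_cast
      linear_combination half F * (k + r + Z.shift) * h2) (1 - Z.shift) r
      (if n + r + Z.shift = 0 then w else 0)
  simp only [← hC] at hstep
  have hnord := R.finite_nord gg (n + r) w
  simp only [← hB] at hnord
  have hinj : Function.Injective fun m : ℤ => r + m := add_right_injective r
  have hL1 : (fun m : ℤ => if m = n + r + Z.shift then R.L (n + r + Z.shift) w
      else 0).HasFiniteSupport := by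
    refine (Set.finite_singleton (n + r + Z.shift)).subset fun k hk => ?_
    by_contra h
    exact hk (if_neg h)
  have hB1 : (fun m => B (r + m)).HasFiniteSupport := hnord.fun_comp_of_injective hinj
  have hC1 : (fun m => C (r + m)).HasFiniteSupport := hstep.1.fun_comp_of_injective hinj
  have hB2 : ∑ᶠ m, B (r + m) = R.quad gg (n + r) w := by
    rw [quad_apply, ← finsum_congr hB]
    exact finsum_comp_equiv (Equiv.addLeft r)
  have hC2 : ∑ᶠ m, C (r + m) = ∑ᶠ k, C k := finsum_comp_equiv (Equiv.addLeft r)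
  have hBC : (fun m => B (r + m) + C (r + m)).HasFiniteSupport := hB1.add hC1
  rw [theta, theta, map_finsum _ hfin, ← finsum_add_distrib (R.finite_theta n _) hfin',
    finsum_congr hterm, finsum_add_distrib hL1 hBC, finsum_add_distrib hB1 hC1,
    hB2, hC2, hstep.2, finsum_eq_single _ _ (fun m hm => if_neg hm), if_pos rfl,
    L_apply, add_sub_cancel_right, ← add_assoc, add_right_comm (R.quad _ _ _) _ (R.quad _ _ _),
    ← quad_add]
  -- The dependence on `k` cancels between `L(n + r)` and the commutator sum.
  have hcoef : (fun k => -(half F * kap F Z k) + gg k) = fun k => half F * kap F Z r * 1 := by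
    funext k
    simp only [hgg, kap]
    linear_combination (-(half F * Z.shift)) * h2
  rw [hcoef, quad_smul, quad_one]
  by_cases h : n + r + Z.shift = 0
  · obtain rfl : r = -n - Z.shift := by omega
    rw [if_pos h, if_pos h, h]
    rcases hs with h0 | h1
    · have hZ : Z = .int := by
        cases Z
        · simp [Sector.shift] at h0
        · rfl
      subst hZ
      rw [if_pos ⟨by omega, h0⟩]
      simp only [constTerm, lam, kap, h0, if_true]
      push_cast
      match_scalars
      linear_combination (half F * n) * h2
    · have hZ : Z = .halfInt := by
        cases Z
        · rfl
        · simp [Sector.shift] at h1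
      subst hZ
      rw [if_neg (by omega)]
      simp only [constTerm, lam, kap, h1]
      push_cast
      match_scalars
      linear_combination (half F ^ 2 * n + n * half F * (1 - 4 * half F) -
        half F ^ 2 * (1 + 2 * half F)) * h2
  · rw [if_neg h, if_neg h, constTerm_of_ne h, if_neg (by omega)]
    simp

theorem theta_mem_H {g : ℤ} (n : ℤ) {d : ℤ} {t : ZMod 2} {x : N} (hx : x ∈ R.H g d t) :
    R.theta n x ∈ R.H g (d - g * (2 * n + Z.shift)) (t + 1) := by
  rw [theta]
  refine finsum_induction (· ∈ R.H g _ (t + 1)) (zero_mem _) (fun _ _ => add_mem) fun m => ?_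
  split_ifs
  · convert L_mem_H m (a_mem_H (n - m) hx) using 2
    ring
  · convert a_mem_H (n - m) (L_mem_H m hx) using 2
    ring

/-- Mode form of the null vector `L(-2)ψ = (3/4) L(-1)²ψ`. The difference of the two sides
anticommutes with all fermions, so the vacuum decides. There it is evaluated directly for
nonnegative modes; for negative ones it is singular of nonzero degree. -/
theorem theta_eq (n : ℤ) (w : N) : R.theta n w = lam F Z n • R.a n w := by
  have hs := Z.shift_cases
  have hstep : ∀ r w, R.theta n (R.a r w) - lam F Z n • R.a n (R.a r w) =
      -R.a r (R.theta n w - lam F Z n • R.a n w) := by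
    intro r w
    rw [eq_sub_of_add_eq (R.theta_anticomm n r w), R.anticomm' n r, map_sub, map_smul]
    split_ifs <;> module
  have hvac : R.theta n R.vac - lam F Z n • R.a n R.vac = 0 := by
    by_cases hn : 0 ≤ 2 * n + Z.shift
    · have h1 : R.theta n R.vac = constTerm F Z 0 • R.a n R.vac := by
        rw [theta, finsum_eq_single _ 0, if_neg (lt_irrefl 0), R.L_vac le_rfl, sub_zero, map_smul]
        intro m hm
        split_ifs with h
        · rw [R.ann _ (by omega), map_zero]
        · rw [R.L_vac_of_pos (by omega), map_zero]
      rw [h1]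
      by_cases h0 : 2 * n + Z.shift = 0
      · obtain ⟨h0, rfl⟩ : Z.shift = 0 ∧ n = 0 := by omega
        have hZ : Z = .int := by
          cases Z
          · simp [Sector.shift] at h0
          · rfl
        subst hZ
        rw [← sub_smul]
        simp [lam, kap, constTerm, Sector.shift]
      · rw [R.ann n (by omega), smul_zero, smul_zero, sub_zero]
    · have hmem : R.theta n R.vac - lam F Z n • R.a n R.vac ∈ R.H 1 (-(2 * n + Z.shift)) 1 := by
        have h0 := R.vac_mem_H (g := 1)
        refine sub_mem ?_ (Submodule.smul_mem _ _ ?_)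
        · convert R.theta_mem_H n h0 using 2 <;> ring
        · convert a_mem_H n h0 using 2 <;> ring
      obtain ⟨j, hj⟩ := hmem
      by_contra h0
      have := (mem_V_zero (mem_V_zero_of_ann hj fun k hk => by
        rw [← neg_eq_zero, ← hstep, R.ann k hk, map_zero, smul_zero, sub_zero]
        simpa using R.theta_smul n 0 0) h0).1
      omega
  have h := R.ext_of_step (P := fun w => R.theta n w - lam F Z n • R.a n w) ?_ ?_ ?_ hvac ?_ w
  · exact sub_eq_zero.1 h
  · simpa using R.theta_smul n 0 0
  · intro v w
    simp only [theta_add, map_add]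
    module
  · intro c w
    simp only [theta_smul, map_smul]
    module
  · intro k w hw
    rw [hstep, hw, map_zero, neg_zero]

end FockRep

theorem HasLead.exists_lead {K : Type*} [CommRing K] {n : ℕ} {f : ℤ → K}
    (hf : HasLead (n + 1) 0 f) : ∃ c, HasLead n c f := by
  induction n generalizing f with
  | zero =>
    refine ⟨f 0, fun k => ?_⟩
    have h : ∀ k, f (k + 1) = f k := fun k => sub_eq_zero.1 (hf k)
    induction k with
    | zero => rfl
    | succ i ih => rw [h, ih]
    | pred i ih => rw [← ih, ← h, sub_add_cancel]
  | succ n ih => exact ih (f := fun k => f (k + 1) - f k) hf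

namespace FockRep

variable {F : Type*} [Field F] {N : Type*} [AddCommGroup N] [Module F N]
  {Z : Sector} (R : FockRep F N Z) (W : Submodule F N)

/-! ## Moments of a two-point function modulo a submodule -/

/-- The class of `a(k) a(l) w` modulo `W`. -/
def two (w : N) (k l : ℤ) : N ⧸ W := W.mkQ (R.a k (R.a l w))

variable {W} in
theorem mkQ_eq_zero {w : N} (hw : w ∈ W) : W.mkQ w = 0 := (Submodule.Quotient.mk_eq_zero W).2 hw

variable {W} in
-- The anticommutator is a multiple of `w`, which is zero modulo `W`; for the same reason normal
-- ordering is invisible in the quotient.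
theorem two_swap {w : N} (hw : w ∈ W) (k l : ℤ) : R.two W w k l = -R.two W w l k := by
  rw [two, R.anticomm', map_sub]
  split_ifs
  · rw [mkQ_eq_zero hw, zero_sub, two]
  · rw [map_zero, zero_sub, two]

variable {W} in
theorem mkQ_nord {w : N} (hw : w ∈ W) (k l : ℤ) : W.mkQ (R.nord k l w) = R.two W w k l := by
  rcases le_or_gt k l with h | h
  · rw [R.nord_of_le h, two]
  · rw [R.nord_of_lt h, map_neg, ← two, ← two_swap R hw]

variable {W} in
theorem two_eq_zero {w : N} (hw : w ∈ W) {K : ℤ} (hK : ∀ k, K < k → R.a k w = 0) {k l : ℤ}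
    (h : K < k ∨ K < l) : R.two W w k l = 0 := by
  rcases h with h | h
  · rw [two_swap R hw, two, hK k h, map_zero, map_zero, neg_zero]
  · rw [two, hK l h, map_zero, map_zero]

/-- The sum `∑ f(k) a(k) a(T-k) w` modulo `W`. -/
def moment (f : ℤ → F) (T : ℤ) (w : N) : N ⧸ W := ∑ᶠ k, f k • R.two W w k (T - k)

/-- All moments of degree less than `n` vanish on `W`. -/
def Kills (n : ℕ) : Prop := ∀ w ∈ W, ∀ (T : ℤ) (f : ℤ → F), HasLead n 0 f → R.moment W f T w = 0

variable {R W}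

theorem finite_two {w : N} (hw : w ∈ W) (f : ℤ → F) (T : ℤ) :
    (fun k => f k • R.two W w k (T - k)).HasFiniteSupport := by
  have h := (R.finite_nord f T w).fun_comp (g := W.mkQ) (map_zero _)
  simpa only [map_smul, R.mkQ_nord hw] using h

theorem moment_eq_mkQ {w : N} (hw : w ∈ W) (f : ℤ → F) (T : ℤ) :
    R.moment W f T w = W.mkQ (R.quad f T w) := by
  rw [quad_apply, map_finsum _ (R.finite_nord f T w), moment]
  exact finsum_congr fun k => by rw [map_smul, R.mkQ_nord hw]

theorem moment_sub {w : N} (hw : w ∈ W) (f g : ℤ → F) (T : ℤ) :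
    R.moment W (fun k => f k - g k) T w = R.moment W f T w - R.moment W g T w := by
  simp only [moment]
  rw [← finsum_sub_distrib (finite_two hw f T) (finite_two hw g T)]
  exact finsum_congr fun k => sub_smul _ _ _

theorem moment_smul {w : N} (hw : w ∈ W) (c : F) (f : ℤ → F) (T : ℤ) :
    R.moment W (fun k => c * f k) T w = c • R.moment W f T w := by
  simp only [moment]
  rw [smul_finsum' c (finite_two hw f T)]
  exact finsum_congr fun k => mul_smul _ _ _

theorem moment_reflect {w : N} (hw : w ∈ W) (f : ℤ → F) (T : ℤ) :
    R.moment W (fun k => f (T - k)) T w = -R.moment W f T w := by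
  simp only [moment]
  rw [← finsum_neg_distrib, ← finsum_comp_equiv (Equiv.subLeft T)]
  refine finsum_congr fun k => ?_
  simp only [Equiv.subLeft_apply, sub_sub_cancel]
  rw [R.two_swap hw, smul_neg]

/-- Moments of degree `n` only depend on the leading coefficient if the lower ones vanish. -/
theorem Kills.moment_eq {n : ℕ} (h : R.Kills W n) {w : N} (hw : w ∈ W) (T : ℤ) {f : ℤ → F} {c : F}
    (hf : HasLead n c f) : R.moment W f T w = c • R.moment W (bin F n) T w := by
  have h0 := h w hw T _ ((hf.sub ((hasLead_bin n).smul c)).congr (fun _ => rfl) (by ring))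
  rwa [moment_sub hw, moment_smul hw, sub_eq_zero] at h0

theorem Kills.succ {n : ℕ} (h : R.Kills W n)
    (h0 : ∀ w ∈ W, ∀ T, R.moment W (bin F n) T w = 0) : R.Kills W (n + 1) := by
  intro w hw T f hf
  obtain ⟨c, hc⟩ := hf.exists_lead
  rw [h.moment_eq hw T hc, h0 w hw, smul_zero]

theorem Kills.quad_mem {n : ℕ} (h : R.Kills W n) {w : N} (hw : w ∈ W) (T : ℤ) {f : ℤ → F}
    (hf : HasLead n 0 f) : R.quad f T w ∈ W := by
  rw [← Submodule.Quotient.mk_eq_zero, ← Submodule.mkQ_apply, ← moment_eq_mkQ hw]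
  exact h w hw T f hf

theorem kills_zero : R.Kills W 0 := by
  intro w _ T f hf
  exact finsum_eq_zero_of_forall_eq_zero fun k => by rw [hf k, zero_smul]

/-- If all moments vanish then `W` is stable under all products of two fermions. -/
theorem a_a_mem_of_kills (h : ∀ n, R.Kills W n) {w : N} (hw : w ∈ W) (k l : ℤ) :
    R.a k (R.a l w) ∈ W := by
  obtain ⟨K, hK⟩ := R.exists_bound w
  suffices h0 : ∀ n : ℕ, R.two W w (K - n) (k + l - (K - n)) = 0 by
    rw [← Submodule.Quotient.mk_eq_zero, ← Submodule.mkQ_apply, ← two]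
    by_cases hk : K < k
    · exact R.two_eq_zero hw hK (Or.inl hk)
    · have h1 := h0 (K - k).toNat
      rwa [show K - ((K - k).toNat : ℤ) = k by omega, add_sub_cancel_left] at h1
  intro n
  induction n using Nat.strong_induction_on with
  | _ n ih =>
    by_cases hn : K < k + l - (K - n)
    · exact R.two_eq_zero hw hK (Or.inr hn)
    obtain ⟨m, hm⟩ : ∃ m : ℕ, K - n - m = k + l - K := ⟨(K - n - (k + l - K)).toNat, by omega⟩
    -- Write `T = k + l`. The weight `x - (T - K) choose m` is `1` at `K - n` and vanishes for `T -
    -- K ≤ x < K - n`. Larger `x` are covered by induction, or exceed the bound `K`, so a single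
    -- term remains.
    have h1 := h (m + 1) w hw (k + l) _
      (((hasLead_bin (K := F) m).shift (-(k + l - K))).of_lt (Nat.lt_succ_self m))
    rw [moment, finsum_eq_single _ (K - n)] at h1
    · rwa [show K - n + -(k + l - K) = (m : ℕ) by omega, bin_natCast, Nat.choose_self,
        Nat.cast_one, one_smul] at h1
    · intro x hx
      by_cases hx1 : K - n < x
      · by_cases hx2 : K < x
        · rw [R.two_eq_zero hw hK (Or.inl hx2), smul_zero]
        · have h2 := ih (K - x).toNat (by omega)
          rw [show K - ((K - x).toNat : ℤ) = x by omega] at h2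
          rw [h2, smul_zero]
      · by_cases hx2 : K < k + l - x
        · rw [R.two_eq_zero hw hK (Or.inr hx2), smul_zero]
        · rw [show x + -(k + l - K) = ((x + -(k + l - K)).toNat : ℕ) by omega, bin_natCast,
            Nat.choose_eq_zero_of_lt (by omega), Nat.cast_zero, zero_smul]

variable [Algebra ZHalf F]

/-- Reflection `k ↦ T - k` negates the moment by antisymmetry but preserves the leading coefficient
in even degree, so the moment equals its negative. -/
theorem Kills.succ_of_even {n : ℕ} (h : R.Kills W n) (hn : Even n) : R.Kills W (n + 1) := by
  refine h.succ fun w hw T => ?_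
  have h1 := h.moment_eq hw T ((hasLead_bin n).reflect T)
  rw [moment_reflect hw, hn.neg_one_pow, one_mul, one_smul] at h1
  exact eq_zero_of_eq_neg (F := F) h1.symm

/-- Modulo `W`, the operator `L(T + shift)` is a moment of degree one with leading coefficient
`-1/2`, and it maps `W` to `W`. -/
theorem kills_two (hW : ∀ n, ∀ w ∈ W, R.L n w ∈ W) : R.Kills W 2 := by
  have h1 := (kills_zero (R := R) (W := W)).succ_of_even Even.zero
  refine h1.succ fun w hw T => ?_
  have hlead : HasLead 1 (-half F) fun k => -(half F * kap F Z k) := by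
    refine (HasLead.linear (-(half F * (Z.shift * half F))) (-half F)).congr (fun k => ?_) rfl
    simp only [kap]
    ring
  have h2 := h1.moment_eq hw T hlead
  rw [moment_eq_mkQ hw] at h2
  have h3 := mkQ_eq_zero (hW (T + Z.shift) w hw)
  rw [L_apply, add_sub_cancel_right, map_add, map_smul, mkQ_eq_zero hw, smul_zero, add_zero,
    h2] at h3
  refine (smul_eq_zero.1 h3).resolve_left fun h0 => ?_
  have := two_mul_half F
  rw [neg_eq_zero.1 h0, mul_zero] at this
  exact zero_ne_one this

end FockRep

namespace FockRep

variable {F : Type*} [Field F] {N : Type*} [AddCommGroup N] [Module F N]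
  {Z : Sector} {R : FockRep F N Z} {W : Submodule F N}

/-! ## The commutator with a quadratic operator of low degree -/

theorem moment_shift {w : N} (f : ℤ → F) (T e : ℤ) :
    ∑ᶠ k, f k • R.two W w (k + e) (T - k) = R.moment W (fun k => f (k - e)) (T + e) w := by
  rw [moment, ← finsum_comp_equiv (Equiv.addRight e)
    (f := fun k => f (k - e) • R.two W w k (T + e - k))]
  refine finsum_congr fun k => ?_
  simp only [Equiv.coe_addRight, add_sub_cancel_right, add_sub_add_right_eq_sub]

theorem moment_add {w : N} (hw : w ∈ W) (f g : ℤ → F) (T : ℤ) :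
    R.moment W (fun k => f k + g k) T w = R.moment W f T w + R.moment W g T w := by
  simp only [moment]
  rw [← finsum_add_distrib (finite_two hw f T) (finite_two hw g T)]
  exact finsum_congr fun k => add_smul _ _ _

/-- The operator `X = quad f` preserves `W` and so acts on the quotient. Applied to the vanishing
moment of `φ`, it gives the moment of `φ` at `X w`, again zero, plus the commutators of `X` with the
two fermions. The displayed moment is the sum of these commutators. -/
theorem Kills.moment_comm {n : ℕ} (h : R.Kills W n) {f φ : ℤ → F} (hf : HasLead n 0 f)
    (hφ : HasLead n 0 φ) {w : N} (hw : w ∈ W) (U e : ℤ) :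
    R.moment W (fun k => φ (k - e) * (f k - f (e - k - Z.shift)) +
      φ k * (f (U - k) - f (k + e - Z.shift - U))) U w = 0 := by
  set X := R.quad f (e - Z.shift) with hX
  have hXW : ∀ w ∈ W, X w ∈ W := fun w hw => h.quad_mem hw _ hf
  have hle : W ≤ W.comap X := hXW
  have hcomm : ∀ r w, X (R.a r w) =
      R.a r (X w) + (f (r + e) - f (-r - Z.shift)) • R.a (r + e) w := by
    intro r w
    have h1 := R.quad_comm f (e - Z.shift) r w
    rw [show e - Z.shift + r + Z.shift = r + e by ring, sub_eq_iff_eq_add'] at h1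
    exact h1
  have htwo : ∀ k l, W.mapQ W X hle (R.two W w k l) = R.two W (X w) k l +
      (f (l + e) - f (-l - Z.shift)) • R.two W w k (l + e) +
      (f (k + e) - f (-k - Z.shift)) • R.two W w (k + e) l := by
    intro k l
    simp only [two, Submodule.mkQ_apply, Submodule.mapQ_apply, ← Submodule.Quotient.mk_smul,
      ← Submodule.Quotient.mk_add]
    rw [hcomm k, hcomm l, map_add, map_smul]
  have h0 : W.mapQ W X hle (R.moment W φ (U - e) w) = 0 := by rw [h w hw _ φ hφ, map_zero]
  rw [moment, map_finsum _ (finite_two hw φ (U - e))] at h0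
  have hterm : ∀ k, W.mapQ W X hle (φ k • R.two W w k (U - e - k)) =
      φ k • R.two W (X w) k (U - e - k) +
      ((φ k * (f (U - k) - f (k + e - Z.shift - U))) • R.two W w k (U - k) +
      (φ k * (f (k + e) - f (-k - Z.shift))) • R.two W w (k + e) (U - e - k)) := by
    intro k
    rw [map_smul, htwo, show U - e - k + e = U - k by ring,
      show -(U - e - k) - Z.shift = k + e - Z.shift - U by ring, smul_add, smul_add, smul_smul,
      smul_smul, add_assoc]
  have hshift := moment_shift (R := R) (W := W) (w := w)
    (fun k => φ k * (f (k + e) - f (-k - Z.shift))) (U - e) e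
  have hfin3 : (fun k => (φ k * (f (k + e) - f (-k - Z.shift))) •
      R.two W w (k + e) (U - e - k)).HasFiniteSupport := by
    have h3 := (finite_two (R := R) hw (fun k => φ (k - e) * (f k - f (e - k - Z.shift)))
      U).fun_comp_of_injective (add_left_injective e)
    refine (iff_of_eq (congrArg Function.HasFiniteSupport (funext fun k => ?_))).1 h3
    simp only [add_sub_cancel_right]
    rw [show e - (k + e) - Z.shift = -k - Z.shift by ring, show U - (k + e) = U - e - k by ring]
  have hfin2 := finite_two (R := R) hw (fun k => φ k * (f (U - k) - f (k + e - Z.shift - U))) U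
  have hfin23 : (fun k => (φ k * (f (U - k) - f (k + e - Z.shift - U))) • R.two W w k (U - k) +
      (φ k * (f (k + e) - f (-k - Z.shift))) • R.two W w (k + e) (U - e - k)).HasFiniteSupport :=
    hfin2.add hfin3
  have h00 := h (X w) (hXW w hw) (U - e) φ hφ
  rw [moment] at h00
  rw [finsum_congr hterm, finsum_add_distrib (finite_two (hXW w hw) φ (U - e)) hfin23,
    finsum_add_distrib hfin2 hfin3, hshift, h00, zero_add, ← moment, sub_add_cancel] at h0
  rw [moment_add hw, add_comm, ← h0]
  congr 2
  funext k
  rw [sub_add_cancel, show -(k - e) - Z.shift = e - k - Z.shift by ring]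

/-- `moment_comm` is used for binomials of degrees `i + 1` and `j + 1`. As `i + 1` is odd, `f(k)`
and `-f(-k)` have equal leading coefficients, the terms of degree `i + j + 2` cancel, and the next
coefficient is affine in the free shift `e`. Comparing `e = 0` with `e = 1` isolates its slope, a
sum of two adjacent binomials. -/
theorem Kills.choose_smul {i j : ℕ} (h : R.Kills W (i + j + 1)) (hi : Even i) (hi0 : 0 < i)
    (hj0 : 0 < j) {w : N} (hw : w ∈ W) (U : ℤ) :
    (2 * ((i + j + 2).choose (i + 1) : F)) • R.moment W (bin F (i + j + 1)) U w = 0 := by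
  have hf := hasLead_bin (K := F) (i + 1)
  have hφ := hasLead_bin (K := F) (j + 1)
  set f := bin F (i + 1)
  set φ := bin F (j + 1)
  have hf' : HasLead (i + 1) 1 fun k => -1 * f (0 - k) :=
    (hf.reflect 0).smul (-1) |>.congr (fun _ => rfl) (by rw [hi.add_one.neg_one_pow]; ring)
  have key : ∀ e : ℤ, (((i + j + 1).choose (j + 1) : F) * (2 * (U + Z.shift - e)) -
      (i + j + 1).choose j * (2 * e)) • R.moment W (bin F (i + j + 1)) U w = 0 := by
    intro e
    rw [← h.moment_eq hw U, h.moment_comm (f := f) (φ := φ) (hf.of_lt (by omega))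
      (hφ.of_lt (by omega)) hw U e]
    -- The combination is regrouped as one difference of translates of `φ` times `f`, plus `φ` times
    -- differences of translates of `f`, so that each product visibly has degree `i + j + 1`.
    have h1 := (hφ.translate (-e)).mul (hf.add (hf'.shift (Z.shift - e)))
    have h2 := hφ.mul ((((hf.translate (e - Z.shift - U)).smul (-1)).add
      ((hf'.translate (U + Z.shift - e)).shift (-U))))
    rw [show j + (i + 1) = i + j + 1 by ring] at h1
    rw [show j + 1 + i = i + j + 1 by ring] at h2
    refine (h1.add h2).congr (fun k => ?_) ?_
    · rw [show k + -e = k - e by ring, show 0 - (k + (Z.shift - e)) = e - k - Z.shift by ring,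
        show k + (e - Z.shift - U) = k + e - Z.shift - U by ring,
        show 0 - (k + -U + (U + Z.shift - e)) = e - k - Z.shift by ring,
        show 0 - (k + -U) = U - k by ring]
      ring
    · push_cast
      ring
  have h0 := key 0
  have h1 := key 1
  have h2 := congrArg₂ (· - ·) h0 h1
  simp only [← sub_smul, sub_self] at h2
  have hch : (i + j + 2).choose (i + 1) = (i + j + 1).choose j + (i + j + 1).choose (j + 1) := by
    rw [← Nat.choose_succ_succ]
    exact (Nat.choose_symm_of_eq_add (by omega)).trans rfl
  rw [hch]
  convert h2 using 2
  push_cast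
  ring

end FockRep

namespace FockRep

variable {F : Type*} [Field F] [Algebra ZHalf F] {N : Type*} [AddCommGroup N] [Module F N]
  {Z : Sector} {R : FockRep F N Z} {W : Submodule F N}

/-! ## The differential equation for the two-point function -/

/-- Only finitely many `L(m) w` with `m ≥ 0` are nonzero, so the sum of their individual bounds
serves for all of them. -/
theorem exists_joint_bound (R : FockRep F N Z) (w : N) : ∃ K : ℤ, 0 ≤ K ∧
    (∀ k, K < k → R.a k w = 0) ∧ (∀ m, K < m → R.L m w = 0) ∧
    ∀ m, 0 ≤ m → ∀ k, K < k → R.a k (R.L m w) = 0 := by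
  obtain ⟨K₁, h₁⟩ := R.exists_bound w
  obtain ⟨K₂, h₂⟩ := R.exists_bound_L w
  choose B hB using fun m => R.exists_bound (R.L m w)
  refine ⟨max (max 0 (max K₁ K₂)) (∑ m ∈ Finset.Icc 0 K₂, |B m|), by omega,
    fun k hk => h₁ k (by omega), fun m hm => h₂ m (by omega), fun m hm k hk => ?_⟩
  by_cases hm2 : K₂ < m
  · rw [h₂ m hm2, map_zero]
  · refine hB m k ?_
    have h3 : |B m| ≤ ∑ m ∈ Finset.Icc 0 K₂, |B m| :=
      Finset.single_le_sum (f := fun m => |B m|) (fun _ _ => abs_nonneg _)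
        (Finset.mem_Icc.2 ⟨hm, by omega⟩)
    have h4 := le_abs_self (B m)
    omega

theorem hasLead_lam : HasLead 2 (6 * half F ^ 2) (lam F Z) := by
  intro k
  simp only [lam, kap]
  push_cast
  ring

omit [Algebra ZHalf F] in
/-- A sum over an interval containing all relevant indices is a moment. -/
theorem sum_eq_moment {w : N} (hw : w ∈ W) {K : ℤ} (hK : ∀ k, K < k → R.a k w = 0) (f : ℤ → F)
    {x₀ x₁ m T : ℤ} (h₀ : x₀ ≤ T - K) (h₁ : K + m ≤ x₁) :
    ∑ x ∈ Finset.Icc x₀ x₁, f x • R.two W w (x - m) (T - x) =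
      R.moment W (fun k => f (k + m)) (T - m) w := by
  rw [moment, ← finsum_comp_equiv (Equiv.subRight m)
    (f := fun k => f (k + m) • R.two W w k (T - m - k)),
    finsum_eq_sum_of_support_subset (s := Finset.Icc x₀ x₁)]
  · refine Finset.sum_congr rfl fun x _ => ?_
    simp only [Equiv.subRight_apply, sub_add_cancel]
    rw [show T - m - (x - m) = T - x by ring]
  · intro x hx
    by_contra hx'
    apply hx
    rw [Finset.mem_coe, Finset.mem_Icc] at hx'
    simp only [Equiv.subRight_apply]
    rw [R.two_eq_zero hw hK (by omega), smul_zero]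

/-- The relation `theta_eq` is applied to `a(T - x) w` and summed over `x` against a binomial of
degree `j`. On the left stands a moment with coefficient `lam * f`, of degree `j + 2`. On the right,
the terms with `L(m)` outermost and those with `L(m) w` are moments of degree `j` and vanish. What
remains comes from `[L(m), a(T - x)]`, again of degree `j + 2`; comparing leading coefficients gives
the factor. -/
theorem Kills.bpz {j : ℕ} (h : R.Kills W (j + 2)) (hW : ∀ n, ∀ w ∈ W, R.L n w ∈ W) {w : N}
    (hw : w ∈ W) (T : ℤ) :
    (6 * half F ^ 2 * (j + 2).choose 2 + half F * (2 * (j + 2) - 1)) •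
      R.moment W (bin F (j + 2)) T w = 0 := by
  obtain ⟨K, hK0, hKa, hKL, hKaL⟩ := exists_joint_bound R w
  set f := bin F j with hf
  have hle : ∀ m, W ≤ W.comap (R.L m) := hW
  let t₁ : ℤ → ℤ → N ⧸ W := fun x m =>
    if m < 0 then W.mapQ W (R.L m) (hle m) (R.two W w (x - m) (T - x)) else 0
  let t₂ : ℤ → ℤ → N ⧸ W := fun x m => if m < 0 then 0 else R.two W (R.L m w) (x - m) (T - x)
  let t₃ : ℤ → ℤ → N ⧸ W := fun x k => if x < k then 0 else
    (kap F Z (T - x) + (x - k : ℤ) * half F) • R.two W w k (T - k)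
  have fin₁ : ∀ x, (t₁ x).HasFiniteSupport := by
    intro x
    refine (Set.finite_Icc (x - K) 0).subset fun m hm => ?_
    by_contra hm'
    rw [Set.mem_Icc] at hm'
    apply hm
    simp only [t₁]
    split_ifs
    · rw [R.two_eq_zero hw hKa (by omega), map_zero]
    · rfl
  have fin₂ : ∀ x, (t₂ x).HasFiniteSupport := by
    intro x
    refine (Set.finite_Icc 0 K).subset fun m hm => ?_
    by_contra hm'
    rw [Set.mem_Icc] at hm'
    apply hm
    simp only [t₂]
    split_ifs
    · rfl
    · rw [hKL m (by omega), two, map_zero, map_zero, map_zero]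
  have fin₃ : ∀ x, (t₃ x).HasFiniteSupport := by
    intro x
    refine (Set.finite_Icc (T - K) K).subset fun m hm => ?_
    by_contra hm'
    rw [Set.mem_Icc] at hm'
    apply hm
    simp only [t₃]
    split_ifs
    · rfl
    · rw [R.two_eq_zero hw hKa (by omega), smul_zero]
  have hmode : ∀ x, lam F Z x • R.two W w x (T - x) =
      ∑ᶠ m, t₁ x m + ∑ᶠ m, t₂ x m - ∑ᶠ k, t₃ x k := by
    intro x
    have hfin₃ : (fun m => t₃ x (x - m)).HasFiniteSupport :=
      (fin₃ x).fun_comp_of_injective (sub_right_injective (b := x))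
    have hfin₁₂ : (fun m => t₁ x m + t₂ x m).HasFiniteSupport := (fin₁ x).add (fin₂ x)
    rw [← finsum_comp_equiv (Equiv.subLeft x) (f := t₃ x)]
    simp only [Equiv.subLeft_apply]
    rw [← finsum_add_distrib (fin₁ x) (fin₂ x), ← finsum_sub_distrib hfin₁₂ hfin₃, two, ← map_smul,
      ← theta_eq, theta, map_finsum _ (R.finite_theta x _)]
    refine finsum_congr fun m => ?_
    simp only [t₁, t₂, t₃, two]
    by_cases hm : m < 0
    · rw [if_pos hm, if_pos hm, if_pos hm, if_pos (by omega), add_zero, sub_zero]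
      rfl
    · rw [if_neg hm, if_neg hm, if_neg hm, if_neg (by omega), zero_add, L_comm, map_sub, map_smul,
        map_sub, map_smul, sub_sub_cancel, show T - (x - m) = T - x + m by ring]
  -- The lower end is where `a(T - x) w` starts to be nonzero. The upper end makes the sums of `t₁`
  -- and `t₂` over `x` complete moments, as `x - m ≤ K` and `m ≤ K` for their nonzero terms; `t₃`
  -- becomes a partial sum over `k ≤ x ≤ 2K`.
  set I := Finset.Icc (T - K) (2 * K) with hI
  have hsum : R.moment W (fun k => lam F Z k * f k) T w =
      ∑ᶠ m, ∑ x ∈ I, f x • t₁ x m + ∑ᶠ m, ∑ x ∈ I, f x • t₂ x m - ∑ᶠ k, ∑ x ∈ I, f x • t₃ x k := by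
    have h1 := sum_eq_moment hw hKa (fun k => lam F Z k * f k) (x₀ := T - K) (x₁ := 2 * K) (m := 0)
      (T := T) le_rfl (by omega)
    simp only [sub_zero, add_zero] at h1
    rw [← h1, finsum_sum_comm, finsum_sum_comm, finsum_sum_comm, ← Finset.sum_add_distrib,
      ← Finset.sum_sub_distrib]
    · refine Finset.sum_congr rfl fun x _ => ?_
      rw [mul_comm, mul_smul, hmode, smul_sub, smul_add, smul_finsum' _ (fin₁ x),
        smul_finsum' _ (fin₂ x), smul_finsum' _ (fin₃ x)]
    · exact fun x _ => (fin₃ x).fun_comp (smul_zero _)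
    · exact fun x _ => (fin₂ x).fun_comp (smul_zero _)
    · exact fun x _ => (fin₁ x).fun_comp (smul_zero _)
  have hfj : HasLead (j + 2) 0 f := (hasLead_bin j).of_lt (by omega)
  have hz₁ : ∀ m, ∑ x ∈ I, f x • t₁ x m = 0 := by
    intro m
    simp only [t₁]
    split_ifs with hm
    · simp only [← map_smul]
      rw [← map_sum, sum_eq_moment hw hKa f le_rfl (by omega), h w hw _ _ (hfj.shift m), map_zero]
    · simp
  have hz₂ : ∀ m, ∑ x ∈ I, f x • t₂ x m = 0 := by
    intro m
    simp only [t₂]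
    split_ifs with hm
    · simp
    · by_cases hmK : K < m
      · simp [hKL m hmK, two]
      · rw [sum_eq_moment (hW m w hw) (hKaL m (by omega)) f le_rfl (by omega),
          h _ (hW m w hw) _ _ (hfj.shift m)]
  have hz₃ : ∑ᶠ k, ∑ x ∈ I, f x • t₃ x k = (half F * (2 * (j + 2) - 1)) •
      R.moment W (bin F (j + 2)) T w := by
    -- `G₁` and `G₂` are antiderivatives of `f(k)` and `k f(k)`. They put the partial sum over `k ≤
    -- x ≤ 2K` into the closed form `H`, whose leading coefficient can be read off.
    let G₁ : ℤ → F := bin F (j + 1)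
    let G₂ : ℤ → F := fun k => (j + 1) * bin F (j + 2) k + j * bin F (j + 1) k
    have hG₁ : ∀ k, G₁ (k + 1) - G₁ k = f k := fun k => by
      simp only [G₁, bin_succ, hf]
      ring
    have hG₂ : ∀ k, G₂ (k + 1) - G₂ k = k * f k := fun k => by
      simp only [G₂, bin_succ, hf, mul_bin]
      ring
    let c : F := T + Z.shift * half F
    let H : ℤ → F := fun k => (c + -half F * k) * (G₁ (2 * K + 1) - G₁ k) -
      half F * (G₂ (2 * K + 1) - G₂ k)
    have hH : HasLead (j + 2) (half F * (2 * (j + 2) - 1)) H := by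
      have h1 := (HasLead.linear c (-half F)).mul
        (((HasLead.const (G₁ (2 * K + 1))).of_lt (Nat.succ_pos j)).sub (hasLead_bin (j + 1)))
      rw [show 1 + (j + 1) = j + 2 by ring] at h1
      have h2 := ((HasLead.const (G₂ (2 * K + 1))).of_lt (Nat.succ_pos (j + 1))).sub
        (((hasLead_bin (j + 2)).smul ((j : F) + 1)).add
          (((hasLead_bin (j + 1)).smul (j : F)).of_lt (Nat.lt_succ_self _)))
      refine (h1.sub (h2.smul (half F))).congr (fun k => rfl) ?_
      push_cast [Nat.choose_one_right]
      ring
    rw [← h.moment_eq hw T hH, moment]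
    refine finsum_congr fun k => ?_
    by_cases hk : T - K ≤ k ∧ k ≤ K
    · have hsub : Finset.Ico k (2 * K + 1) ⊆ I := by
        intro x hx
        rw [Finset.mem_Ico] at hx
        rw [hI, Finset.mem_Icc]
        omega
      rw [← Finset.sum_subset hsub]
      · have hsumH : H k = ∑ x ∈ Finset.Ico k (2 * K + 1),
            f x * (kap F Z (T - x) + (x - k : ℤ) * half F) := by
          simp only [H]
          rw [← sum_Ico_telescope hG₁ (by omega), ← sum_Ico_telescope hG₂ (by omega),
            Finset.mul_sum, Finset.mul_sum, ← Finset.sum_sub_distrib]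
          refine Finset.sum_congr rfl fun x _ => ?_
          simp only [kap, c]
          push_cast
          linear_combination (-(x : F) * f x) * two_mul_half F
        rw [hsumH, Finset.sum_smul]
        refine Finset.sum_congr rfl fun x hx => ?_
        rw [Finset.mem_Ico] at hx
        simp only [t₃]
        rw [if_neg (by omega), smul_smul]
      · intro x hx hx'
        rw [hI, Finset.mem_Icc] at hx
        rw [Finset.mem_Ico] at hx'
        simp only [t₃]
        rw [if_pos (by omega), smul_zero]
    · have h0 : R.two W w k (T - k) = 0 := R.two_eq_zero hw hKa (by omega)
      simp only [t₃, h0]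
      simp
  have hlhs := (hasLead_lam (F := F) (Z := Z)).mul (hasLead_bin (K := F) j)
  rw [add_comm 2 j] at hlhs
  rw [h.moment_eq hw T hlhs, hz₃, finsum_congr hz₁, finsum_congr hz₂,
    finsum_zero, add_zero, zero_sub, ← add_eq_zero_iff_eq_neg, ← add_smul] at hsum
  rw [← hsum]
  congr 1
  ring

end FockRep

namespace FockRep

variable {F : Type*} [Field F] [Algebra ZHalf F] {N : Type*} [AddCommGroup N] [Module F N]
  {Z : Sector} {R : FockRep F N Z} {W : Submodule F N}

/-! ## Submodules stable under the Virasoro operators -/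

/-- If the moment were nonzero, its coefficient in `bpz` and in every `choose_smul` would vanish in
`F`. Arithmetic modulo the characteristic rules this out. -/
theorem Kills.succ_of_odd {n : ℕ} (h : R.Kills W n) (hW : ∀ n, ∀ w ∈ W, R.L n w ∈ W)
    (h7 : ringChar F ≠ 7) (hn : Odd n) (hn3 : 3 ≤ n) : R.Kills W (n + 1) := by
  have h2 := two_ne F
  refine h.succ fun w hw T => ?_
  obtain ⟨j, rfl⟩ : ∃ j, n = j + 2 := ⟨n - 2, by omega⟩
  have hb := h.bpz hW hw T
  by_cases hμ : R.moment W (bin F (j + 2)) T w = 0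
  · exact hμ
  exfalso
  -- Four times the `bpz` coefficient is `3n(n - 1) + 2(2n - 1) = (3n - 2)(n + 1)` with `n = j + 2`.
  have key : (3 * ((j + 2 : ℕ) : F) - 2) * ((j + 2 + 1 : ℕ) : F) = 0 := by
    have hb' := (smul_eq_zero.1 hb).resolve_right hμ
    have hc : ((j + 2).choose 2 : F) * 2 = (j + 2) * (j + 1) := by
      have h1 := Nat.choose_two_right (j + 2)
      have h3 : (j + 2).choose 2 * 2 = (j + 2) * (j + 1) := by
        rw [h1, Nat.add_sub_assoc (by norm_num), Nat.div_mul_cancel]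
        exact (Nat.even_mul_succ_self (j + 1)).two_dvd.trans (by rw [mul_comm])
      have h4 := congrArg (Nat.cast : ℕ → F) h3
      push_cast at h4
      exact h4
    have hh := two_mul_half F
    push_cast
    linear_combination 4 * hb' - 3 * hc - (6 * ((j + 2).choose 2 : F) * (2 * half F + 1) +
      2 * (2 * ((j : F) + 2) - 1)) * hh
  by_cases h1 : ((j + 2 + 1 : ℕ) : F) = 0
  · set p := ringChar F with hp
    have hchar : CharP F p := ringChar.charP F
    have hpd : p ∣ j + 2 + 1 := (CharP.cast_eq_zero_iff F p _).1 h1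
    have hpp : p.Prime := (CharP.char_is_prime_or_zero F p).resolve_right (by
      rintro h0
      rw [h0, Nat.zero_dvd] at hpd
      omega)
    have hfact := Fact.mk hpp
    have hp2 : Odd p := hpp.odd_of_ne_two (by
      intro h
      apply h2
      have := CharP.cast_eq_zero F p
      rw [h] at this
      exact_mod_cast this)
    -- Since `n + 1` is even and `p` odd, the cofactor `m` is even, hence at least `2`; this leaves
    -- room for a positive second degree in `choose_smul`.
    obtain ⟨a, m, hm, hpa⟩ := Nat.exists_eq_pow_mul_and_not_dvd (n := j + 2 + 1) (by omega) p
      hpp.ne_one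
    have hodd : Odd (p ^ a) := hp2.pow
    have ha : a ≠ 0 := by
      rintro rfl
      rw [pow_zero, one_mul] at hpa
      exact hm (hpa ▸ hpd)
    have hp3 : 3 ≤ p ^ a := by
      have h4 : p ≤ p ^ a := Nat.le_self_pow ha p
      have h5 := hpp.two_le
      obtain ⟨k, hk⟩ := hp2
      omega
    have hm2 : 2 ≤ m := by
      have he : Even (p ^ a * m) := hpa ▸ hn.add_one
      have hme : Even m := (Nat.even_mul.1 he).resolve_left (Nat.not_even_iff_odd.2 hodd)
      obtain ⟨k, rfl⟩ := hme
      have : k ≠ 0 := by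
        rintro rfl
        simp at hpa
      omega
    have hle : p ^ a * 2 ≤ j + 2 + 1 := hpa ▸ Nat.mul_le_mul_left _ hm2
    -- The even number `q = p^a - 1` is the first degree, so the binomial is `n + 1` over `p^a`,
    -- prime to `p`.
    obtain ⟨q, hq⟩ : ∃ q, p ^ a = q + 1 := ⟨p ^ a - 1, by omega⟩
    obtain ⟨r, hr⟩ : ∃ r, j + 2 = q + r + 1 := ⟨j + 2 - q - 1, by omega⟩
    have hqe : Even q := by
      rw [hq] at hodd
      simpa [Nat.even_add_one, ← Nat.not_even_iff_odd] using hodd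
    rw [hr] at h hμ
    have hc := h.choose_smul hqe (by omega) (by omega) hw T
    have hc' := (mul_eq_zero.1 ((smul_eq_zero.1 hc).resolve_right hμ)).resolve_left h2
    rw [show q + r + 2 = p ^ a * m by omega, ← hq] at hc'
    exact cast_choose_pow_ne_zero hm hc'
  · have h3 := (mul_eq_zero.1 key).resolve_right h1
    have h3' : 3 * ((j + 2 : ℕ) : F) = 2 := sub_eq_zero.1 h3
    -- For `n = 3` the condition `3n = 2` reads `7 = 0`.
    have hj : j ≠ 1 := by
      rintro rfl
      have h70 : ((7 : ℕ) : F) = 0 := by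
        push_cast at h3' ⊢
        linear_combination h3'
      have hd := (ringChar.spec F 7).1 h70
      rcases (Nat.dvd_prime (by norm_num)).1 hd with h | h
      · have : ((1 : ℕ) : F) = 0 := (ringChar.spec F 1).2 (h ▸ dvd_rfl)
        simp at this
      · exact h7 h
    obtain ⟨i, rfl⟩ : ∃ i, j = i + 1 := ⟨j - 1, by omega⟩
    -- Here `n ≥ 5`, and six times the binomial is `(n + 1) n (n - 1)`. With `3n = 2` and `n + 1 ≠
    -- 0`, a zero factor would force `2 = 0` or `1 = 0`.
    have hc := Kills.choose_smul (i := 2) (j := i) (by convert h using 1; omega) even_two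
      two_pos (by omega) hw T
    rw [show 2 + i + 1 = i + 1 + 2 by ring] at hc
    have hc' := (mul_eq_zero.1 ((smul_eq_zero.1 hc).resolve_right hμ)).resolve_left h2
    have h6 : (6 : F) * ((2 + i + 2).choose (2 + 1) : F) = (i + 4) * (i + 3) * (i + 2) := by
      have := Nat.descFactorial_eq_factorial_mul_choose (2 + i + 2) 3
      have h4 : (2 + i + 2).descFactorial 3 = (i + 4) * (i + 3) * (i + 2) := by
        rw [show 2 + i + 2 = i + 4 by ring]
        simp only [Nat.descFactorial]
        rw [show i + 4 - 2 = i + 2 by omega, show i + 4 - 1 = i + 3 by omega]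
        simp only [Nat.sub_zero]
        ring
      rw [h4] at this
      have h5 := congrArg (Nat.cast : ℕ → F) this
      push_cast at h5
      rw [h5]
      norm_num [Nat.factorial]
    rw [hc', mul_zero] at h6
    push_cast at h3'
    push_cast at h1
    rcases mul_eq_zero.1 h6.symm with h4 | h4
    · rcases mul_eq_zero.1 h4 with h4 | h4
      · exact h1 (by linear_combination h4)
      · exact h2 (by linear_combination 3 * h4 - h3')
    · exact one_ne_zero (α := F) (by linear_combination h3' - 3 * h4)

theorem kills_all (hW : ∀ n, ∀ w ∈ W, R.L n w ∈ W) (h7 : ringChar F ≠ 7) (n : ℕ) :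
    R.Kills W n := by
  induction n with
  | zero => exact kills_zero
  | succ n ih =>
    rcases Nat.even_or_odd n with hn | hn
    · exact ih.succ_of_even hn
    · by_cases h1 : n = 1
      · subst h1
        exact kills_two hW
      · exact ih.succ_of_odd hW h7 hn (by obtain ⟨k, rfl⟩ := hn; omega)

omit [Algebra ZHalf F] in
theorem word_mem_of_even (hW : ∀ k l, ∀ w ∈ W, R.a k (R.a l w) ∈ W) {w : N} (hw : w ∈ W)
    (l : List ℤ) (hl : Even l.length) : R.word l w ∈ W := by
  induction l using List.twoStepInduction with
  | nil => exact hw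
  | singleton k => simp at hl
  | cons_cons k m l ih _ =>
    refine hW k m _ (ih ?_)
    simpa [Nat.even_add_one] using hl

/-- A nonzero homogeneous subspace stable under the Virasoro operators contains all monomials of
its parity. -/
theorem word_vac_mem (hW : ∀ n, ∀ w ∈ W, R.L n w ∈ W) (h7 : ringChar F ≠ 7) {t : ZMod 2}
    (ht : W ≤ R.H 0 0 t) (h0 : W ≠ ⊥) (l : List ℤ) (hl : (l.length : ZMod 2) = t) :
    R.word l R.vac ∈ W := by
  obtain ⟨w, hw, hw0⟩ := W.ne_bot_iff.1 h0
  have he := fun l : List ℤ => word_mem_of_even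
    (fun k l _ hw => a_a_mem_of_kills (kills_all hW h7) hw k l) hw l
  obtain ⟨j, hj⟩ := ht hw
  -- The lowering word need not have even length. Only its composite with the raising word `l` does,
  -- because both `w` and `l` have parity `t`.
  obtain ⟨m, -, hm, hm0⟩ := lower hj hw0
  have heven : ∀ n : ℕ, (n : ZMod 2) = 0 → Even n := fun n => (ZMod.natCast_eq_zero_iff_even).1
  obtain ⟨-, c, hc, ⟨hp, h⟩ | ⟨hp, hs, h⟩⟩ := mem_V_zero hm hm0
  · have h1 := he (l ++ m) (heven _ (by rw [List.length_append]; push_cast; rw [hl, hp]))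
    rw [word_append, h, word_smul] at h1
    exact (W.smul_mem_iff hc).1 h1
  -- When the lowering ends at `a(0) vac`, an extra zero mode returns to the vacuum, by `a(0)² =
  -- 1/2`, and corrects the parity.
  · have h1 := he (l ++ 0 :: m) (heven _ (by
      rw [List.length_append, List.length_cons]
      push_cast
      rw [hl, ← add_assoc, hp]
      decide))
    rw [word_append, word_cons, h, map_smul, a_zero_a_zero hs, smul_smul, word_smul] at h1
    refine (W.smul_mem_iff (mul_ne_zero hc fun hh => ?_)).1 h1
    simpa [hh] using two_mul_half F

end FockRep

/-! ## Maps out of cyclic modules -/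

/-- An action of `A` on `N` and a vector killed by the generators of a left ideal give a map from
the quotient by that ideal. -/
theorem exists_lift_quotient {D A N : Type*} [CommRing D] [Ring A] [Algebra D A] [AddCommGroup N]
    [Module D N] (φ : A →ₐ[D] Module.End D N) (v : N) (S : Set A) (hS : ∀ x ∈ S, φ x v = 0) :
    ∃ ψ : (A ⧸ Submodule.span A S) →ₗ[D] N, ψ ((Submodule.span A S).mkQ 1) = v ∧
      ∀ (a : A) x, ψ (a • x) = φ a (ψ x) := by
  let φ₀ : A →ₗ[D] N := LinearMap.applyₗ v ∘ₗ φ.toLinearMap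
  have h0 : (Submodule.span A S).restrictScalars D ≤ LinearMap.ker φ₀ := by
    intro x hx
    change φ x v = 0
    rw [Submodule.restrictScalars_mem] at hx
    induction hx using Submodule.span_induction with
    | mem x hx => exact hS x hx
    | zero => rw [map_zero, LinearMap.zero_apply]
    | add x y _ _ hx hy => rw [map_add, LinearMap.add_apply, hx, hy, add_zero]
    | smul a x _ hx => rw [smul_eq_mul, map_mul, Module.End.mul_apply, hx, map_zero]
  let ψ : (A ⧸ Submodule.span A S) →ₗ[D] N :=
    ((Submodule.span A S).restrictScalars D).liftQ φ₀ h0 ∘ₗ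
      (Submodule.Quotient.restrictScalarsEquiv D (Submodule.span A S)).symm.toLinearMap
  have hψ : ∀ a : A, ψ ((Submodule.span A S).mkQ a) = φ a v := fun a => rfl
  refine ⟨ψ, by rw [hψ, map_one, Module.End.one_apply], fun a x => ?_⟩
  obtain ⟨b, rfl⟩ := (Submodule.span A S).mkQ_surjective x
  rw [← map_smul, hψ, hψ, smul_eq_mul, map_mul, Module.End.mul_apply]

/-! ### Universal property, parity splitting and nondegeneracy of the Fock space -/

namespace Fock

section

variable (D : Type*) [CommRing D] (Z : Sector)

/-- A vector killed by the annihilation operators of a representation of the fermion algebra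
defines a map from the Fock space. -/
theorem exists_lift {N : Type*} [AddCommGroup N] [Module D N] (a : ℤ → N →ₗ[D] N) (v : N)
    (ha : ∀ k l w, a k (a l w) + a l (a k w) = if k + l + Z.shift = 0 then w else 0)
    (hv : ∀ k, 0 < 2 * k + Z.shift → a k v = 0) :
    ∃ ψ : Fock D Z →ₗ[D] N, ψ (vac D Z) = v ∧ ∀ k x, ψ (gen D Z k • x) = a k (ψ x) := by
  let φ : Fermion D Z →ₐ[D] Module.End D N :=
    RingQuot.liftAlgHom D ⟨FreeAlgebra.lift D a, by
      rintro _ _ ⟨k, l⟩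
      ext w
      rw [map_add, map_mul, map_mul, AlgHom.commutes, FreeAlgebra.lift_ι_apply,
        FreeAlgebra.lift_ι_apply]
      refine (ha k l w).trans ?_
      split_ifs <;> simp⟩
  have hφ : ∀ k, φ (gen D Z k) = a k := fun k =>
    (RingQuot.liftAlgHom_mkAlgHom_apply D _ _ _).trans (FreeAlgebra.lift_ι_apply _ _)
  obtain ⟨ψ, h1, h2⟩ := exists_lift_quotient φ v {x | ∃ k : ℤ, 0 < 2 * k + Z.shift ∧ x = gen D Z k}
    (by
      rintro _ ⟨k, hk, rfl⟩
      rw [hφ, hv k hk])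
  exact ⟨ψ, h1, fun k x => by rw [← hφ]; exact h2 _ _⟩

/-- The operator `a(k + shift / 2)`. -/
def mode (k : ℤ) : Fock D Z →ₗ[D] Fock D Z := Algebra.lsmul D D (Fock D Z) (gen D Z k)

theorem mode_apply (k : ℤ) (w : Fock D Z) : mode D Z k w = gen D Z k • w := rfl

theorem mode_anticomm (k l : ℤ) (w : Fock D Z) :
    mode D Z k (mode D Z l w) + mode D Z l (mode D Z k w) =
      if k + l + Z.shift = 0 then w else 0 := by
  simp only [mode_apply]
  rw [← mul_smul, gen_anticomm, add_smul, neg_smul, mul_smul]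
  split_ifs <;> simp

theorem mode_vac {k : ℤ} (hk : 0 < 2 * k + Z.shift) : mode D Z k (vac D Z) = 0 := by
  rw [mode_apply, vac, ← map_smul, Submodule.mkQ_apply, Submodule.Quotient.mk_eq_zero, smul_eq_mul,
    mul_one]
  exact Submodule.subset_span ⟨k, hk, rfl⟩

theorem mono_nil : mono D Z [] = vac D Z := by simp [mono]

theorem mono_cons (k : ℤ) (l : List ℤ) : mono D Z (k :: l) = mode D Z k (mono D Z l) := by
  rw [mode_apply, mono, mono, List.map_cons, List.prod_cons, mul_smul]

theorem mem_span_mono (w : Fock D Z) : w ∈ Submodule.span D (Set.range (mono D Z)) := by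
  have hstep : ∀ (x : FreeAlgebra D ℤ), ∀ w ∈ Submodule.span D (Set.range (mono D Z)),
      Fermion.mk D Z x • w ∈ Submodule.span D (Set.range (mono D Z)) := by
    intro x
    induction x using FreeAlgebra.induction with
    | grade0 r =>
      intro w hw
      rw [AlgHom.commutes, algebraMap_smul]
      exact Submodule.smul_mem _ _ hw
    | grade1 k =>
      intro w hw
      change mode D Z k w ∈ _
      induction hw using Submodule.span_induction with
      | mem x hx =>
        obtain ⟨l, rfl⟩ := hx
        exact Submodule.subset_span ⟨k :: l, mono_cons D Z k l⟩
      | zero => rw [map_zero]; exact zero_mem _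
      | add x y _ _ hx hy => rw [map_add]; exact add_mem hx hy
      | smul r x _ hx => rw [map_smul]; exact Submodule.smul_mem _ _ hx
    | mul x y hx hy =>
      intro w hw
      rw [map_mul, mul_smul]
      exact hx _ (hy w hw)
    | add x y hx hy =>
      intro w hw
      rw [map_add, add_smul]
      exact add_mem (hx w hw) (hy w hw)
  obtain ⟨y, rfl⟩ := (annihilators D Z).mkQ_surjective w
  obtain ⟨x, rfl⟩ : ∃ x, Fermion.mk D Z x = y :=
    RingQuot.mkAlgHom_surjective D (FermionRel D Z) y
  have h := hstep x _ (Submodule.subset_span ⟨[], mono_nil D Z⟩)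
  rwa [vac, ← map_smul, smul_eq_mul, mul_one] at h

/-- The projection onto the part of parity `s`. -/
theorem exists_proj [Algebra ZHalf D] (s : ZMod 2) : ∃ π : Fock D Z →ₗ[D] Fock.part D Z s,
    π ∘ₗ (Fock.part D Z s).subtype = LinearMap.id := by
  -- Replacing every `a(k)` by its negative preserves the relations, giving the parity involution
  -- `σ`; the projection is `(1 + εσ)/2` with `ε = (-1)^s`.
  obtain ⟨σ, hσ0, hσ⟩ := exists_lift D Z (N := Fock D Z) (fun k => -mode D Z k) (vac D Z)
    (fun k l w => by
      simp only [LinearMap.neg_apply, map_neg, neg_neg]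
      exact mode_anticomm D Z k l w)
    (fun k hk => by rw [LinearMap.neg_apply, mode_vac D Z hk, neg_zero])
  have hmono : ∀ l : List ℤ, σ (mono D Z l) = (-1 : D) ^ l.length • mono D Z l := by
    intro l
    induction l with
    | nil => rw [mono_nil, hσ0, List.length_nil, pow_zero, one_smul]
    | cons k l ih =>
      rw [mono_cons, mode_apply, hσ, ih, LinearMap.neg_apply, map_smul, List.length_cons, pow_succ,
        mul_neg_one, neg_smul, mode_apply]
  have h01 : ∀ t : ZMod 2, t = 0 ∨ t = 1 := by decide
  obtain ⟨ε, hε⟩ : ∃ ε : D, ∀ n : ℕ, ((n : ZMod 2) = s → ε * (-1) ^ n = 1) ∧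
      ((n : ZMod 2) ≠ s → ε * (-1) ^ n = -1) := by
    have h10 : (1 : ZMod 2) ≠ 0 := by decide
    have hpow : ∀ n : ℕ, ((n : ZMod 2) = 0 → (-1 : D) ^ n = 1) ∧
        ((n : ZMod 2) = 1 → (-1 : D) ^ n = -1) := fun n =>
      ⟨fun h => (ZMod.natCast_eq_zero_iff_even.1 h).neg_one_pow,
        fun h => (ZMod.natCast_eq_one_iff_odd.1 h).neg_one_pow⟩
    rcases h01 s with rfl | rfl
    · refine ⟨1, fun n => ⟨fun h => ?_, fun h => ?_⟩⟩
      · rw [(hpow n).1 h, one_mul]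
      · rw [(hpow n).2 ((h01 _).resolve_left h), one_mul]
    · refine ⟨-1, fun n => ⟨fun h => ?_, fun h => ?_⟩⟩
      · rw [(hpow n).2 h, neg_one_mul, neg_neg]
      · rw [(hpow n).1 ((h01 _).resolve_right h), neg_one_mul]
  let π₀ : Fock D Z →ₗ[D] Fock D Z := half D • (LinearMap.id + ε • σ)
  have hπ₀ : ∀ l : List ℤ, π₀ (mono D Z l) =
      (half D * (1 + ε * (-1) ^ l.length)) • mono D Z l := by
    intro l
    simp only [π₀, LinearMap.smul_apply, LinearMap.add_apply, LinearMap.id_apply, hmono]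
    module
  have hself : ∀ l : List ℤ, (l.length : ZMod 2) = s → π₀ (mono D Z l) = mono D Z l := by
    intro l hl
    rw [hπ₀, (hε _).1 hl, one_add_one_eq_two, mul_comm, two_mul_half, one_smul]
  have hmem : ∀ w, π₀ w ∈ Fock.part D Z s := by
    intro w
    induction mem_span_mono D Z w using Submodule.span_induction with
    | mem x hx =>
      obtain ⟨l, rfl⟩ := hx
      by_cases hl : (l.length : ZMod 2) = s
      · rw [hself l hl]
        exact Submodule.subset_span ⟨l, hl, rfl⟩
      · rw [hπ₀, (hε _).2 hl, add_neg_cancel, mul_zero, zero_smul]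
        exact zero_mem _
    | zero => rw [map_zero]; exact zero_mem _
    | add x y _ _ hx hy => rw [map_add]; exact add_mem hx hy
    | smul r x _ hx => rw [map_smul]; exact Submodule.smul_mem _ _ hx
  refine ⟨π₀.codRestrict _ hmem, ?_⟩
  ext ⟨w, hw⟩
  change π₀ w = w
  induction hw using Submodule.span_induction with
  | mem x hx =>
    obtain ⟨l, hl, rfl⟩ := hx
    exact hself l hl
  | zero => rw [map_zero]
  | add x y _ _ hx hy => rw [map_add, hx, hy]
  | smul r x _ hx => rw [map_smul, hx]

/-- A linear functional on the Fock space which does not vanish on the vacuum, from the realization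
of the fermions on an exterior algebra. -/
theorem exists_functional [Algebra ZHalf D] : ∃ f : Fock D Z →ₗ[D] D, f (vac D Z) = 1 := by
  let E := ℤ →₀ D
  -- Negative modes act by exterior multiplication, positive ones by contraction, and the zero mode
  -- by `e/2 + c`, whose square is `1/2`. These weights are what makes `hαβ` true.
  let α : ℤ → D := fun k =>
    if 2 * k + Z.shift < 0 then 1 else if 2 * k + Z.shift = 0 then half D else 0
  let β : ℤ → D := fun k => if 2 * k + Z.shift < 0 then 0 else 1
  let d : ℤ → Module.Dual D E := fun k => Finsupp.lapply (-k - Z.shift)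
  let e : ℤ → ExteriorAlgebra D E := fun k => ExteriorAlgebra.ι D (Finsupp.single k 1)
  let c : ℤ → ExteriorAlgebra D E →ₗ[D] ExteriorAlgebra D E := fun k =>
    CliffordAlgebra.contractLeft (d k)
  let a : ℤ → ExteriorAlgebra D E →ₗ[D] ExteriorAlgebra D E := fun k =>
    α k • LinearMap.mulLeft D (e k) + β k • c k
  have ha : ∀ k w, a k w = α k • (e k * w) + β k • c k w := fun k w => rfl
  have hee : ∀ k l w, e k * (e l * w) = -(e l * (e k * w)) := by
    intro k l w
    have h := ExteriorAlgebra.ι_add_mul_swap (R := D) (M := E) (Finsupp.single k 1)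
      (Finsupp.single l 1)
    rw [← mul_assoc, ← mul_assoc, ← neg_mul, ← eq_neg_of_add_eq_zero_left h]
  have hcc : ∀ k l w, c k (c l w) = -c l (c k w) := fun k l w =>
    CliffordAlgebra.contractLeft_comm _ _ _
  have hce : ∀ k l w, c k (e l * w) =
      (if k + l + Z.shift = 0 then w else 0) - e l * c k w := by
    intro k l w
    refine (CliffordAlgebra.contractLeft_ι_mul _ _ _).trans ?_
    congr 1
    change (Finsupp.single l (1 : D) (-k - Z.shift)) • w = _
    rw [Finsupp.single_apply]
    by_cases h : k + l + Z.shift = 0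
    · rw [if_pos h, if_pos (by omega), one_smul]
    · rw [if_neg h, if_neg (by omega), zero_smul]
  have hαβ : ∀ k l, k + l + Z.shift = 0 → α k * β l + α l * β k = 1 := by
    intro k l h
    simp only [α, β]
    rcases lt_trichotomy (2 * k + Z.shift) 0 with hk | hk | hk
    · rw [if_pos hk, if_neg (by omega), if_pos hk]
      ring
    · rw [if_neg (by omega), if_pos hk, if_neg (by omega), if_neg (by omega), if_pos (by omega),
        if_neg (by omega)]
      linear_combination two_mul_half D
    · rw [if_neg (by omega), if_neg (by omega), if_pos (by omega), if_pos (by omega),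
        if_neg (by omega)]
      ring
  obtain ⟨ψ, hψ, -⟩ := exists_lift D Z a 1 (by
    intro k l w
    simp only [ha, mul_add, map_add, map_smul, mul_smul_comm, hce, hee k l, hcc k l]
    rw [add_comm l k]
    split_ifs with h
    · linear_combination (norm := module) hαβ k l h • w
    · module) (by
    intro k hk
    rw [ha]
    simp only [α, β]
    rw [if_neg (by omega), if_neg (by omega), zero_smul, zero_add]
    have h1 : c k 1 = 0 := CliffordAlgebra.contractLeft_one _ _
    rw [h1, smul_zero])
  exact ⟨ExteriorAlgebra.algebraMapInv.toLinearMap ∘ₗ ψ, by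
    rw [LinearMap.comp_apply, hψ, AlgHom.toLinearMap_apply, map_one]⟩

end

end Fock

namespace Fock

/-! ## Extension of scalars of the Fock space -/

section

variable (F : Type*) [Field F] [Algebra ZHalf F] (Z : Sector)

/-- A functional over `ℤ[1/2]` with value `1` on the vacuum keeps this value after extension of
scalars. -/
theorem vac_tmul_ne_zero : (1 : F) ⊗ₜ[ZHalf] vac ZHalf Z ≠ 0 := by
  intro h
  obtain ⟨f, hf⟩ := exists_functional ZHalf Z
  have h1 := congrArg (TensorProduct.rid ZHalf F) (congrArg (f.lTensor F) h)
  rw [LinearMap.lTensor_tmul, hf, TensorProduct.rid_tmul, one_smul, map_zero, map_zero] at h1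
  exact one_ne_zero h1

theorem foldr_baseChange_mode (l : List ℤ) :
    l.foldr (fun k => (mode ZHalf Z k).baseChange F) ((1 : F) ⊗ₜ[ZHalf] vac ZHalf Z) =
      1 ⊗ₜ[ZHalf] mono ZHalf Z l := by
  induction l with
  | nil => rw [mono_nil, List.foldr_nil]
  | cons k l ih => rw [List.foldr_cons, ih, LinearMap.baseChange_tmul, mono_cons]

/-- The Fock space over `F` obtained by extension of scalars. -/
def rep : FockRep F (F ⊗[ZHalf] Fock ZHalf Z) Z where
  a k := (mode ZHalf Z k).baseChange F
  vac := 1 ⊗ₜ[ZHalf] vac ZHalf Z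
  anticomm k l w := by
    induction w using TensorProduct.induction_on with
    | zero => simp
    | tmul c x =>
      simp only [LinearMap.baseChange_tmul]
      rw [← TensorProduct.tmul_add, mode_anticomm]
      split_ifs
      · rfl
      · rw [TensorProduct.tmul_zero]
    | add x y hx hy =>
      simp only [map_add]
      rw [add_add_add_comm, hx, hy]
      split_ifs
      · rfl
      · rw [add_zero]
  ann k hk := by rw [LinearMap.baseChange_tmul, mode_vac _ _ hk, TensorProduct.tmul_zero]
  span w := by
    simp only [foldr_baseChange_mode]
    induction w using TensorProduct.induction_on with
    | zero => exact zero_mem _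
    | tmul c x =>
      induction mem_span_mono ZHalf Z x using Submodule.span_induction with
      | mem x hx =>
        obtain ⟨l, rfl⟩ := hx
        have h : c ⊗ₜ[ZHalf] mono ZHalf Z l = c • (1 : F) ⊗ₜ[ZHalf] mono ZHalf Z l := by
          rw [TensorProduct.smul_tmul', smul_eq_mul, mul_one]
        rw [h]
        exact Submodule.smul_mem _ _ (Submodule.subset_span ⟨l, rfl⟩)
      | zero => rw [TensorProduct.tmul_zero]; exact zero_mem _
      | add x y _ _ hx hy => rw [TensorProduct.tmul_add]; exact add_mem hx hy
      | smul r x _ hx =>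
        rw [TensorProduct.tmul_smul, ← algebraMap_smul F r]
        exact Submodule.smul_mem _ _ hx
    | add x y hx hy => exact add_mem hx hy
  vac_ne := vac_tmul_ne_zero F Z

theorem word_rep (l : List ℤ) : (rep F Z).word l (rep F Z).vac = 1 ⊗ₜ[ZHalf] mono ZHalf Z l :=
  foldr_baseChange_mode F Z l

variable {F Z}

theorem rep_a_tmul (k : ℤ) (c : F) (w : Fock ZHalf Z) :
    (rep F Z).a k (c ⊗ₜ w) = c ⊗ₜ (gen ZHalf Z k • w) := LinearMap.baseChange_tmul _ _ _

theorem rep_nord_tmul (k l : ℤ) (c : F) (w : Fock ZHalf Z) :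
    (rep F Z).nord k l (c ⊗ₜ w) = c ⊗ₜ (normalOrder ZHalf Z k l • w) := by
  rw [normalOrder]
  split_ifs with h
  · rw [(rep F Z).nord_of_le h, rep_a_tmul, rep_a_tmul, mul_smul]
  · rw [(rep F Z).nord_of_lt (not_le.1 h), rep_a_tmul, rep_a_tmul, neg_smul, mul_smul,
      TensorProduct.tmul_neg]

theorem algebraMap_half : algebraMap ZHalf F (half ZHalf) = half F := rfl

theorem algebraMap_constTerm (n : ℤ) :
    algebraMap ZHalf F (constTerm ZHalf Z n) = constTerm F Z n := by
  cases Z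
  · exact map_zero _
  · simp only [constTerm]
    split_ifs
    · rw [map_pow, algebraMap_half]
    · exact map_zero _

theorem tmul_smul_algebraMap {M : Type*} [AddCommGroup M] [Module ZHalf M] (c : F) (r : ZHalf)
    (x : M) : c ⊗ₜ[ZHalf] (r • x) = algebraMap ZHalf F r • c ⊗ₜ[ZHalf] x := by
  rw [TensorProduct.tmul_smul, algebraMap_smul]

/-- The substitution `k ↦ -k - Z.shift` passes from indexing by the second mode to indexing by the
first, which is the origin of the sign in `FockRep.L`. -/
theorem rep_L_tmul (n : ℤ) (c : F) (w : Fock ZHalf Z) :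
    (rep F Z).L n (c ⊗ₜ w) = c ⊗ₜ virOp ZHalf Z n w := by
  have hsm : ∀ (r : ZHalf) (x : Fock ZHalf Z),
      c ⊗ₜ[ZHalf] (r • x) = algebraMap ZHalf F r • c ⊗ₜ[ZHalf] x :=
    tmul_smul_algebraMap c
  change _ = c ⊗ₜ[ZHalf] (half ZHalf • (∑ᶠ k : ℤ, ((k : ZHalf) + (Z.shift : ZHalf) * half ZHalf) •
    normalOrder ZHalf Z (-k - Z.shift) (n + k) • w) + constTerm ZHalf Z n • w)
  rw [FockRep.L_apply, TensorProduct.tmul_add, hsm, hsm, algebraMap_constTerm, algebraMap_half]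
  congr 1
  have hfin : (fun k : ℤ => ((k : ZHalf) + (Z.shift : ZHalf) * half ZHalf) •
      normalOrder ZHalf Z (-k - Z.shift) (n + k) • w).HasFiniteSupport :=
    finite_support ZHalf Z n w fun k => (k : ZHalf) + (Z.shift : ZHalf) * half ZHalf
  have h1 := map_finsum (TensorProduct.mk ZHalf F (Fock ZHalf Z) c) hfin
  simp only [TensorProduct.mk_apply] at h1
  have h2 := hfin.fun_comp (g := TensorProduct.mk ZHalf F (Fock ZHalf Z) c) (map_zero _)
  simp only [TensorProduct.mk_apply] at h2
  rw [h1, smul_finsum' (half F) h2, FockRep.quad_apply, ← finsum_comp_equiv (Equiv.subLeft (-Z.shift))]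
  refine finsum_congr fun k => ?_
  rw [Equiv.subLeft_apply, rep_nord_tmul, hsm, smul_smul,
    show n - Z.shift - (-Z.shift - k) = n + k by ring, show -Z.shift - k = -k - Z.shift by ring,
    FockRep.kap_neg]
  congr 1
  rw [map_add, map_mul, map_intCast, map_intCast, algebraMap_half, FockRep.kap]
  ring

variable (F Z)

/-- The inclusion of a part into the Fock space. -/
def incl (s : ZMod 2) : F ⊗[ZHalf] Fock.part ZHalf Z s →ₗ[F] F ⊗[ZHalf] Fock ZHalf Z :=
  (Fock.part ZHalf Z s).subtype.baseChange F

/-- The part is a direct summand, so no flatness is needed. -/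
theorem incl_injective (s : ZMod 2) : Function.Injective (incl F Z s) := by
  obtain ⟨π, hπ⟩ := exists_proj ZHalf Z s
  refine Function.LeftInverse.injective (g := π.baseChange F) fun x => ?_
  rw [incl, ← LinearMap.comp_apply, ← LinearMap.baseChange_comp, hπ, LinearMap.baseChange_id,
    LinearMap.id_apply]

theorem incl_virOpPart (s : ZMod 2) (n : ℤ) (x : F ⊗[ZHalf] Fock.part ZHalf Z s) :
    incl F Z s ((virOpPart ZHalf Z s n).baseChange F x) = (rep F Z).L n (incl F Z s x) := by
  induction x using TensorProduct.induction_on with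
  | zero => simp
  | tmul c w =>
    rw [incl, LinearMap.baseChange_tmul, LinearMap.baseChange_tmul, LinearMap.baseChange_tmul,
      rep_L_tmul]
    rfl
  | add x y hx hy => simp only [map_add, hx, hy]

theorem incl_monoPart (s : ZMod 2) (l : List ℤ) (h : (l.length : ZMod 2) = s) :
    incl F Z s (1 ⊗ₜ monoPart ZHalf Z s l h) = (rep F Z).word l (rep F Z).vac := by
  rw [word_rep, incl, LinearMap.baseChange_tmul]
  rfl

theorem range_incl (s : ZMod 2) : LinearMap.range (incl F Z s) =
    Submodule.span F {x | ∃ l : List ℤ, (l.length : ZMod 2) = s ∧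
      x = (rep F Z).word l (rep F Z).vac} := by
  apply le_antisymm
  · rintro _ ⟨x, rfl⟩
    induction x using TensorProduct.induction_on with
    | zero => rw [map_zero]; exact zero_mem _
    | tmul c w =>
      obtain ⟨w, hw⟩ := w
      rw [incl, LinearMap.baseChange_tmul, Submodule.subtype_apply]
      induction hw using Submodule.span_induction with
      | mem x hx =>
        obtain ⟨l, hl, rfl⟩ := hx
        have h : c ⊗ₜ[ZHalf] mono ZHalf Z l = c • (1 : F) ⊗ₜ[ZHalf] mono ZHalf Z l := by
          rw [TensorProduct.smul_tmul', smul_eq_mul, mul_one]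
        rw [h, ← word_rep]
        exact Submodule.smul_mem _ _ (Submodule.subset_span ⟨l, hl, rfl⟩)
      | zero => rw [TensorProduct.tmul_zero]; exact zero_mem _
      | add x y _ _ hx hy => rw [TensorProduct.tmul_add]; exact add_mem hx hy
      | smul r x _ hx =>
        rw [TensorProduct.tmul_smul, ← algebraMap_smul F r]
        exact Submodule.smul_mem _ _ hx
    | add x y hx hy => rw [map_add]; exact add_mem hx hy
  · rw [Submodule.span_le]
    rintro _ ⟨l, hl, rfl⟩
    exact ⟨_, incl_monoPart F Z s l hl⟩

end

end Fock

/-! ## Graded structure of Verma modules -/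

section

attribute [local instance] LieRing.ofAssociativeRing

variable {F : Type*} [Field F] [Algebra ZHalf F]

/-- The element `∑ f(n) L_n + c C`. -/
def Vir.mk (f : ℤ →₀ F) (c : F) : Vir F := (f, c)

omit [Algebra ZHalf F] in
/-- A linear property of elements of the Virasoro algebra holds if it holds for the basis. -/
theorem Vir.induction {p : Vir F → Prop} (x : Vir F) (h0 : p 0) (hL : ∀ n, p (Vir.L F n))
    (hC : p (Vir.C F)) (hadd : ∀ x y, p x → p y → p (x + y))
    (hsmul : ∀ (r : F) x, p x → p (r • x)) : p x := by
  have hx : x = Vir.mk x.1 0 + x.2 • Vir.C F :=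
    Vir.ext' ((add_zero x.1).symm.trans (congrArg (x.1 + ·) (smul_zero x.2).symm))
      ((zero_add x.2).symm.trans (congrArg (0 + ·) (mul_one x.2).symm))
  have hf : ∀ f : ℤ →₀ F, p (Vir.mk f 0) := by
    intro f
    induction f using Finsupp.induction_linear with
    | zero => exact h0
    | add f g hf hg =>
      have h : Vir.mk (f + g) 0 = Vir.mk f 0 + Vir.mk g 0 := Vir.ext' rfl (add_zero _).symm
      exact h ▸ hadd _ _ hf hg
    | single n b =>
      have h : Vir.mk (Finsupp.single n b) 0 = b • Vir.L F n :=
        Vir.ext' (Finsupp.smul_single_one n b).symm (mul_zero b).symm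
      exact h ▸ hsmul b _ (hL n)
  exact hx ▸ hadd _ _ (hf _) (hsmul _ _ hC)

theorem opL_mul (m n : ℤ) : opL (D := F) m * opL n = opL n * opL m +
    (((m - n : ℤ) : F) • opL (m + n) +
      (if m + n = 0 then (cubic m : F) * half F else 0) • opC) := by
  have h : ⁅Vir.L F m, Vir.L F n⁆ = Vir.basisBracket F m n := by
    rw [Vir.lie_def]
    change Vir.bracketLin F (Finsupp.single m 1) (Finsupp.single n 1) = _
    rw [Vir.bracketLin_single, one_mul, one_smul]
  have h1 := congrArg (UniversalEnvelopingAlgebra.ι F) h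
  rw [LieHom.map_lie, LieRing.of_associative_ring_bracket, Vir.basisBracket, map_add, map_smul,
    map_smul] at h1
  exact sub_eq_iff_eq_add'.1 h1

theorem opC_mul (n : ℤ) : opC (D := F) * opL n = opL n * opC := by
  have h : ⁅Vir.C F, Vir.L F n⁆ = 0 := by
    rw [Vir.lie_def]
    change Vir.bracketLin F 0 _ = 0
    rw [map_zero, LinearMap.zero_apply]
  have h1 := congrArg (UniversalEnvelopingAlgebra.ι F) h
  rw [LieHom.map_lie, LieRing.of_associative_ring_bracket, map_zero] at h1
  exact sub_eq_zero.1 h1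

/-- A subspace stable under all `L_n` and `C` is stable under the enveloping algebra. -/
theorem smul_mem_of_stable {M : Type*} [AddCommGroup M] [Module F M] [Module (UVir F) M]
    [IsScalarTower F (UVir F) M] {S : Submodule F M} (hL : ∀ n, ∀ w ∈ S, opL (D := F) n • w ∈ S)
    (hC : ∀ w ∈ S, opC (D := F) • w ∈ S) (x : UVir F) {w : M} (hw : w ∈ S) : x • w ∈ S := by
  let A : Subalgebra F (UVir F) :=
    { carrier := {x | ∀ w ∈ S, x • w ∈ S}
      mul_mem' := fun {a b} ha hb w hw => by
        rw [mul_smul]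
        exact ha _ (hb w hw)
      add_mem' := fun {a b} ha hb w hw => by
        rw [add_smul]
        exact add_mem (ha w hw) (hb w hw)
      algebraMap_mem' := fun r w hw => by
        rw [algebraMap_smul]
        exact S.smul_mem r hw }
  have hι : ∀ y : Vir F, UniversalEnvelopingAlgebra.ι F y ∈ A := by
    intro y
    induction y using Vir.induction with
    | h0 => rw [map_zero]; exact A.zero_mem
    | hL n => exact hL n
    | hC => exact hC
    | hadd x y hx hy => rw [map_add]; exact A.add_mem hx hy
    | hsmul r x hx => rw [map_smul]; exact A.smul_mem hx r
  -- The stabiliser `A` receives the Lie algebra, hence a map from the enveloping algebra. Composed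
  -- with the inclusion it is the identity, so `A` is everything.
  let g : Vir F →ₗ⁅F⁆ A :=
    { toFun := fun y => ⟨UniversalEnvelopingAlgebra.ι F y, hι y⟩
      map_add' := fun x y => Subtype.ext (map_add _ x y)
      map_smul' := fun r x => Subtype.ext (map_smul _ r x)
      map_lie' := fun {x y} => Subtype.ext (LieHom.map_lie _ x y) }
  have hg : A.val.comp (UniversalEnvelopingAlgebra.lift F g) = AlgHom.id F (UVir F) := by
    apply UniversalEnvelopingAlgebra.hom_ext
    ext y
    simp [g]
  have hx : x ∈ A := by
    have h := congrArg (fun f : UVir F →ₐ[F] UVir F => f x) hg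
    simp only [AlgHom.comp_apply, AlgHom.id_apply] at h
    rw [← h]
    exact Subtype.property _
  exact hx w hw

variable {c h : F}

theorem smul_vermaVec_eq_zero {x : UVir F} (hx : x ∈ vermaIdeal c h) : x • vermaVec c h = 0 := by
  rw [vermaVec, ← map_smul, smul_eq_mul, mul_one, Submodule.mkQ_apply,
    Submodule.Quotient.mk_eq_zero]
  exact hx

theorem opL_pos_vermaVec {n : ℤ} (hn : 0 < n) : opL (D := F) n • vermaVec c h = 0 :=
  smul_vermaVec_eq_zero (Submodule.subset_span (Or.inl ⟨n, hn, rfl⟩))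

theorem opL_zero_vermaVec : opL (D := F) 0 • vermaVec c h = h • vermaVec c h := by
  have h1 := smul_vermaVec_eq_zero (c := c) (h := h) (x := opL 0 - algebraMap F (UVir F) h)
    (Submodule.subset_span (Or.inr (Or.inl rfl)))
  rwa [sub_smul, algebraMap_smul, sub_eq_zero] at h1

theorem opC_vermaVec : opC (D := F) • vermaVec c h = c • vermaVec c h := by
  have h1 := smul_vermaVec_eq_zero (c := c) (h := h) (x := opC - algebraMap F (UVir F) c)
    (Submodule.subset_span (Or.inr (Or.inr rfl)))
  rwa [sub_smul, algebraMap_smul, sub_eq_zero] at h1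

theorem eq_top_of_vermaVec_mem {N : Submodule (UVir F) (Verma c h)} (hN : vermaVec c h ∈ N) :
    N = ⊤ := by
  refine eq_top_iff.2 fun x _ => ?_
  obtain ⟨a, rfl⟩ := (vermaIdeal c h).mkQ_surjective x
  have h1 := N.smul_mem a hN
  rwa [vermaVec, ← map_smul, smul_eq_mul, mul_one] at h1

variable (c h) in
/-- The monomial `L_{-n₁} ⋯ L_{-n_k} v`. -/
def vermaMono (l : List ℕ) : Verma c h :=
  (l.map fun i : ℕ => opL (D := F) (-(i : ℤ))).prod • vermaVec c h

theorem vermaMono_nil : vermaMono c h [] = vermaVec c h := by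
  rw [vermaMono, List.map_nil, List.prod_nil, one_smul]

theorem vermaMono_cons (i : ℕ) (l : List ℕ) :
    vermaMono c h (i :: l) = opL (D := F) (-(i : ℤ)) • vermaMono c h l := by
  rw [vermaMono, List.map_cons, List.prod_cons, mul_smul, vermaMono]

theorem opC_vermaMono (l : List ℕ) : opC (D := F) • vermaMono c h l = c • vermaMono c h l := by
  induction l with
  | nil => rw [vermaMono_nil, opC_vermaVec]
  | cons i l ih => rw [vermaMono_cons, ← mul_smul, opC_mul, mul_smul, ih, smul_comm]

/-- The span of the monomials is stable: an `L_n` is commuted to the right through a monomial, by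
induction on its length, until it meets the highest weight vector. -/
theorem iSup_vermaDeg : ⨆ n, vermaDeg c h n = ⊤ := by
  set S := ⨆ n, vermaDeg c h n with hS
  have hmono : ∀ l : List ℕ, (∀ i ∈ l, 1 ≤ i) → vermaMono c h l ∈ S := fun l hl =>
    Submodule.mem_iSup_of_mem l.sum (Submodule.subset_span ⟨l, hl, rfl, rfl⟩)
  have hind : ∀ {p : Verma c h → Prop}, (∀ l : List ℕ, (∀ i ∈ l, 1 ≤ i) → p (vermaMono c h l)) →
      p 0 → (∀ x y, p x → p y → p (x + y)) → (∀ (r : F) x, p x → p (r • x)) → ∀ w ∈ S, p w := by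
    intro p h1 h2 h3 h4 w hw
    induction hw using Submodule.iSup_induction' with
    | mem n x hx =>
      induction hx using Submodule.span_induction with
      | mem x hx =>
        obtain ⟨l, hl, -, rfl⟩ := hx
        exact h1 l hl
      | zero => exact h2
      | add x y _ _ hx hy => exact h3 x y hx hy
      | smul r x _ hx => exact h4 r x hx
    | zero => exact h2
    | add x y _ _ hx hy => exact h3 x y hx hy
  have hneg : ∀ n : ℤ, n < 0 → ∀ w ∈ S, opL (D := F) n • w ∈ S := by
    intro n hn
    obtain ⟨i, rfl⟩ : ∃ i : ℕ, n = -(i : ℤ) := ⟨(-n).toNat, by omega⟩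
    refine hind (fun l hl => ?_) ?_ (fun x y hx hy => ?_) (fun r x hx => ?_)
    · rw [← vermaMono_cons]
      refine hmono _ fun j hj => ?_
      rcases List.mem_cons.1 hj with rfl | hj
      · omega
      · exact hl j hj
    · rw [smul_zero]
      exact zero_mem _
    · rw [smul_add]
      exact add_mem hx hy
    · rw [smul_comm]
      exact S.smul_mem r hx
  have hopL : ∀ l : List ℕ, (∀ i ∈ l, 1 ≤ i) → ∀ n : ℤ, opL (D := F) n • vermaMono c h l ∈ S := by
    intro l
    induction l with
    | nil =>
      intro _ n
      have hv := hmono [] (by simp)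
      rcases lt_trichotomy n 0 with hn | rfl | hn
      · exact hneg n hn _ hv
      · rw [vermaMono_nil, opL_zero_vermaVec, ← vermaMono_nil]
        exact S.smul_mem h hv
      · rw [vermaMono_nil, opL_pos_vermaVec hn]
        exact zero_mem _
    | cons i l ih =>
      intro hl n
      have hl' : ∀ j ∈ l, 1 ≤ j := fun j hj => hl j (List.mem_cons_of_mem _ hj)
      have hi := hl i List.mem_cons_self
      rw [vermaMono_cons, ← mul_smul, opL_mul, add_smul, add_smul, mul_smul, smul_assoc, smul_assoc,
        opC_vermaMono]
      exact add_mem (hneg _ (by omega) _ (ih hl' n))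
        (add_mem (S.smul_mem _ (ih hl' _)) (S.smul_mem _ (S.smul_mem _ (hmono l hl'))))
  have hall : ∀ n : ℤ, ∀ w ∈ S, opL (D := F) n • w ∈ S := fun n =>
    hind (fun l hl => hopL l hl n) (by rw [smul_zero]; exact zero_mem _)
      (fun x y hx hy => by rw [smul_add]; exact add_mem hx hy)
      (fun r x hx => by rw [smul_comm]; exact S.smul_mem r hx)
  have hC : ∀ w ∈ S, opC (D := F) • w ∈ S :=
    hind (fun l hl => by rw [opC_vermaMono]; exact S.smul_mem c (hmono l hl))
      (by rw [smul_zero]; exact zero_mem _)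
      (fun x y hx hy => by rw [smul_add]; exact add_mem hx hy)
      (fun r x hx => by rw [smul_comm]; exact S.smul_mem r hx)
  refine eq_top_iff.2 fun x _ => ?_
  obtain ⟨a, rfl⟩ := (vermaIdeal c h).mkQ_surjective x
  have hv : vermaVec c h ∈ S := by
    rw [← vermaMono_nil]
    exact hmono [] (by simp)
  have h1 := smul_mem_of_stable hall hC a hv
  rwa [vermaVec, ← map_smul, smul_eq_mul, mul_one] at h1

theorem mem_vermaDeg_zero {x : Verma c h} (hx : x ∈ vermaDeg c h 0) :
    ∃ r : F, x = r • vermaVec c h := by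
  induction hx using Submodule.span_induction with
  | mem x hx =>
    obtain ⟨l, hl, hs, rfl⟩ := hx
    have hl0 : l = [] := by
      cases l with
      | nil => rfl
      | cons i l =>
        have := hl i List.mem_cons_self
        rw [List.sum_cons] at hs
        omega
    subst hl0
    exact ⟨1, by simp⟩
  | zero => exact ⟨0, by rw [zero_smul]⟩
  | add x y _ _ hx hy =>
    obtain ⟨r, rfl⟩ := hx
    obtain ⟨s, rfl⟩ := hy
    exact ⟨r + s, by rw [add_smul]⟩
  | smul r x _ hx =>
    obtain ⟨s, rfl⟩ := hx
    exact ⟨r * s, by rw [mul_smul]⟩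

/-- A map from the Verma module to a graded vector space whose kernel is a maximal submodule: the
kernel is then the largest proper graded submodule. -/
theorem maxGraded_eq_of_isCoatom {K : Submodule (UVir F) (Verma c h)} (hK : IsCoatom K)
    {N : Type*} [AddCommGroup N] [Module F N] (ψ : Verma c h →ₗ[F] N) (hψ : ∀ x, x ∈ K ↔ ψ x = 0)
    {G : ℕ → Submodule F N} (hG : iSupIndep G) (hdeg : ∀ n, ∀ x ∈ vermaDeg c h n, ψ x ∈ G n) :
    maxGraded c h = K := by
  rw [iSupIndep_iff_finsetSum_eq_zero_imp_eq_zero] at hG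
  apply le_antisymm
  · refine sSup_le ?_
    rintro N ⟨hN, htop⟩
    by_contra hle
    -- Write `v = k + n` with `k ∈ K`, `n ∈ N`. By independence in the target, the degree-zero part
    -- of `n` is congruent to `v` modulo `K`. It is a multiple of `v`, nonzero since `v ∉ K`, and it
    -- lies in `N` because `N` is graded; so `v ∈ N`.
    have hsup := hK.2 _ (left_lt_sup.2 hle)
    obtain ⟨k, hk, n, hn, hkn⟩ := Submodule.mem_sup.1 (hsup ▸ Submodule.mem_top (x := vermaVec c h))
    have hn' : n ∈ N.restrictScalars F := hn
    rw [hN, Submodule.mem_iSup_iff_exists_finsupp] at hn'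
    obtain ⟨f, hf, hfn⟩ := hn'
    have hv : vermaVec c h ∈ vermaDeg c h 0 := Submodule.subset_span ⟨[], by simp, by simp, by simp⟩
    have hψn : ψ n = ψ (vermaVec c h) := by rw [← hkn, map_add, (hψ k).1 hk, zero_add]
    have hsum : ∑ i ∈ insert 0 f.support, (ψ (f i) - if i = 0 then ψ (vermaVec c h) else 0) = 0 := by
      rw [Finset.sum_sub_distrib, Finset.sum_ite_eq', if_pos (Finset.mem_insert_self _ _), ← hψn,
        ← hfn, ← map_sum, Finsupp.sum_of_support_subset f (Finset.subset_insert 0 _) _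
          (fun _ _ => rfl), sub_self]
    have h0 := hG _ _ (fun i _ => by
      refine sub_mem (hdeg i _ (hf i).2) ?_
      split_ifs with hi
      · subst hi
        exact hdeg 0 _ hv
      · exact zero_mem _) hsum 0 (Finset.mem_insert_self _ _)
    rw [if_pos rfl] at h0
    obtain ⟨r, hr⟩ := mem_vermaDeg_zero (hf 0).2
    have hr0 : r ≠ 0 := by
      rintro rfl
      rw [hr, zero_smul, map_zero, zero_sub, neg_eq_zero] at h0
      exact hK.1 (eq_top_of_vermaVec_mem ((hψ _).2 h0))
    refine htop (eq_top_of_vermaVec_mem ?_)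
    have hmem := (hf 0).1
    rw [hr] at hmem
    exact ((N.restrictScalars F).smul_mem_iff hr0).1 hmem
  -- Conversely `K` is itself graded: the images of the components of `x` lie in independent pieces,
  -- so each vanishes if their sum does.
  · refine le_sSup ⟨le_antisymm (fun x hx => ?_) (iSup_le fun n => inf_le_left), hK.1⟩
    have hx' : x ∈ ⨆ n, vermaDeg c h n := iSup_vermaDeg (c := c) (h := h) ▸ Submodule.mem_top
    rw [Submodule.mem_iSup_iff_exists_finsupp] at hx'
    obtain ⟨f, hf, rfl⟩ := hx'
    refine (Submodule.mem_iSup_iff_exists_finsupp _ _).2 ⟨f, fun n => ⟨?_, hf n⟩, rfl⟩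
    by_cases hn : n ∈ f.support
    · refine (hψ _).2 (hG f.support (fun i => ψ (f i)) (fun i _ => hdeg i _ (hf i)) ?_ n hn)
      rw [← map_sum]
      exact (hψ _).1 hx
    · rw [Finsupp.notMem_support_iff.1 hn]
      exact zero_mem _

end

attribute [local instance] LieRing.ofAssociativeRing

namespace FockRep

variable {F : Type*} [Field F] [Algebra ZHalf F] {N : Type*} [AddCommGroup N] [Module F N]
  {Z : Sector}

omit [Algebra ZHalf F] in
theorem word_sum (R : FockRep F N Z) (l : List ℤ) {ι : Type*} (S : Finset ι) (v : ι → N) :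
    R.word l (∑ i ∈ S, v i) = ∑ i ∈ S, R.word l (v i) := by
  induction l with
  | nil => rfl
  | cons k l ih => simp only [word_cons, ih, map_sum]

/-- In a vanishing sum take the nonzero component of highest degree. A word lowering it to degree
zero sends all other components to negative degree, where everything is zero, so it would have to
kill that component as well. -/
theorem iSupIndep_H (R : FockRep F N Z) (d : ℤ) (t : ZMod 2) :
    iSupIndep fun n : ℕ => R.H 1 (d + 2 * n) t := by
  rw [iSupIndep_iff_finsetSum_eq_zero_imp_eq_zero]
  classical
  intro S v hv hsum
  by_contra! hne
  obtain ⟨i₀, hi₀, hv₀⟩ := hne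
  obtain ⟨i, hi, hmax⟩ := (S.filter fun i => v i ≠ 0).exists_max_image id
    ⟨i₀, Finset.mem_filter.2 ⟨hi₀, hv₀⟩⟩
  obtain ⟨hiS, hvi⟩ := Finset.mem_filter.1 hi
  obtain ⟨j, hj⟩ := hv i hiS
  obtain ⟨l, hl, -, hl0⟩ := lower hj hvi
  apply hl0
  have h := congrArg (R.word l) hsum
  rw [word_sum, word_zero, Finset.sum_eq_single_of_mem i hiS] at h
  · exact h
  intro k hk hki
  by_cases hvk : v k = 0
  · rw [hvk, word_zero]
  · have hlt : k < i := lt_of_le_of_ne (hmax k (Finset.mem_filter.2 ⟨hk, hvk⟩)) hki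
    obtain ⟨m, hm⟩ := word_mem_H l (hv k hk)
    exact V_neg_eq_zero hm (by rw [hl]; omega)

variable (R : FockRep F N Z)

theorem L_a_vac {n r : ℤ} (hn : 0 ≤ n) : R.L n (R.a r R.vac) =
    constTerm F Z n • R.a r R.vac - (kap F Z r + n * half F) • R.a (r + n) R.vac := by
  rw [L_comm, R.L_vac hn, map_smul]

end FockRep

/-! ## Realizations of the irreducible highest weight modules -/

section

variable {F : Type*} [Field F] [Algebra ZHalf F] {M : Type*} [AddCommGroup M] [Module F M]

/-- Operators satisfying the Virasoro relations with central charge `1/2` give an action of the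
Virasoro algebra. -/
theorem exists_rep (Λ : ℤ → M →ₗ[F] M)
    (hΛ : ∀ m n w, Λ m (Λ n w) - Λ n (Λ m w) = ((m - n : ℤ) : F) • Λ (m + n) w +
      if m + n = 0 then (cubic m * half F * half F : F) • w else 0) :
    ∃ φ : UVir F →ₐ[F] Module.End F M, (∀ n, φ (opL n) = Λ n) ∧
      φ opC = half F • (1 : Module.End F M) := by
  let ρ : Vir F →ₗ[F] Module.End F M :=
    (Finsupp.linearCombination F Λ).coprod (LinearMap.toSpanSingleton F (Module.End F M) (half F • 1))
  have hρ : ∀ x : Vir F, ρ x = Finsupp.linearCombination F Λ x.1 +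
      x.2 • half F • (1 : Module.End F M) := fun x => rfl
  have hL : ∀ n, ρ (Vir.L F n) = Λ n := by
    intro n
    rw [hρ]
    simp [Vir.L]
  have hC : ρ (Vir.C F) = half F • (1 : Module.End F M) := by
    rw [hρ]
    simp [Vir.C]
  have hC0 : ∀ x : Vir F, ⁅x, Vir.C F⁆ = 0 := fun x => by
    rw [Vir.lie_def]
    change Vir.bracketLin F _ 0 = 0
    rw [map_zero]
  have hlie : ∀ x y : Vir F, ρ ⁅x, y⁆ = ⁅ρ x, ρ y⁆ := by
    intro x y
    induction y using Vir.induction with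
    | h0 => rw [lie_zero, map_zero, lie_zero]
    | hC => rw [hC0, hC, map_zero, lie_smul, LieRing.of_associative_ring_bracket, mul_one, one_mul,
        sub_self, smul_zero]
    | hadd y z hy hz => rw [lie_add, map_add, map_add, lie_add, hy, hz]
    | hsmul r y hy => rw [lie_smul, map_smul, map_smul, lie_smul, hy]
    | hL n =>
      induction x using Vir.induction with
      | h0 => rw [zero_lie, map_zero, zero_lie]
      | hC => rw [← lie_skew, hC0, hC, neg_zero, map_zero, smul_lie,
          LieRing.of_associative_ring_bracket, mul_one, one_mul, sub_self, smul_zero]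
      | hadd y z hy hz => rw [add_lie, map_add, map_add, add_lie, hy, hz]
      | hsmul r y hy => rw [smul_lie, map_smul, map_smul, smul_lie, hy]
      | hL m =>
        have h : ⁅Vir.L F m, Vir.L F n⁆ = Vir.basisBracket F m n := by
          rw [Vir.lie_def]
          change Vir.bracketLin F (Finsupp.single m 1) (Finsupp.single n 1) = _
          rw [Vir.bracketLin_single, one_mul, one_smul]
        rw [h, Vir.basisBracket, map_add, map_smul, map_smul, hL, hL, hL, hC,
          LieRing.of_associative_ring_bracket]
        ext w
        simp only [LinearMap.add_apply, LinearMap.smul_apply, LinearMap.sub_apply,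
          Module.End.mul_apply, Module.End.one_apply]
        rw [hΛ]
        split_ifs
        · rw [smul_smul]
        · rw [zero_smul]
  refine ⟨UniversalEnvelopingAlgebra.lift F { ρ with map_lie' := fun {x y} => hlie x y },
    fun n => ?_, ?_⟩
  · exact (UniversalEnvelopingAlgebra.lift_ι_apply F _ _).trans (hL n)
  · exact (UniversalEnvelopingAlgebra.lift_ι_apply F _ _).trans hC

/-- A graded irreducible module with a highest weight vector is the irreducible highest weight
module. -/
theorem exists_equiv_irredHW {h : F} (Λ : ℤ → M →ₗ[F] M)
    (hΛ : ∀ m n w, Λ m (Λ n w) - Λ n (Λ m w) = ((m - n : ℤ) : F) • Λ (m + n) w +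
      if m + n = 0 then (cubic m * half F * half F : F) • w else 0)
    (hirr : ∀ U : Submodule F M, (∀ n, ∀ w ∈ U, Λ n w ∈ U) → U ≠ ⊥ → U = ⊤)
    {G : ℕ → Submodule F M} (hG : iSupIndep G)
    (hΛG : ∀ (i n : ℕ), ∀ w ∈ G n, Λ (-(i : ℤ)) w ∈ G (i + n))
    {u : M} (hu : u ∈ G 0) (hu0 : u ≠ 0) (hpos : ∀ n, 0 < n → Λ n u = 0) (hzero : Λ 0 u = h • u) :
    (∃ e : IrredHW (half F) h ≃ₗ[F] M,
      (∀ (n : ℤ) (x : IrredHW (half F) h), e (opL (D := F) n • x) = Λ n (e x)) ∧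
      (∀ x : IrredHW (half F) h, e (opC (D := F) • x) = half F • e x) ∧
      e (irredVec (half F) h) = u) ∧
    IsSimpleModule (UVir F) (IrredHW (half F) h) := by
  obtain ⟨φ, hφL, hφC⟩ := exists_rep Λ hΛ
  obtain ⟨ψ, hψv, hψ⟩ : ∃ ψ : Verma (half F) h →ₗ[F] M, ψ (vermaVec (half F) h) = u ∧
      ∀ (a : UVir F) x, ψ (a • x) = φ a (ψ x) := by
    refine exists_lift_quotient φ u _ ?_
    rintro x (⟨n, hn, rfl⟩ | rfl | rfl)
    · rw [hφL, hpos n hn]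
    · rw [map_sub, hφL, AlgHom.commutes, LinearMap.sub_apply, hzero, Module.algebraMap_end_apply,
        sub_self]
    · rw [map_sub, hφC, AlgHom.commutes, LinearMap.sub_apply, Module.algebraMap_end_apply,
        LinearMap.smul_apply, Module.End.one_apply, sub_self]
  -- Irreducibility of `M` enters only here, giving both the surjectivity of `ψ` and the maximality
  -- of its kernel.
  have hmap : ∀ P : Submodule (UVir F) (Verma (half F) h), (P.restrictScalars F).map ψ ≠ ⊥ →
      (P.restrictScalars F).map ψ = ⊤ := by
    refine fun P => hirr _ ?_
    rintro n _ ⟨x, hx, rfl⟩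
    exact ⟨opL n • x, P.smul_mem _ hx, by rw [hψ, hφL]⟩
  have hsurj : Function.Surjective ψ := by
    have h1 := hmap ⊤ fun hbot => hu0 (by
      have : u ∈ ((⊤ : Submodule (UVir F) (Verma (half F) h)).restrictScalars F).map ψ :=
        ⟨vermaVec (half F) h, trivial, hψv⟩
      rwa [hbot, Submodule.mem_bot] at this)
    intro y
    obtain ⟨x, -, hx⟩ : y ∈ ((⊤ : Submodule (UVir F) (Verma (half F) h)).restrictScalars F).map ψ :=
      h1 ▸ Submodule.mem_top
    exact ⟨x, hx⟩
  let K : Submodule (UVir F) (Verma (half F) h) :=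
    { carrier := {x | ψ x = 0}
      zero_mem' := map_zero ψ
      add_mem' := fun {x y} hx hy => by
        change ψ (x + y) = 0
        rw [map_add, hx, hy, add_zero]
      smul_mem' := fun a x hx => by
        change ψ (a • x) = 0
        rw [hψ, hx, map_zero] }
  have hKψ : ∀ x, x ∈ K ↔ ψ x = 0 := fun x => Iff.rfl
  have hK : IsCoatom K := by
    refine ⟨fun htop => hu0 ?_, fun P hP => ?_⟩
    · rw [← hψv, ← hKψ, htop]
      trivial
    · obtain ⟨y, hyP, hyK⟩ := SetLike.exists_of_lt hP
      have h1 := hmap P fun hbot => hyK (by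
        have : ψ y ∈ (P.restrictScalars F).map ψ := ⟨y, hyP, rfl⟩
        rwa [hbot, Submodule.mem_bot] at this)
      refine eq_top_iff.2 fun x _ => ?_
      obtain ⟨z, hz, hzx⟩ : ψ x ∈ (P.restrictScalars F).map ψ := h1 ▸ Submodule.mem_top
      have hxz : x - z ∈ K := by rw [hKψ, map_sub, hzx, sub_self]
      rw [← sub_add_cancel x z]
      exact P.add_mem (hP.le hxz) hz
  have hmax : maxGraded (half F) h = K := by
    refine maxGraded_eq_of_isCoatom hK ψ hKψ hG fun n x hx => ?_
    induction hx using Submodule.span_induction with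
    | mem x hx =>
      obtain ⟨l, -, rfl, rfl⟩ := hx
      change ψ (vermaMono _ _ l) ∈ _
      induction l with
      | nil =>
        rw [vermaMono_nil, hψv]
        exact hu
      | cons i l ih =>
        rw [vermaMono_cons, hψ, hφL, List.sum_cons]
        exact hΛG i _ _ ih
    | zero => rw [map_zero]; exact zero_mem _
    | add x y _ _ hx hy => rw [map_add]; exact add_mem hx hy
    | smul r x _ hx => rw [map_smul]; exact Submodule.smul_mem _ _ hx
  have hker : (maxGraded (half F) h).restrictScalars F = LinearMap.ker ψ := by
    rw [hmax]
    rfl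
  let e : IrredHW (half F) h ≃ₗ[F] M :=
    (Submodule.Quotient.restrictScalarsEquiv F (maxGraded (half F) h)).symm ≪≫ₗ
      Submodule.quotEquivOfEq _ _ hker ≪≫ₗ ψ.quotKerEquivOfSurjective hsurj
  have he : ∀ x, e ((maxGraded (half F) h).mkQ x) = ψ x := fun x => rfl
  have hsmul : ∀ (a : UVir F) x, e (a • x) = φ a (e x) := by
    intro a x
    obtain ⟨y, rfl⟩ := (maxGraded (half F) h).mkQ_surjective x
    rw [← map_smul, he, he, hψ]
  refine ⟨⟨e, fun n x => by rw [hsmul, hφL], fun x => by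
    rw [hsmul, hφC, LinearMap.smul_apply, Module.End.one_apply], (he _).trans hψv⟩, ?_⟩
  rw [isSimpleModule_iff_isCoatom, hmax]
  exact hK

/-- A highest weight vector generates the irreducible highest weight module. -/
theorem reducesTo_of_highest_weight (h7 : ringChar F ≠ 7) {h : F} {Z : Sector} {s : ZMod 2}
    {u : Fock.part ZHalf Z s} {d : ℤ} {x : F ⊗[ZHalf] Fock ZHalf Z}
    (hx : Fock.incl F Z s (1 ⊗ₜ u) = x) (hd : x ∈ (Fock.rep F Z).H 1 d s) (hx0 : x ≠ 0)
    (hpos : ∀ n, 0 < n → (Fock.rep F Z).L n x = 0) (hzero : (Fock.rep F Z).L 0 x = h • x) :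
    ReducesTo h Z s u := by
  subst hx
  set R := Fock.rep F Z with hR
  have hinj := Fock.incl_injective F Z s
  have hL := Fock.incl_virOpPart F Z s
  have hrange := Fock.range_incl F Z s
  refine exists_equiv_irredHW (fun n => (virOpPart ZHalf Z s n).baseChange F) (fun m n w => ?_)
    (fun U hU hbot => ?_) (G := fun n : ℕ => (R.H 1 (d + 2 * n) s).comap (Fock.incl F Z s)) ?_
    (fun i n w hw => ?_) ?_ (fun h0 => hx0 (by rw [h0, map_zero])) (fun n hn => hinj ?_) (hinj ?_)
  · apply hinj
    have h1 := R.defect_eq m n (Fock.incl F Z s w)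
    rw [FockRep.defect, sub_eq_iff_eq_add'] at h1
    rw [map_sub, hL, hL, hL, hL, h1, map_add, map_smul, hL]
    split_ifs
    · rw [map_smul]
    · rw [map_zero]
  -- With `g = 0` the degree is forgotten and only parity is left, so `U` need not be graded.
  · have hle : U.map (Fock.incl F Z s) ≤ R.H 0 0 s := by
      refine (LinearMap.map_le_range).trans (hrange.le.trans (Submodule.span_le.2 ?_))
      rintro _ ⟨l, hl, rfl⟩
      have h1 := FockRep.word_mem_H l (FockRep.vac_mem_H (R := R) (g := 0))
      rwa [zero_mul, sub_zero, zero_add, hl] at h1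
    have hW := FockRep.word_vac_mem (W := U.map (Fock.incl F Z s)) (R := R) (by
      rintro n _ ⟨w, hw, rfl⟩
      exact ⟨_, hU n w hw, hL n w⟩) h7 hle (by
      exact fun hb => hbot (Submodule.map_injective_of_injective hinj
        (hb.trans (Submodule.map_bot _).symm)))
    refine eq_top_iff.2 fun w _ => ?_
    have h1 : Fock.incl F Z s w ∈ U.map (Fock.incl F Z s) := by
      refine (hrange.le.trans (Submodule.span_le.2 ?_)) (LinearMap.mem_range_self _ w)
      rintro _ ⟨l, hl, rfl⟩
      exact hW l hl
    obtain ⟨y, hy, hyw⟩ := h1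
    exact hinj hyw ▸ hy
  · have hind := R.iSupIndep_H d s
    rw [iSupIndep_iff_finsetSum_eq_zero_imp_eq_zero] at hind ⊢
    intro S v hv hsum i hi
    refine hinj ((hind S (fun i => Fock.incl F Z s (v i)) hv ?_ i hi).trans (map_zero _).symm)
    rw [← map_sum, hsum, map_zero]
  · rw [Submodule.mem_comap, hL]
    convert FockRep.L_mem_H (-(i : ℤ)) (Submodule.mem_comap.1 hw) using 2
    push_cast
    ring
  · rw [Submodule.mem_comap]
    convert hd using 2
    simp
  · rw [hL, hpos n hn, map_zero]
  · rw [hL, hzero, map_smul]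

end

end Ising

end

/-! ### The four highest weight vectors -/

theorem corollary4p5 {F : Type*} [Field F] [Algebra Ising.ZHalf F]
    (h2 : ringChar F ≠ 2) (h7 : ringChar F ≠ 7) :
    -- `h = 0`, with `L(1/2,0)_R = V(H_R, ℤ + 1/2)_0` and vacuum `1`
    Ising.ReducesTo (0 : F) .halfInt 0 (Ising.monoPart _ _ 0 [] rfl) ∧
    -- `h = 1/2`, with `L(1/2,1/2)_R = V(H_R, ℤ + 1/2)_1` and highest weight vector `a(-1/2)`
    Ising.ReducesTo (Ising.half F) .halfInt 1 (Ising.monoPart _ _ 1 [-1] rfl) ∧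
    -- `h = 1/16`, with `L(1/2,1/16)_R = V(H_R, ℤ)_s` for `s = 0` and for `s = 1`, and highest
    -- weight vector `1` or `a(0)`
    Ising.ReducesTo (Ising.half F ^ 4) .int 0 (Ising.monoPart _ _ 0 [] rfl) ∧
    Ising.ReducesTo (Ising.half F ^ 4) .int 1 (Ising.monoPart _ _ 1 [0] rfl) := by
  have h01 : (1 : ZMod 2) = 0 + 1 := rfl
  refine ⟨?_, ?_, ?_, ?_⟩
  · exact Ising.reducesTo_of_highest_weight h7 (Ising.Fock.incl_monoPart F _ _ _ _)
      Ising.FockRep.vac_mem_H (Ising.FockRep.vac_ne _) (fun n hn => Ising.FockRep.L_vac_of_pos _ hn)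
      (Ising.FockRep.L_vac _ le_rfl)
  · set R := Ising.Fock.rep F .halfInt
    refine Ising.reducesTo_of_highest_weight h7 (Ising.Fock.incl_monoPart F _ _ _ _)
      (h01 ▸ Ising.FockRep.a_mem_H (-1) Ising.FockRep.vac_mem_H) (x := R.a (-1) R.vac)
      (fun h0 => R.vac_ne ?_) (fun n hn => ?_) ?_
    -- For half-integral modes the index `0` encodes `1/2`, which contracts with `-1/2` to give back
    -- the vacuum.
    · have h1 := R.anticomm 0 (-1) R.vac
      rwa [h0, R.ann 0 (by decide), map_zero, map_zero, add_zero, if_pos (by decide), eq_comm] at h1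
    · rw [R.L_a_vac hn.le, R.ann (-1 + n) (by change 0 < 2 * (-1 + n) + 1; omega), smul_zero,
        sub_zero]
      exact zero_smul _ _
    · rw [R.L_a_vac le_rfl, add_zero, ← sub_smul]
      congr 1
      simp only [Ising.constTerm, Ising.FockRep.kap, Ising.Sector.shift]
      push_cast
      linear_combination -Ising.two_mul_half F
  · exact Ising.reducesTo_of_highest_weight h7 (Ising.Fock.incl_monoPart F _ _ _ _)
      Ising.FockRep.vac_mem_H (Ising.FockRep.vac_ne _) (fun n hn => Ising.FockRep.L_vac_of_pos _ hn)
      (Ising.FockRep.L_vac _ le_rfl)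
  · set R := Ising.Fock.rep F .int
    refine Ising.reducesTo_of_highest_weight h7 (Ising.Fock.incl_monoPart F _ _ _ _)
      (h01 ▸ Ising.FockRep.a_mem_H 0 Ising.FockRep.vac_mem_H) (x := R.a 0 R.vac)
      (fun h0 => R.vac_ne ?_) (fun n hn => ?_) ?_
    -- For integral modes `2 a(0)²` is the identity, so `a(0) vac` cannot vanish.
    · have h1 := R.anticomm 0 0 R.vac
      rwa [h0, map_zero, add_zero, if_pos (by decide), eq_comm] at h1
    · rw [R.L_a_vac hn.le, R.ann (0 + n) (by change 0 < 2 * (0 + n) + 0; omega), smul_zero,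
        sub_zero, Ising.FockRep.constTerm_of_ne hn.ne', zero_smul]
    · rw [R.L_a_vac le_rfl, add_zero, ← sub_smul]
      congr 1
      simp [Ising.constTerm, Ising.FockRep.kap, Ising.Sector.shift]
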